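/- Let $k$ be an algebraically closed field of characteristic $p>0$ and let $X$ be a projective curve over $k$ (a one-dimensional integral regular scheme, proper over $k$). Let $G$ be a cyclic group of order $p^v$ with $v\ge 2$, acting faithfully and admissibly on $X$ over $k$; let $H$ be its subgroup of order $p^{v-1}$ and $P=G/H$. Write $X\xrightarrow{\alpha}Z=X/H\xrightarrow{\beta}Y=Z/P=X/G$ for the quotient morphisms and $\pi=\beta\circ\alpha$. Choose generators $\sigma$, $\tau$, $\varepsilon$ of $G$, $H$, $P$. For $i\ge 0$ let $V_i$ denote $k[G]/(\sigma-1)^i$, $k[H]/(\tau-1)^i$ or $k[P]/(\varepsilon-1)^i$, according to the group considered (so $V_0=0$). A $G$-sheaf on $X$ is a quasi-coherent sheaf $\mathcal F$ of $\mathcal O_X$-modules with $\mathcal O_X$-linear morphisms $\psi_g:g_*\mathcal F\to\mathcal F$ ($g\in G$) such that $\psi_1=1$ and $\psi_{hg}=\psi_h\circ h_*\psi_g$. For a $k[G]$-module $V$ of finite type let $\underline{\mathcal F}(V)=\pi_*^G\,\mathcal{H}om_{\mathcal O_X}(s_X^*V,\mathcal F)$, where $s_X:X\to\operatorname{Spec}k$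 is the structure morphism and $\pi_*^G$ denotes the $G$-invariants of the direct image; that is, $\underline{\mathcal F}(V)$ is the sheaf $U\mapsto \operatorname{Hom}_{k[G]}(V,\mathcal F(\pi^{-1}U))$ of $\mathcal O_Y$-modules. For $i\ge 1$ let $$\mathrm{gr}^G_0\,\underline{\mathcal F}(V_i)=\operatorname{coker}\bigl(\underline{\mathcal F}(V_{i-1})\to\underline{\mathcal F}(V_i)\bigr),$$ the map being induced by the projection $V_i\to V_{i-1}$. Define $\mathrm{gr}_0^H$ (for $H$ and $\alpha$) and $\mathrm{gr}_0^P$ (for $P$ and $\beta$) in the same way. If $\mathcal L$ is a $G$-sheaf on $X$, then $G$ acts on $\mathrm{gr}_0^H\underline{\mathcal L}(V_l)$ by the action induced by $(g f)(v)=g\,f(v)$ on $H$-equivariant maps $f:V_l\to\mathcal L(\alpha^{-1}U)$; the subgroup $H$ acts trivially, so that $\mathrm{gr}_0^H\underline{\mathcal L}(V_l)$ is a $P$-sheaf on $Z$. Let $\mathcal L$ be a $G$-sheaf on $X$ that is invertible as an $\mathcal O_X$-module, let $1\le j\le p^v$, and write $j=(l-1)p+j'$ with $1\le l\le p^{v-1}$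 and $1\le j'\le p$. Then $\mathrm{gr}_0^G\,\underline{\mathcal L}(V_j)$ and $\mathrm{gr}_0^P\,\underline{\mathrm{gr}_0^H\,\underline{\mathcal L}(V_l)}\,(V_{j'})$ are invertible sheaves on $Y$, and there is an isomorphism of sheaves of $\mathcal O_Y$-modules $$\mathrm{gr}_0^G\,\underline{\mathcal L}(V_j)\;\simeq\;\mathrm{gr}_0^P\,\underline{\mathrm{gr}_0^H\,\underline{\mathcal L}(V_l)}\,(V_{j'}).$$ -/

import Mathlib

universe u
open CategoryTheory AlgebraicGeometry TopologicalSpace Opposite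

namespace ModularSheaf
noncomputable section

variable {k : Type u} [Field k] {G : Type u} [Group G]

/-- The structure map `k → 𝒪_Y(U)` of a scheme `s : Y ⟶ Spec k`. -/
def scalar {Y : Scheme.{u}} (s : Y ⟶ Spec (CommRingCat.of k)) (U : Y.Opens) : k →+* Γ(Y, U) :=
  ((Scheme.ΓSpecIso (CommRingCat.of k)).inv ≫ s.appLE ⊤ U le_top).hom

lemma scalar_map {Y : Scheme.{u}} (s : Y ⟶ Spec (CommRingCat.of k)) {U V : Y.Opens}
    (i : V ⟶ U) (c : k) :
    Y.presheaf.map i.op (scalar s U c) = scalar s V c := by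
  rw [scalar, scalar, ← Scheme.Hom.appLE_map s (U := ⊤) (V := U) le_top i.op]
  rfl

section Hom

variable {Y : Scheme.{u}} (s : Y ⟶ Spec (CommRingCat.of k)) (M : Y.Modules) (a : G →* End M)
    (V : Type u) [AddCommGroup V] [Module (MonoidAlgebra k G) V]

/-- The `k[G]`-linear maps `V → M(U)`, where `M` is an `𝒪_Y`-module on a `k`-scheme `Y` on which `G`
acts by `𝒪_Y`-linear endomorphisms: an additive map `f` with `f ((c g) v) = c (g (f v))` for `g ∈ G`,
`c ∈ k`. It is an `𝒪_Y(U)`-module through `M(U)`. -/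
def equivariantHoms (U : Y.Opens) : Submodule Γ(Y, U) (V → Γ(M, U)) where
  carrier := {f | (∀ v w, f (v + w) = f v + f w) ∧
    ∀ (g : G) (c : k) (v : V), f (MonoidAlgebra.single g c • v) =
      scalar s U c • Scheme.Modules.Hom.app (a g) U (f v)}
  add_mem' := by
    rintro f f' ⟨h1, h2⟩ ⟨h3, h4⟩
    refine ⟨fun v w => ?_, fun g c v => ?_⟩
    · simp only [Pi.add_apply, h1, h3]; abel
    · simp only [Pi.add_apply, h2, h4, map_add, smul_add]
  zero_mem' := ⟨fun v w => by simp, fun g c v => by simp⟩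
  smul_mem' := by
    rintro r f ⟨h1, h2⟩
    refine ⟨fun v w => ?_, fun g c v => ?_⟩
    · simp only [Pi.smul_apply, h1, smul_add]
    · simp only [Pi.smul_apply, h2, Scheme.Modules.Hom.app_smul]
      rw [smul_comm]

variable {M} in
lemma app_map {N : Y.Modules} (φ : M ⟶ N) {U W : Y.Opens} (i : W ⟶ U) (x : Γ(M, U)) :
    φ.app W (M.presheaf.map i.op x) = N.presheaf.map i.op (φ.app U x) :=
  ConcreteCategory.congr_hom (φ.mapPresheaf.naturality i.op) x

/-- Restriction of `k[G]`-linear maps `V → M(U)` to `V → M(W)`, for `W ⊆ U`. -/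
def equivariantHomsRes {U W : Y.Opens} (i : W ⟶ U) :
    equivariantHoms s M a V U →+ equivariantHoms s M a V W where
  toFun f := ⟨fun v => M.presheaf.map i.op (f.1 v), by
    refine ⟨fun v w => ?_, fun g c v => ?_⟩ <;> dsimp only
    · rw [f.2.1, map_add]
    · rw [f.2.2, Scheme.Modules.map_smul, scalar_map, app_map]⟩
  map_zero' := by ext; simp
  map_add' f f' := by ext; simp

/-- The presheaf `U ↦ Hom_{k[G]}(V, M(U))` of abelian groups. -/
def equivariantHomsPresheaf : TopCat.Presheaf Ab Y where
  obj U := AddCommGrpCat.of (equivariantHoms s M a V U.unop)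
  map i := AddCommGrpCat.ofHom (equivariantHomsRes s M a V i.unop)
  map_id U := by
    ext f v
    exact ConcreteCategory.congr_hom (M.presheaf.map_id U) (f.1 v)
  map_comp i j := by
    ext f v
    exact ConcreteCategory.congr_hom (M.presheaf.map_comp i j) (f.1 v)

instance (U : (Opens Y)ᵒᵖ) : Module (Y.ringCatSheaf.obj.obj U)
    ((equivariantHomsPresheaf s M a V).obj U) :=
  inferInstanceAs (Module Γ(Y, U.unop) (equivariantHoms s M a V U.unop))

lemma equivariantHomsPresheaf_isSheaf : (equivariantHomsPresheaf s M a V).IsSheaf := by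
  rw [TopCat.Presheaf.isSheaf_iff_isSheafUniqueGluing]
  intro ι U sf hsf
  have hM : TopCat.Presheaf.IsSheafUniqueGluing M.presheaf :=
    (TopCat.Presheaf.isSheaf_iff_isSheafUniqueGluing _).1 M.isSheaf
  have key : ∀ v : V, ∃! s : Γ(M, iSup U),
      TopCat.Presheaf.IsGluing M.presheaf U (fun i => (sf i).1 v) s := fun v => by
    refine hM U _ fun i j => ?_
    exact congrArg (fun f : equivariantHoms s M a V _ => f.1 v) (hsf i j)
  choose t ht hu using key
  have hmem : t ∈ equivariantHoms s M a V (iSup U) := by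
    refine ⟨fun v w => (hu _ _ ?_).symm, fun g c v => (hu _ _ ?_).symm⟩
    · intro i
      have h1 := ht v i
      have h2 := ht w i
      dsimp only at h1 h2 ⊢
      rw [map_add, h1, h2, (sf i).2.1]
    · intro i
      have h1 := ht v i
      dsimp only at h1 ⊢
      rw [(sf i).2.2, ← h1, Scheme.Modules.map_smul, scalar_map, app_map]
  refine ⟨⟨t, hmem⟩, fun i => Subtype.ext (funext fun v => ht v i), ?_⟩
  intro t' ht'
  apply Subtype.ext; funext v
  exact hu v _ fun i => congrArg (fun f : equivariantHoms s M a V _ => f.1 v) (ht' i)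

/-- The sheaf of `𝒪_Y`-modules `U ↦ Hom_{k[G]}(V, M(U))`. -/
def homSheaf : Y.Modules where
  val := PresheafOfModules.ofPresheaf (equivariantHomsPresheaf s M a V) (by
      intro U W i r f
      apply Subtype.ext; funext v
      exact Scheme.Modules.map_smul M i.unop r (f.1 v))
  isSheaf := equivariantHomsPresheaf_isSheaf s M a V

variable {M a V} in
/-- A family of maps on sections, additive, linear and natural, as a morphism of sheaves. -/
def mkHom {M N : Y.Modules} (φ : ∀ U : Y.Opens, Γ(M, U) →+ Γ(N, U))
    (hφ : ∀ U (r : Γ(Y, U)) (x : Γ(M, U)), φ U (r • x) = r • φ U x)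
    (hn : ∀ {U W : Y.Opens} (i : W ⟶ U) (x : Γ(M, U)),
      φ W (M.presheaf.map i.op x) = N.presheaf.map i.op (φ U x)) : M ⟶ N where
  val := PresheafOfModules.homMk
    { app U := AddCommGrpCat.ofHom (φ U.unop)
      naturality U W i := by ext x; exact hn i.unop x } (fun U r x => hφ U.unop r x)

lemma mkHom_app {M N : Y.Modules} (φ : ∀ U : Y.Opens, Γ(M, U) →+ Γ(N, U)) (hφ) (hn) (U : Y.Opens)
    (x : Γ(M, U)) : (mkHom φ hφ hn).app U x = φ U x := rfl

variable {V} in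
/-- The map `Hom_{k[G]}(V, M) ⟶ Hom_{k[G]}(W, M)` given by composition with `q : W → V`. -/
def homSheafMap {W : Type u} [AddCommGroup W] [Module (MonoidAlgebra k G) W]
    (q : W →ₗ[MonoidAlgebra k G] V) : homSheaf s M a V ⟶ homSheaf s M a W :=
  mkHom (fun U =>
    { toFun := fun f => (⟨fun w => f.1 (q w), fun v w => by simp only [map_add, f.2.1],
        fun g c v => by simp only [map_smul, f.2.2]⟩ : equivariantHoms s M a W U)
      map_zero' := rfl
      map_add' := fun _ _ => rfl } : ∀ U : Y.Opens, equivariantHoms s M a V U →+ equivariantHoms s M a W U)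
    (fun _ _ _ => rfl) (fun _ _ => rfl)

end Hom


section Transport

open Scheme.Modules

variable {X Y Z : Scheme.{u}}

lemma map_map (M : X.Modules) {U V W : X.Opens} (i : U ⟶ V) (j : V ⟶ W) (x : Γ(M, W)) :
    M.presheaf.map i.op (M.presheaf.map j.op x) = M.presheaf.map (i ≫ j).op x := by
  rw [op_comp, Functor.map_comp]; rfl

lemma map_self (M : X.Modules) {U : X.Opens} (i : U ⟶ U) (x : Γ(M, U)) :
    M.presheaf.map i.op x = x := by
  rw [Subsingleton.elim i (𝟙 U), op_id]
  exact ConcreteCategory.congr_hom (M.presheaf.map_id _) x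

/-- The map `M(W) → N(U)` on sections given by a morphism of sheaves `φ : f_* M ⟶ N`, where `W` is
the open set `f⁻¹ U`. -/
def sec {f : X ⟶ Y} {M : X.Modules} {N : Y.Modules} (φ : (pushforward f).obj M ⟶ N)
    (U : Y.Opens) (W : X.Opens) (e : f ⁻¹ᵁ U = W) : Γ(M, W) →+ Γ(N, U) :=
  AddMonoidHom.comp (M := Γ(M, W)) (N := Γ(M, f ⁻¹ᵁ U)) (P := Γ(N, U))
    (φ.app U).hom (M.presheaf.map (eqToHom e).op).hom

lemma sec_self {f : X ⟶ Y} {M : X.Modules} {N : Y.Modules} (φ : (pushforward f).obj M ⟶ N)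
    (U : Y.Opens) (x : Γ(M, f ⁻¹ᵁ U)) :
    sec φ U (f ⁻¹ᵁ U) rfl x = φ.app U x :=
  congrArg (φ.app U) (map_self M _ x)

lemma sec_ext {f : X ⟶ Y} {M : X.Modules} {N : Y.Modules} {φ ψ : (pushforward f).obj M ⟶ N}
    (h : ∀ (U : Y.Opens) (x : Γ(M, f ⁻¹ᵁ U)), sec φ U _ rfl x = sec ψ U _ rfl x) : φ = ψ := by
  refine Scheme.Modules.hom_ext _ _ fun U => ?_
  ext x
  exact ((sec_self φ U x).symm.trans (h U x)).trans (sec_self ψ U x)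

lemma sec_map {f : X ⟶ Y} {M : X.Modules} {N : Y.Modules} (φ : (pushforward f).obj M ⟶ N)
    {U U' : Y.Opens} {W W' : X.Opens} (e : f ⁻¹ᵁ U = W) (e' : f ⁻¹ᵁ U' = W') (i : U' ⟶ U)
    (j : W' ⟶ W) (x : Γ(M, W)) :
    sec φ U' W' e' (M.presheaf.map j.op x) = N.presheaf.map i.op (sec φ U W e x) := by
  subst e e'
  rw [sec_self, sec_self]
  exact app_map φ i x

lemma sec_smul {f : X ⟶ Y} {M : X.Modules} {N : Y.Modules} (φ : (pushforward f).obj M ⟶ N)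
    (U : Y.Opens) (r : Γ(Y, U)) (x : Γ(M, f ⁻¹ᵁ U)) :
    sec φ U _ rfl (f.app U r • x) = r • sec φ U _ rfl x := by
  rw [sec_self, sec_self]
  exact φ.app_smul r x

lemma sec_comp {f : X ⟶ Y} {M : X.Modules} {N N' : Y.Modules} (φ : (pushforward f).obj M ⟶ N)
    (ψ : N ⟶ N') {U : Y.Opens} {W : X.Opens} (e : f ⁻¹ᵁ U = W) (x : Γ(M, W)) :
    sec (φ ≫ ψ) U W e x = ψ.app U (sec φ U W e x) := rfl


lemma appLE_of_eq {f f' : X ⟶ Y} (h : f = f') {U : Y.Opens} {V : X.Opens} (e : V ≤ f ⁻¹ᵁ U)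
    (e' : V ≤ f' ⁻¹ᵁ U) : f.appLE U V e = f'.appLE U V e' := by
  subst h; rfl

lemma sec_smul_appLE {f : X ⟶ Y} {M : X.Modules} {N : Y.Modules} (φ : (pushforward f).obj M ⟶ N)
    {U : Y.Opens} {W : X.Opens} (e : f ⁻¹ᵁ U = W) (r : Γ(Y, U)) (x : Γ(M, W)) :
    sec φ U W e (f.appLE U W e.ge r • x) = r • sec φ U W e x := by
  subst e
  rw [← sec_smul, Scheme.Hom.app_eq_appLE]

end Transport


/-- The automorphism by which `g` acts on `X`; it is covariant: `hg` acts by `h ∘ g`. -/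
def actHom {X : Scheme.{u}} (ρ : G →* Aut X) (g : G) : X ⟶ X := (ρ g).hom

lemma actHom_one {X : Scheme.{u}} (ρ : G →* Aut X) : actHom ρ 1 = 𝟙 X := by
  rw [actHom, map_one]; rfl

lemma actHom_mul {X : Scheme.{u}} (ρ : G →* Aut X) (h g : G) :
    actHom ρ (h * g) = actHom ρ g ≫ actHom ρ h := by
  rw [actHom, map_mul]; rfl

open Scheme.Modules in
/-- A `G`-sheaf on `X`: an `𝒪_X`-module `F` with morphisms `ψ_g : g_* F ⟶ F` for `g ∈ G`, such that
`ψ_1 = 1` and `ψ_{hg} = ψ_h ∘ h_* ψ_g`. Both rules are written on sections over every open set `U`: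
`ψ_g` maps `F(g⁻¹ U)` to `F(U)`, and the second rule compares two maps
`F((hg)⁻¹ U) = F(g⁻¹ h⁻¹ U) → F(U)`. Quasi-coherence is a property of `F`, which the invertible
sheaves have. -/
structure GSheaf {X : Scheme.{u}} (ρ : G →* Aut X) where
  sheaf : X.Modules
  lin (g : G) : (pushforward (actHom ρ g)).obj sheaf ⟶ sheaf
  lin_one (U : X.Opens) (e : actHom ρ 1 ⁻¹ᵁ U = U) (x : Γ(sheaf, U)) : sec (lin 1) U U e x = x
  lin_mul (h g : G) (U V W : X.Opens) (e : actHom ρ h ⁻¹ᵁ U = V) (e' : actHom ρ g ⁻¹ᵁ V = W)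
    (e'' : actHom ρ (h * g) ⁻¹ᵁ U = W) (x : Γ(sheaf, W)) :
    sec (lin (h * g)) U W e'' x = sec (lin h) U V e (sec (lin g) V W e' x)

namespace GSheaf

open Scheme.Modules

variable {X : Scheme.{u}} {ρ : G →* Aut X} (F : GSheaf ρ)

/-- A `G`-sheaf regarded as an `H`-sheaf, for a subgroup `H` of `G`. -/
def restrict (H : Subgroup G) : GSheaf (ρ.comp H.subtype) where
  sheaf := F.sheaf
  lin h := F.lin h
  lin_one := F.lin_one
  lin_mul h g := F.lin_mul h g

section act
variable {T : Scheme.{u}} (f : X ⟶ T) (hf : ∀ g, actHom ρ g ≫ f = f)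

lemma preimage_invariant (hf : ∀ g, actHom ρ g ≫ f = f) (g : G) (U : T.Opens) : actHom ρ g ⁻¹ᵁ f ⁻¹ᵁ U = f ⁻¹ᵁ U := by
  change (actHom ρ g ≫ f) ⁻¹ᵁ U = _
  rw [hf]

/-- The `𝒪_T`-linear action of `G` on `f_* F`, for a `G`-invariant morphism `f : X ⟶ T`: on
`(f_* F)(U) = F(f⁻¹ U)`, the element `g` acts through `ψ_g`. -/
def act : G →* End ((pushforward f).obj F.sheaf) where
  toFun g := mkHom (M := (pushforward f).obj F.sheaf) (N := (pushforward f).obj F.sheaf)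
    (fun U => sec (F.lin g) (f ⁻¹ᵁ U) (f ⁻¹ᵁ U) (preimage_invariant f hf g U))
    (fun U r x => by
      have h : f.app U r = (actHom ρ g).appLE (f ⁻¹ᵁ U) (f ⁻¹ᵁ U)
          (preimage_invariant f hf g U).ge (f.app U r) := by
        have h1 := (Scheme.Hom.comp_appLE (actHom ρ g) f U (f ⁻¹ᵁ U) (by rw [hf])).symm.trans
          (appLE_of_eq (hf g) _ le_rfl)
        rw [Scheme.Hom.appLE_eq_app] at h1
        exact (ConcreteCategory.congr_hom h1 r).symm
      refine Eq.trans ?_ (sec_smul_appLE (F.lin g) (preimage_invariant f hf g U) (f.app U r) x)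
      rw [← h]; rfl)
    (fun i x => sec_map _ _ _ _ _ _)
  map_one' := Scheme.Modules.hom_ext _ _ fun U => by
    ext x
    exact F.lin_one _ _ x
  map_mul' h g := Scheme.Modules.hom_ext _ _ fun U => by
    ext x
    exact F.lin_mul h g _ _ _ _ _ _ x

lemma act_app (g : G) (U : T.Opens) (x : Γ(F.sheaf, f ⁻¹ᵁ U)) :
    Scheme.Modules.Hom.app (F.act f hf g) U x =
      sec (F.lin g) (f ⁻¹ᵁ U) (f ⁻¹ᵁ U) (preimage_invariant f hf g U) x := rfl

end act

section push
variable {Z : Scheme.{u}} {ρZ : G →* Aut Z} (α : X ⟶ Z)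
  (hα : ∀ g, actHom ρ g ≫ α = α ≫ actHom ρZ g)

lemma preimage_push (hα : ∀ g, actHom ρ g ≫ α = α ≫ actHom ρZ g) (g : G) {U V : Z.Opens} (e : actHom ρZ g ⁻¹ᵁ U = V) :
    actHom ρ g ⁻¹ᵁ α ⁻¹ᵁ U = α ⁻¹ᵁ V := by
  subst e
  change (actHom ρ g ≫ α) ⁻¹ᵁ U = (α ≫ actHom ρZ g) ⁻¹ᵁ U
  rw [hα]

/-- The linearization of `α_* F` given by that of `F`, for an equivariant morphism `α : X ⟶ Z`. -/
def pushLin (g : G) : (pushforward (actHom ρZ g)).obj ((pushforward α).obj F.sheaf) ⟶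
    (pushforward α).obj F.sheaf :=
  mkHom (M := (pushforward (actHom ρZ g)).obj ((pushforward α).obj F.sheaf))
    (N := (pushforward α).obj F.sheaf)
    (fun U => sec (F.lin g) (α ⁻¹ᵁ U) (α ⁻¹ᵁ actHom ρZ g ⁻¹ᵁ U) (preimage_push α hα g rfl))
    (fun U r x => by
      have h : α.app _ ((actHom ρZ g).app U r) =
          (actHom ρ g).appLE (α ⁻¹ᵁ U) (α ⁻¹ᵁ actHom ρZ g ⁻¹ᵁ U)
          (preimage_push α hα g rfl).ge (α.app U r) := by
        have h1 := (Scheme.Hom.comp_appLE (actHom ρ g) α U (α ⁻¹ᵁ actHom ρZ g ⁻¹ᵁ U)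
          (preimage_push α hα g rfl).ge).symm.trans ((appLE_of_eq (hα g) _ le_rfl).trans
          (Scheme.Hom.comp_appLE α (actHom ρZ g) U (α ⁻¹ᵁ actHom ρZ g ⁻¹ᵁ U) le_rfl))
        have h2 := h1.trans (congrArg ((actHom ρZ g).app U ≫ ·) (Scheme.Hom.appLE_eq_app α))
        replace h1 := h2
        exact (ConcreteCategory.congr_hom h1 r).symm
      refine Eq.trans ?_ (sec_smul_appLE (F.lin g) (preimage_push α hα g rfl) (α.app U r) x)
      rw [← h]; rfl)
    (fun i x => sec_map _ _ _ _ _ _)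

lemma sec_pushLin (g : G) {U V : Z.Opens} (e : actHom ρZ g ⁻¹ᵁ U = V) (x : Γ(F.sheaf, α ⁻¹ᵁ V)) :
    sec (F.pushLin α hα g) U V e x =
      sec (F.lin g) (α ⁻¹ᵁ U) (α ⁻¹ᵁ V) (preimage_push α hα g e) x := by
  subst e
  exact sec_self (F.pushLin α hα g) U x

/-- The direct image `α_* F` of a `G`-sheaf along an equivariant morphism `α : X ⟶ Z`. -/
def push : GSheaf ρZ where
  sheaf := (pushforward α).obj F.sheaf
  lin := F.pushLin α hα
  lin_one U e x := (F.sec_pushLin α hα 1 e x).trans (F.lin_one _ _ x)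
  lin_mul h g U V W e e' e'' x :=
    (F.sec_pushLin α hα _ e'' x).trans
      ((F.lin_mul h g _ _ _ (preimage_push α hα h e) (preimage_push α hα g e') _ x).trans (by
        refine Eq.trans ?_ (F.sec_pushLin α hα h e _).symm
        exact congrArg _ (F.sec_pushLin α hα g e' x).symm))

end push


section hom

variable (s : X ⟶ Spec (CommRingCat.of k)) (hs : ∀ g, actHom ρ g ≫ s = s)
  {H : Type u} [Group H] (a : H →* End F.sheaf)
  (ha : ∀ (g : G) (h : H) (U V : X.Opens) (e : actHom ρ g ⁻¹ᵁ U = V) (x : Γ(F.sheaf, V)),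
    sec (F.lin g) U V e (Scheme.Modules.Hom.app (a h) V x) =
      Scheme.Modules.Hom.app (a h) U (sec (F.lin g) U V e x))
  (V : Type u) [AddCommGroup V] [Module (MonoidAlgebra k H) V]

lemma scalar_actHom (hs : ∀ g, actHom ρ g ≫ s = s) (g : G) (U : X.Opens) (c : k) :
    (actHom ρ g).app U (scalar s U c) = scalar s (actHom ρ g ⁻¹ᵁ U) c := by
  have h2 : s.appLE ⊤ U le_top ≫ (actHom ρ g).app U = s.appLE ⊤ (actHom ρ g ⁻¹ᵁ U) le_top := by
    rw [Scheme.Hom.app_eq_appLE]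
    exact (Scheme.Hom.appLE_comp_appLE (actHom ρ g) s ⊤ U _ le_top le_rfl).trans
      (appLE_of_eq (hs g) _ le_top)
  exact ConcreteCategory.congr_hom h2 _

/-- The linearization of `U ↦ Hom_{k[H]}(V, F(U))` given by composition with that of `F`. -/
def homLin (g : G) : (pushforward (actHom ρ g)).obj (homSheaf s F.sheaf a V) ⟶
    homSheaf s F.sheaf a V :=
  mkHom (M := (pushforward (actHom ρ g)).obj (homSheaf s F.sheaf a V))
    (fun U =>
    { toFun := fun f => (⟨fun v => sec (F.lin g) U _ rfl (f.1 v),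
        fun v w => by simp only [f.2.1, map_add],
        fun h c v => by
          simp only [f.2.2]
          rw [← scalar_actHom s hs g U c, sec_smul, ha]⟩ : equivariantHoms s F.sheaf a V U)
      map_zero' := Subtype.ext (funext fun v => map_zero _)
      map_add' := fun f f' => Subtype.ext (funext fun v => map_add _ _ _) } :
        ∀ U : X.Opens, equivariantHoms s F.sheaf a V (actHom ρ g ⁻¹ᵁ U) →+
          equivariantHoms s F.sheaf a V U)
    (fun U r f => Subtype.ext (funext fun v => sec_smul (F.lin g) U r (f.1 v)))
    (fun i f => Subtype.ext (funext fun v => sec_map (F.lin g) _ _ _ _ (f.1 v)))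

lemma sec_homLin (g : G) {U W : X.Opens} (e : actHom ρ g ⁻¹ᵁ U = W)
    (f : equivariantHoms s F.sheaf a V W) (v : V) :
    Subtype.val (p := (· ∈ equivariantHoms s F.sheaf a V U))
      (sec (F.homLin s hs a ha V g) U W e f) v = sec (F.lin g) U W e (f.1 v) := by
  subst e
  exact congrArg (fun t : equivariantHoms s F.sheaf a V U => t.1 v)
    (sec_self (F.homLin s hs a ha V g) U f)

/-- Let `F` be a `G`-sheaf on which `H` also acts by `𝒪_X`-linear maps that commute with the
linearization. Then `U ↦ Hom_{k[H]}(V, F(U))` is a `G`-sheaf, by `(g f)(v) = g (f v)`. -/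
def hom : GSheaf ρ where
  sheaf := homSheaf s F.sheaf a V
  lin := F.homLin s hs a ha V
  lin_one U e x := Subtype.ext (funext fun v =>
    (F.sec_homLin s hs a ha V 1 e x v).trans (F.lin_one U e _))
  lin_mul h g U V' W e e' e'' x := Subtype.ext (funext fun v => by
    refine (F.sec_homLin s hs a ha V _ e'' x v).trans ?_
    refine Eq.trans ?_ (F.sec_homLin s hs a ha V h e _ v).symm
    refine (F.lin_mul h g U V' W e e' e'' _).trans ?_
    exact congrArg _ (F.sec_homLin s hs a ha V g e' x v).symm)

lemma hom_naturality {W : Type u} [AddCommGroup W] [Module (MonoidAlgebra k H) W]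
    (q : W →ₗ[MonoidAlgebra k H] V) (g : G) :
    (pushforward (actHom ρ g)).map (homSheafMap s F.sheaf a q) ≫ (F.hom s hs a ha W).lin g =
      (F.hom s hs a ha V).lin g ≫ homSheafMap s F.sheaf a q := rfl

end hom

section cokernel

open Limits

instance pushforward_isEquivalence (g : G) : (pushforward (actHom ρ g)).IsEquivalence := by
  have h1 : actHom ρ g ≫ actHom ρ g⁻¹ = 𝟙 X := by rw [← actHom_mul, inv_mul_cancel, actHom_one]
  have h2 : actHom ρ g⁻¹ ≫ actHom ρ g = 𝟙 X := by rw [← actHom_mul, mul_inv_cancel, actHom_one]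
  exact (CategoryTheory.Equivalence.mk (pushforward (actHom ρ g)) (pushforward (actHom ρ g⁻¹))
    ((pushforwardComp _ _ ≪≫ pushforwardCongr h1 ≪≫ pushforwardId X).symm)
    (pushforwardComp _ _ ≪≫ pushforwardCongr h2 ≪≫ pushforwardId X)).isEquivalence_functor

variable {A B : GSheaf ρ} (φ : A.sheaf ⟶ B.sheaf)
  (hφ : ∀ g, (pushforward (actHom ρ g)).map φ ≫ B.lin g = A.lin g ≫ φ)

/-- The linearization induced on the cokernel of a morphism of `G`-sheaves. -/
def cokernelLin (g : G) : (pushforward (actHom ρ g)).obj (cokernel φ) ⟶ cokernel φ :=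
  (PreservesCokernel.iso (pushforward (actHom ρ g)) φ).hom ≫
    cokernel.map _ _ (A.lin g) (B.lin g) (hφ g)

lemma map_π_cokernelLin (g : G) :
    (pushforward (actHom ρ g)).map (cokernel.π φ) ≫ cokernelLin φ hφ g =
      B.lin g ≫ cokernel.π φ := by
  rw [cokernelLin, ← Category.assoc, PreservesCokernel.π_iso_hom, cokernel.π_desc]

lemma sec_cokernelLin (g : G) {U V : X.Opens} (e : actHom ρ g ⁻¹ᵁ U = V) (x : Γ(B.sheaf, V)) :
    sec (cokernelLin φ hφ g) U V e ((cokernel.π φ).app V x) =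
      (cokernel.π φ).app U (sec (B.lin g) U V e x) := by
  subst e
  rw [sec_self, sec_self]
  exact ConcreteCategory.congr_hom (congrArg (fun t => Scheme.Modules.Hom.app t U)
    (map_π_cokernelLin φ hφ g)) x

lemma sec_cokernelLin_eq_self (g : G) (hg : actHom ρ g = 𝟙 X) (t : B.sheaf ⟶ A.sheaf)
    (ht : ∀ (U : X.Opens) (e : actHom ρ g ⁻¹ᵁ U = U) (y : Γ(B.sheaf, U)),
      sec (B.lin g) U U e y = φ.app U (t.app U y) + y)
    (U : X.Opens) (e : actHom ρ g ⁻¹ᵁ U = U) (x : Γ(Limits.cokernel φ, U)) :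
    sec (cokernelLin φ hφ g) U U e x = x := by
  have e1 : ∀ U : X.Opens, actHom ρ g ⁻¹ᵁ U = U := fun U => by rw [hg]; rfl
  let θ : Limits.cokernel φ ⟶ Limits.cokernel φ :=
    mkHom (fun U => sec (cokernelLin φ hφ g) U U (e1 U))
      (fun U r x => by
        refine Eq.trans ?_ (sec_smul_appLE (cokernelLin φ hφ g) (e1 U) r x)
        have h1 : (actHom ρ g).appLE U U (e1 U).ge = 𝟙 _ :=
          (appLE_of_eq hg _ (le_refl U)).trans (Scheme.Hom.appLE_eq_app (𝟙 X))
        rw [h1]; rfl)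
      (fun i x => sec_map _ _ _ _ _ _)
  have hθ : θ = 𝟙 _ := by
    rw [← cancel_epi (Limits.cokernel.π φ)]
    refine Scheme.Modules.hom_ext _ _ fun U => ?_
    ext y
    refine (sec_cokernelLin φ hφ g (e1 U) y).trans ?_
    rw [ht]
    have h1 : (Limits.cokernel.π φ).app U (φ.app U (t.app U y)) = 0 := by
      rw [← ConcreteCategory.comp_apply, ← Scheme.Modules.Hom.comp_app,
        Limits.cokernel.condition, Scheme.Modules.Hom.zero_app]
      rfl
    rw [map_add, h1, zero_add]
    rfl
  exact ConcreteCategory.congr_hom (congrArg (fun t => Scheme.Modules.Hom.app t U) hθ) x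

/-- The cokernel of a morphism of `G`-sheaves, as a `G`-sheaf. -/
def cokernel : GSheaf ρ where
  sheaf := Limits.cokernel φ
  lin := cokernelLin φ hφ
  lin_one U e x := by
    have e1 : ∀ U : X.Opens, actHom ρ 1 ⁻¹ᵁ U = U := fun U => by rw [actHom_one]; rfl
    let θ : Limits.cokernel φ ⟶ Limits.cokernel φ :=
      mkHom (fun U => sec (cokernelLin φ hφ 1) U U (e1 U))
        (fun U r x => by
          refine Eq.trans ?_ (sec_smul_appLE (cokernelLin φ hφ 1) (e1 U) r x)
          have h1 : (actHom ρ 1).appLE U U (e1 U).ge = 𝟙 _ :=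
            (appLE_of_eq (actHom_one ρ) _ (le_refl U)).trans (Scheme.Hom.appLE_eq_app (𝟙 X))
          rw [h1]; rfl)
        (fun i x => sec_map _ _ _ _ _ _)
    have hθ : θ = 𝟙 _ := by
      rw [← cancel_epi (cokernel.π φ)]
      refine Scheme.Modules.hom_ext _ _ fun U => ?_
      ext y
      refine (sec_cokernelLin φ hφ 1 (e1 U) y).trans ?_
      rw [B.lin_one]; rfl
    exact ConcreteCategory.congr_hom (congrArg (fun t => Scheme.Modules.Hom.app t U) hθ) x
  lin_mul h g U V W e e' e'' x := by
    have em : ∀ U : X.Opens, actHom ρ g ⁻¹ᵁ (actHom ρ h ⁻¹ᵁ U) = actHom ρ (h * g) ⁻¹ᵁ U :=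
      fun U => by rw [actHom_mul]; rfl
    let θ : (pushforward (actHom ρ (h * g))).obj (Limits.cokernel φ) ⟶ Limits.cokernel φ :=
      mkHom (M := (pushforward (actHom ρ (h * g))).obj (Limits.cokernel φ))
        (fun U => (sec (cokernelLin φ hφ h) U _ rfl).comp
          (sec (cokernelLin φ hφ g) (actHom ρ h ⁻¹ᵁ U) _ (em U)))
        (fun U r x => by
          refine Eq.trans ?_ (sec_smul (cokernelLin φ hφ h) U r _)
          refine congrArg (sec (cokernelLin φ hφ h) U _ rfl)
            (Eq.trans ?_ (sec_smul_appLE (cokernelLin φ hφ g) (em U) ((actHom ρ h).app U r) x))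
          have h1 := Scheme.Hom.comp_appLE (actHom ρ g) (actHom ρ h) U (actHom ρ (h * g) ⁻¹ᵁ U)
            (em U).ge
          have h2 := (appLE_of_eq (actHom_mul ρ h g) le_rfl (em U).ge).trans h1
          rw [Scheme.Hom.appLE_eq_app] at h2
          have h3 : (actHom ρ (h * g)).app U r = (actHom ρ g).appLE (actHom ρ h ⁻¹ᵁ U)
            (actHom ρ (h * g) ⁻¹ᵁ U) (em U).ge ((actHom ρ h).app U r) :=
            ConcreteCategory.congr_hom h2 r
          refine congrArg (sec (cokernelLin φ hφ g) (actHom ρ h ⁻¹ᵁ U) _ (em U)) ?_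
          exact congrArg (· • (show Γ(Limits.cokernel φ, actHom ρ (h * g) ⁻¹ᵁ U) from x)) h3)
        (fun {U W} i x => (congrArg (sec (cokernelLin φ hφ h) W _ rfl)
          (sec_map (cokernelLin φ hφ g) (em U) (em W) ((Opens.map (actHom ρ h).base).map i)
            ((Opens.map (actHom ρ (h * g)).base).map i) x)).trans
          (sec_map (cokernelLin φ hφ h) rfl rfl i ((Opens.map (actHom ρ h).base).map i) _))
    have hθ : cokernelLin φ hφ (h * g) = θ := by
      rw [← cancel_epi ((pushforward (actHom ρ (h * g))).map (cokernel.π φ))]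
      refine Scheme.Modules.hom_ext _ _ fun U => ?_
      ext y
      have h1 := sec_cokernelLin φ hφ (h * g) (U := U) rfl y
      rw [sec_self] at h1
      refine h1.trans ?_
      rw [B.lin_mul h g U _ _ rfl (em U) rfl y, ← sec_cokernelLin φ hφ h rfl]
      exact congrArg (sec (cokernelLin φ hφ h) U _ rfl) (sec_cokernelLin φ hφ g (em U) y).symm
    subst e e''
    rw [hθ, sec_self]
    rfl

end cokernel

section homCokernel

variable (s : X ⟶ Spec (CommRingCat.of k)) (hs : ∀ g, actHom ρ g ≫ s = s)
  {H : Type u} [Group H] (a : H →* End F.sheaf)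
  (ha : ∀ (g : G) (h : H) (U V : X.Opens) (e : actHom ρ g ⁻¹ᵁ U = V) (x : Γ(F.sheaf, V)),
    sec (F.lin g) U V e (Scheme.Modules.Hom.app (a h) V x) =
      Scheme.Modules.Hom.app (a h) U (sec (F.lin g) U V e x))
  {V : Type u} [AddCommGroup V] [Module (MonoidAlgebra k H) V]
  {W : Type u} [AddCommGroup W] [Module (MonoidAlgebra k H) W]
  (q : V →ₗ[MonoidAlgebra k H] W)

/-- The cokernel of `Hom_{k[H]}(W, F) ⟶ Hom_{k[H]}(V, F)` (composition with `q : V → W`), as a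
`G`-sheaf. -/
def homCokernel : GSheaf ρ :=
  cokernel (A := F.hom s hs a ha W) (B := F.hom s hs a ha V) (homSheafMap s F.sheaf a q)
    (F.hom_naturality s hs a ha W q)

lemma sec_hom_lin_eq (g : G) (h : H)
    (hlin : ∀ (U : X.Opens) (e : actHom ρ g ⁻¹ᵁ U = U) (x : Γ(F.sheaf, U)),
      sec (F.lin g) U U e x = Scheme.Modules.Hom.app (a h) U x)
    (m : W →ₗ[MonoidAlgebra k H] V) (hm : ∀ x, m (q x) = MonoidAlgebra.single h (1 : k) • x - x)
    (U : X.Opens) (e : actHom ρ g ⁻¹ᵁ U = U)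
    (y : Γ(homSheaf s F.sheaf a V, U)) :
    sec ((F.hom s hs a ha V).lin g) U U e y =
      (homSheafMap s F.sheaf a q).app U ((homSheafMap s F.sheaf a m).app U y) + y := by
  refine Subtype.ext (funext fun w => ?_)
  refine (F.sec_homLin s hs a ha V g e y w).trans ?_
  rw [hlin]
  have h1 := y.2.2 h 1 w
  rw [map_one, one_smul] at h1
  refine h1.symm.trans ?_
  have h2 : MonoidAlgebra.single h (1 : k) • w = m (q w) + w := by rw [hm, sub_add_cancel]
  rw [h2]
  exact y.2.1 _ _

lemma sec_homCokernel_lin_eq (g : G) (hg : actHom ρ g = 𝟙 X) (h : H)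
    (hlin : ∀ (U : X.Opens) (e : actHom ρ g ⁻¹ᵁ U = U) (x : Γ(F.sheaf, U)),
      sec (F.lin g) U U e x = Scheme.Modules.Hom.app (a h) U x)
    (m : W →ₗ[MonoidAlgebra k H] V) (hm : ∀ x, m (q x) = MonoidAlgebra.single h (1 : k) • x - x)
    (U : X.Opens) (e : actHom ρ g ⁻¹ᵁ U = U)
    (x : Γ((F.homCokernel s hs a ha q).sheaf, U)) :
    sec ((F.homCokernel s hs a ha q).lin g) U U e x = x :=
  sec_cokernelLin_eq_self (A := F.hom s hs a ha W) (B := F.hom s hs a ha V)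
    (homSheafMap s F.sheaf a q) (F.hom_naturality s hs a ha W q) g hg (homSheafMap s F.sheaf a m)
    (fun U e y => F.sec_hom_lin_eq s hs a ha q g h hlin m hm U e y) U e x

end homCokernel

section descend

variable {H : Subgroup G} [H.Normal] {ρQ : G ⧸ H →* Aut X}
  (N : GSheaf (ρQ.comp (QuotientGroup.mk' H)))
  (hN : ∀ h ∈ H, ∀ (U : X.Opens) (e : actHom (ρQ.comp (QuotientGroup.mk' H)) h ⁻¹ᵁ U = U)
    (x : Γ(N.sheaf, U)), sec (N.lin h) U U e x = x)

lemma actHom_out (q : G ⧸ H) : actHom (ρQ.comp (QuotientGroup.mk' H)) q.out = actHom ρQ q := by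
  simp [actHom]

lemma preimage_out (q : G ⧸ H) (U : X.Opens) :
    actHom (ρQ.comp (QuotientGroup.mk' H)) q.out ⁻¹ᵁ U = actHom ρQ q ⁻¹ᵁ U := by
  rw [actHom_out]

/-- The action of a coset in `G ⧸ H`, computed by a representative. -/
def descendLin (q : G ⧸ H) : (pushforward (actHom ρQ q)).obj N.sheaf ⟶ N.sheaf :=
  mkHom (M := (pushforward (actHom ρQ q)).obj N.sheaf)
    (fun U => sec (N.lin q.out) U _ (preimage_out q U))
    (fun U r x => by
      refine Eq.trans ?_ (sec_smul_appLE (N.lin q.out) (preimage_out q U) r x)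
      rw [appLE_of_eq (actHom_out q) _ le_rfl, Scheme.Hom.appLE_eq_app]
      rfl)
    (fun i x => sec_map _ _ _ _ _ _)

lemma sec_descendLin
    (hN : ∀ h ∈ H, ∀ (U : X.Opens) (e : actHom (ρQ.comp (QuotientGroup.mk' H)) h ⁻¹ᵁ U = U)
      (x : Γ(N.sheaf, U)), sec (N.lin h) U U e x = x)
    (g : G) {U V : X.Opens} (e : actHom ρQ (g : G ⧸ H) ⁻¹ᵁ U = V)
    (x : Γ(N.sheaf, V)) :
    sec (N.descendLin (g : G ⧸ H)) U V e x = sec (N.lin g) U V e x := by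
  subst e
  obtain ⟨h, hh⟩ := QuotientGroup.mk_out_eq_mul H g
  have h1 : g = (g : G ⧸ H).out * (h : G)⁻¹ := by rw [hh, mul_inv_cancel_right]
  have e1 : ∀ V : X.Opens, actHom (ρQ.comp (QuotientGroup.mk' H)) (h : G)⁻¹ ⁻¹ᵁ V = V := fun V => by
    have : actHom (ρQ.comp (QuotientGroup.mk' H)) (h : G)⁻¹ = 𝟙 X := by
      rw [← actHom_one ρQ]
      have : QuotientGroup.mk' H (h : G)⁻¹ = 1 := by simp
      simp only [actHom, MonoidHom.comp_apply, this]
    rw [this]; rfl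
  refine (sec_self (N.descendLin (g : G ⧸ H)) U x).trans ?_
  have e2 : actHom (ρQ.comp (QuotientGroup.mk' H)) ((g : G ⧸ H).out * (h : G)⁻¹) ⁻¹ᵁ U =
      actHom ρQ (g : G ⧸ H) ⁻¹ᵁ U := by rw [← h1]; rfl
  have h2 := N.lin_mul _ _ U _ _ (preimage_out (g : G ⧸ H) U) (e1 _) e2 x
  rw [hN _ (H.inv_mem h.2)] at h2
  refine h2.symm.trans ?_
  have key : ∀ (g' : G) (hg : g' = g) (e' : actHom (ρQ.comp (QuotientGroup.mk' H)) g' ⁻¹ᵁ U =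
      actHom ρQ (g : G ⧸ H) ⁻¹ᵁ U), sec (N.lin g') U _ e' x = sec (N.lin g) U _ rfl x := by
    rintro _ rfl e'; rfl
  exact key _ h1.symm e2

/-- A `G`-sheaf on which the subgroup `H` acts trivially (on `X` and on the sheaf), regarded as a
`G ⧸ H`-sheaf: the coset of `g` acts as `g`. -/
def descend : GSheaf ρQ where
  sheaf := N.sheaf
  lin := N.descendLin
  lin_one U e x := (N.sec_descendLin hN 1 e x).trans (N.lin_one U _ x)
  lin_mul h g U V W e e' e'' x := by
    induction h using QuotientGroup.induction_on with | H h => ?_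
    induction g using QuotientGroup.induction_on with | H g => ?_
    refine (N.sec_descendLin hN (h * g) e'' x).trans ?_
    rw [N.lin_mul h g U V W e e' e'' x, N.sec_descendLin hN, N.sec_descendLin hN]

end descend


end GSheaf

section Jordan

variable (k) {A : Type u} [CommGroup A]

/-- The `k[A]`-module `V_j = k[A] / (σ - 1) ^ j`. -/
def JordanModule (σ : A) (j : ℕ) : Type u :=
  MonoidAlgebra k A ⧸ Ideal.span {(MonoidAlgebra.single σ (1 : k) - 1) ^ j}

instance (σ : A) (j : ℕ) : AddCommGroup (JordanModule k σ j) :=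
  inferInstanceAs (AddCommGroup
    (MonoidAlgebra k A ⧸ Ideal.span {(MonoidAlgebra.single σ (1 : k) - 1) ^ j}))

instance (σ : A) (j : ℕ) : Module (MonoidAlgebra k A) (JordanModule k σ j) :=
  inferInstanceAs (Module (MonoidAlgebra k A)
    (MonoidAlgebra k A ⧸ Ideal.span {(MonoidAlgebra.single σ (1 : k) - 1) ^ j}))

/-- The projection `V_j → V_i`, for `i ≤ j`. -/
def jordanProj (σ : A) {i j : ℕ} (h : i ≤ j) :
    JordanModule k σ j →ₗ[MonoidAlgebra k A] JordanModule k σ i :=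
  Submodule.factor (Ideal.span_singleton_le_span_singleton.2 (pow_dvd_pow _ h))

lemma dvd_single_sub_one {τ : A} (hτ : ∀ a, a ∈ Subgroup.zpowers τ) (a : A) :
    (MonoidAlgebra.single τ (1 : k) - 1) ∣ (MonoidAlgebra.single a (1 : k) - 1) := by
  set I : Ideal (MonoidAlgebra k A) := Ideal.span {MonoidAlgebra.single τ (1 : k) - 1}
  let f : A →* (MonoidAlgebra k A ⧸ I) :=
    (Ideal.Quotient.mk I : MonoidAlgebra k A →* _).comp (MonoidAlgebra.of k A)
  have h1 : ∀ b, f b = 1 ↔ MonoidAlgebra.single b (1 : k) - 1 ∈ I := fun b => by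
    rw [← Ideal.Quotient.eq, map_one]; rfl
  have h2 : Subgroup.zpowers τ ≤ f.ker := by
    rw [Subgroup.zpowers_le]
    exact (h1 τ).2 (Ideal.mem_span_singleton_self _)
  exact Ideal.mem_span_singleton.1 ((h1 a).1 (h2 (hτ a)))

/-- Multiplication by `a - 1`, as a map `V_{l-1} → V_l`. -/
def jordanMul {τ : A} (hτ : ∀ a, a ∈ Subgroup.zpowers τ) (a : A) (l : ℕ) :
    JordanModule k τ (l - 1) →ₗ[MonoidAlgebra k A] JordanModule k τ l :=
  Submodule.mapQ _ _ (LinearMap.mulLeft (MonoidAlgebra k A) (MonoidAlgebra.single a (1 : k) - 1))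
    (by
      rw [Ideal.span, Submodule.span_le, Set.singleton_subset_iff]
      change (MonoidAlgebra.single a (1 : k) - 1) * (MonoidAlgebra.single τ (1 : k) - 1) ^ (l - 1) ∈
        Ideal.span _
      rw [Ideal.mem_span_singleton]
      obtain ⟨c, hc⟩ := dvd_single_sub_one k hτ a
      rw [hc, mul_right_comm, ← pow_succ']
      exact Dvd.dvd.mul_right (pow_dvd_pow _ (by omega)) _)

lemma jordanMul_proj {τ : A} (hτ : ∀ a, a ∈ Subgroup.zpowers τ) (a : A) (l : ℕ)
    (x : JordanModule k τ l) :
    jordanMul k hτ a l (jordanProj k τ (Nat.sub_le l 1) x) =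
      MonoidAlgebra.single a (1 : k) • x - x := by
  obtain ⟨x, rfl⟩ := Submodule.Quotient.mk_surjective _ x
  change Submodule.Quotient.mk ((MonoidAlgebra.single a (1 : k) - 1) * x) =
    Submodule.Quotient.mk (MonoidAlgebra.single a (1 : k) * x) - Submodule.Quotient.mk x
  rw [sub_mul, one_mul]
  rfl

end Jordan

namespace GSheaf

open Scheme.Modules

/-- The sheaf `f_*^G Hom_{𝒪_X}(s_X^* V, F)` on `T`, for a `G`-sheaf `F` on `X`, a `G`-invariant
morphism `f : X ⟶ T` of `k`-schemes and a representation `V` of `G` over `k`; here `s_X` is the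
structure morphism of `X` and `f_*^G` takes the `G`-invariants of the direct image. Its sections over
`U` are the invariant elements of `Hom_k(V, F(f⁻¹ U))`, that is, the `k[G]`-linear maps
`V → F(f⁻¹ U)`. -/
def underline {G : Type u} [Group G] {X T : Scheme.{u}} {ρ : G →* Aut X} (F : GSheaf ρ)
    (s : T ⟶ Spec (CommRingCat.of k)) (f : X ⟶ T) (hf : ∀ g, actHom ρ g ≫ f = f)
    (V : Type u) [AddCommGroup V] [Module (MonoidAlgebra k G) V] : T.Modules :=
  homSheaf s ((pushforward f).obj F.sheaf) (F.act f hf) V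

variable {G : Type u} [CommGroup G]

/-- The map `F(V_{j-1}) ⟶ F(V_j)` of underlined sheaves that is induced by `V_j → V_{j-1}`. -/
def gr0Map {X T : Scheme.{u}} {ρ : G →* Aut X} (F : GSheaf ρ)
    (s : T ⟶ Spec (CommRingCat.of k)) (f : X ⟶ T) (hf : ∀ g, actHom ρ g ≫ f = f)
    (σ : G) (j : ℕ) :
    F.underline s f hf (JordanModule k σ (j - 1)) ⟶ F.underline s f hf (JordanModule k σ j) :=
  homSheafMap s _ (F.act f hf) (jordanProj k σ (Nat.sub_le j 1))

/-- `gr_0 F(V_j)`: the cokernel of the map `F(V_{j-1}) ⟶ F(V_j)` that is induced by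
`V_j → V_{j-1}`. -/
def gr0 {X T : Scheme.{u}} {ρ : G →* Aut X} (F : GSheaf ρ)
    (s : T ⟶ Spec (CommRingCat.of k)) (f : X ⟶ T) (hf : ∀ g, actHom ρ g ≫ f = f)
    (σ : G) (j : ℕ) : T.Modules :=
  Limits.cokernel (F.gr0Map s f hf σ j)

section residual

variable {X Z : Scheme.{u}} {ρ : G →* Aut X} (F : GSheaf ρ) {H : Subgroup G}
  {ρZ : G ⧸ H →* Aut Z} (s : Z ⟶ Spec (CommRingCat.of k)) (hs : ∀ q, actHom ρZ q ≫ s = s)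
  (α : X ⟶ Z) (hinv : ∀ h, actHom (ρ.comp H.subtype) h ≫ α = α)
  (hα : ∀ g : G, actHom ρ g ≫ α = α ≫ actHom ρZ (g : G ⧸ H))
  {τ : H} (hτ : ∀ h, h ∈ Subgroup.zpowers τ) (l : ℕ)

lemma lin_comm {G : Type u} [CommGroup G] {X : Scheme.{u}} {ρ : G →* Aut X} (F : GSheaf ρ)
    (g h : G) {U V : X.Opens} (e : actHom ρ g ⁻¹ᵁ U = V) (eU : actHom ρ h ⁻¹ᵁ U = U)
    (eV : actHom ρ h ⁻¹ᵁ V = V) (x : Γ(F.sheaf, V)) :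
    sec (F.lin g) U V e (sec (F.lin h) V V eV x) =
      sec (F.lin h) U U eU (sec (F.lin g) U V e x) := by
  have e3 : actHom ρ (g * h) ⁻¹ᵁ U = V := by
    rw [actHom_mul]
    change actHom ρ h ⁻¹ᵁ actHom ρ g ⁻¹ᵁ U = V
    rw [e, eV]
  have key : ∀ (g' : G) (_ : g' = g * h) (e' : actHom ρ g' ⁻¹ᵁ U = V),
      sec (F.lin (g * h)) _ _ e3 x = sec (F.lin g') _ _ e' x := by
    rintro _ rfl e'; rfl
  have e4 : actHom ρ (h * g) ⁻¹ᵁ U = V := by rw [mul_comm]; exact e3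
  rw [← F.lin_mul g h _ _ _ _ _ e3, ← F.lin_mul h g _ _ _ _ _ e4]
  exact key _ (mul_comm _ _) e4

lemma lin_act_comm (g : G) (h : H) (U V : Z.Opens)
    (e : actHom (ρZ.comp (QuotientGroup.mk' H)) g ⁻¹ᵁ U = V)
    (x : Γ((F.push (ρZ := ρZ.comp (QuotientGroup.mk' H)) α hα).sheaf, V)) :
    sec ((F.push (ρZ := ρZ.comp (QuotientGroup.mk' H)) α hα).lin g) U V e
        (Scheme.Modules.Hom.app ((F.restrict H).act α hinv h) V x) =
      Scheme.Modules.Hom.app ((F.restrict H).act α hinv h) U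
        (sec ((F.push (ρZ := ρZ.comp (QuotientGroup.mk' H)) α hα).lin g) U V e x) := by
  have e1 : ∀ U : Z.Opens, actHom ρ (h : G) ⁻¹ᵁ α ⁻¹ᵁ U = α ⁻¹ᵁ U :=
    fun U => preimage_invariant α hinv h U
  have e2 : actHom ρ g ⁻¹ᵁ α ⁻¹ᵁ U = α ⁻¹ᵁ V := preimage_push α hα g e
  have key := F.lin_comm g h e2 (e1 U) (e1 V) x
  refine (F.sec_pushLin α hα g e _).trans (key.trans ?_)
  exact congrArg (sec (F.lin h) (α ⁻¹ᵁ U) (α ⁻¹ᵁ U) (e1 U)) (F.sec_pushLin α hα g e x).symm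

variable {V : Type u} [AddCommGroup V] [Module (MonoidAlgebra k H) V]
  {W : Type u} [AddCommGroup W] [Module (MonoidAlgebra k H) W]
  (q : V →ₗ[MonoidAlgebra k H] W)

/-- The cokernel of `Hom_{k[H]}(W, α_* F) ⟶ Hom_{k[H]}(V, α_* F)` (composition with `q : V → W`), as a
sheaf on `Z` with the action of `G` given by `(g f)(v) = g (f v)`; this is well defined as `G` is
commutative. -/
def underlineCokernel : GSheaf (ρZ.comp (QuotientGroup.mk' H)) :=
  (F.push (ρZ := ρZ.comp (QuotientGroup.mk' H)) α hα).homCokernel s (fun g => hs (g : G ⧸ H))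
    ((F.restrict H).act α hinv) (F.lin_act_comm α hinv hα) q

variable (hq : ∀ h : H, ∃ m : W →ₗ[MonoidAlgebra k H] V,
    ∀ x, m (q x) = MonoidAlgebra.single h (1 : k) • x - x)

lemma sec_underlineCokernel_of_mem
    (hq : ∀ h : H, ∃ m : W →ₗ[MonoidAlgebra k H] V,
      ∀ x, m (q x) = MonoidAlgebra.single h (1 : k) • x - x)
    (h : G) (hh : h ∈ H) (U : Z.Opens)
    (e : actHom (ρZ.comp (QuotientGroup.mk' H)) h ⁻¹ᵁ U = U)
    (x : Γ((F.underlineCokernel s hs α hinv hα q).sheaf, U)) :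
    sec ((F.underlineCokernel s hs α hinv hα q).lin h) U U e x = x := by
  have e0 : actHom (ρZ.comp (QuotientGroup.mk' H)) h = 𝟙 Z := by
    have : QuotientGroup.mk' H h = 1 := by simpa using hh
    rw [← actHom_one ρZ]
    simp only [actHom, MonoidHom.comp_apply, this]
  obtain ⟨m, hm⟩ := hq ⟨h, hh⟩
  have hlin : ∀ (U : Z.Opens) (e : actHom (ρZ.comp (QuotientGroup.mk' H)) h ⁻¹ᵁ U = U)
      (x : Γ((F.push (ρZ := ρZ.comp (QuotientGroup.mk' H)) α hα).sheaf, U)),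
      sec ((F.push (ρZ := ρZ.comp (QuotientGroup.mk' H)) α hα).lin h) U U e x =
        Scheme.Modules.Hom.app ((F.restrict H).act α hinv ⟨h, hh⟩) U x := fun U e x =>
    (F.sec_pushLin α hα h e x).trans ((F.restrict H).act_app α hinv ⟨h, hh⟩ U x).symm
  exact (F.push (ρZ := ρZ.comp (QuotientGroup.mk' H)) α hα).sec_homCokernel_lin_eq s
    (fun g => hs (g : G ⧸ H)) ((F.restrict H).act α hinv) (F.lin_act_comm α hinv hα) q h e0
    ⟨h, hh⟩ hlin m hm U e x

/-- The same cokernel as a `G ⧸ H`-sheaf, when `H` acts trivially on it. -/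
def underlineCokernelDescent : GSheaf ρZ :=
  (F.underlineCokernel s hs α hinv hα q).descend
    (F.sec_underlineCokernel_of_mem s hs α hinv hα q hq)

/-- The sheaf `gr_0 F(V_l)` on `Z`, formed for the group `H = ⟨τ⟩` and the `H`-invariant morphism
`α : X ⟶ Z`, as a `G ⧸ H`-sheaf: the action of `g` on `F` induces `(g f)(v) = g (f v)` on `H`-maps
`f : V_l → F(α⁻¹ U)`, and `H` acts trivially on the cokernel, because `(h - 1) V_l` is a quotient of
`V_{l-1}`. -/
def gr0Residual : GSheaf ρZ :=
  F.underlineCokernelDescent s hs α hinv hα (jordanProj k τ (Nat.sub_le l 1))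
    (fun h => ⟨jordanMul k hτ h l, jordanMul_proj k hτ h l⟩)

/-- The sheaf underlying `gr0Residual` is `gr0`, formed for `H` and `α`. -/
lemma gr0Residual_sheaf :
    (F.gr0Residual s hs α hinv hα hτ l).sheaf = (F.restrict H).gr0 s α hinv τ l := rfl

end residual
end GSheaf

section Curves

/-- A projective curve over an algebraically closed field `k`: an integral scheme of dimension one,
proper over `k`, all of whose local rings are regular. -/
structure IsProjectiveCurve {X : Scheme.{u}} (s : X ⟶ Spec (CommRingCat.of k)) : Prop where
  integral : IsIntegral X
  proper : IsProper s
  regular : ∀ x : X, IsRegularLocalRing (X.presheaf.stalk x)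
  dim_one : topologicalKrullDim X = 1

/-- `π : X ⟶ Y` is the quotient of `X` by an (admissible) action of `G`: it is invariant and affine,
and `𝒪_Y` is the sheaf of invariants `(π_* 𝒪_X)^G`. -/
structure IsQuotient {X Y : Scheme.{u}} (ρ : G →* Aut X) (π : X ⟶ Y) : Prop where
  invariant : ∀ g, actHom ρ g ≫ π = π
  affine : IsAffineHom π
  injective : ∀ U : Y.Opens, Function.Injective (π.app U)
  surjective : ∀ (U : Y.Opens) (a : Γ(X, π ⁻¹ᵁ U)),
    (∀ g, (actHom ρ g).appLE (π ⁻¹ᵁ U) (π ⁻¹ᵁ U)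
      (GSheaf.preimage_invariant π invariant g U).ge a = a) → ∃ b, π.app U b = a

/-- An invertible sheaf: every point has an open neighbourhood `U` with a section `t ∈ M(U)` such that
`r ↦ r t` is an isomorphism `𝒪_U ≅ M|_U`. -/
def IsInvertible {X : Scheme.{u}} (M : X.Modules) : Prop :=
  ∀ x : X, ∃ (U : X.Opens) (_ : x ∈ U) (t : Γ(M, U)), ∀ (W : X.Opens) (i : W ⟶ U),
    Function.Bijective fun r : Γ(X, W) => r • M.presheaf.map i.op t

end Curves
end

end ModularSheaf

open ModularSheaf

/-! Put s = σ - 1 in the commutative ring k[G]. Since V_j is cyclic with annihilator (s^j), the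
equivariant maps V_j → M are the sections of M killed by s^j, and the maps factoring through V_{j-1}
are those killed by s^{j-1}. Applying s^{j-1} therefore embeds gr_0 into M, with sheaf image s^{j-1}
ker s^j (`grEval_injective`, `grEval_range`).

Applying this twice, first to H on α_* L and then to P, embeds the iterated graded piece into π_* L.
Let e be a lift of ε to G and t = τ - 1. The image consists locally of the sections (e - 1)^{j'-1}
t^{l-1} w with t^l w = 0 and (e - 1)^{j'} t^{l-1} w = 0 (`iteratedEval_range`). Local solvability on
Z has to be replaced by local solvability on Y here. This works because, on an affine open set, a
section that is locally in the image of a kernel is in it globally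
(`IsInvertible.exists_groupAlgebraEnd_eq`).

The lift e generates G, so e - 1 and s divide each other. In characteristic p, s^p = σ^p - 1 with
σ^p a generator of H, so t and s^p divide each other. As j = (l-1)p + j' ≤ lp, the element (e -
1)^{j'} t^{l-1} agrees with s^j up to mutual divisibility, likewise for j' - 1 and j - 1, and the
condition t^l w = 0 becomes redundant. Both images are thus the same subsheaf of π_* L
(`exists_apply_eq_iff_of_dvd`, `nonempty_gr0_iso`).

For invertibility, let U be affine in Y, A = O_Y(U) and B = O_X(π⁻¹U), so that A = B^G. Both rings
are Dedekind, and N = s^{j-1} ker s^j is a finite torsion-free A-module of G-invariants of a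
B-module of rank one, hence of rank at most one. It is nonzero: s^{p^v - 1} is the sum of all
elements of G, so N contains every trace, and independence of characters gives a nonzero one. Hence
N is locally generated by one element (`exists_generator_kernelImage`,
`IsQuotient.isInvertible_gr0`). The iterated sheaf inherits invertibility through the isomorphism.
-/

/-! ### Epimorphisms of sheaves of modules are locally surjective -/

/-- The presheaf cokernel of φ has zero sheafification, so each of its sections vanishes locally;
exactness of the presheaf cokernel on sections then gives local preimages. -/
lemma SheafOfModules.isLocallySurjective_of_epi {C : Type u} [Category.{u} C]
    {J : GrothendieckTopology C} {R : Sheaf J RingCat.{u}} [HasSheafify J AddCommGrpCat.{u}]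
    [J.WEqualsLocallyBijective AddCommGrpCat.{u}] {M N : SheafOfModules.{u} R} (φ : M ⟶ N) [Epi φ] :
    Presheaf.IsLocallySurjective J ((PresheafOfModules.toPresheaf R.obj).map φ.val) := by
  let adj := PresheafOfModules.sheafificationAdjunction (𝟙 R.obj)
  let S := PresheafOfModules.sheafification.{u} (𝟙 R.obj)
  let P : M.val ⟶ N.val := φ.val
  let q := Limits.cokernel.π P
  -- The counits at the sheaves M and N are isomorphisms and identify the sheafification of P with
  -- φ.
  have h1 : Epi (S.map P) := by
    let cM : S.obj M.val ⟶ M := adj.counit.app M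
    let cN : S.obj N.val ⟶ N := adj.counit.app N
    have : IsIso cM := inferInstanceAs (IsIso (adj.counit.app M))
    have : IsIso cN := inferInstanceAs (IsIso (adj.counit.app N))
    have h2 : S.map P ≫ cN = cM ≫ φ := adj.counit.naturality φ
    have h3 : S.map P = (cM ≫ φ) ≫ inv cN := by
      rw [← h2, Category.assoc, IsIso.hom_inv_id, Category.comp_id]
    rw [h3]
    infer_instance
  have h4 : S.map q = 0 := by
    rw [← cancel_epi (S.map P), ← S.map_comp, Limits.cokernel.condition, Limits.comp_zero,
      S.map_zero]
  -- By naturality of the unit, q followed by sheafification factors through S(q) = 0.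
  have h5 : q ≫ adj.unit.app (Limits.cokernel P) = 0 := by
    have := adj.unit.naturality q
    refine this.trans ?_
    change _ ≫ (SheafOfModules.forget R ⋙ PresheafOfModules.restrictScalars (𝟙 R.obj)).map (S.map q) = 0
    rw [h4, Functor.map_zero, Limits.comp_zero]
  have h6 : (PresheafOfModules.toPresheaf _).map q ≫ CategoryTheory.toSheafify J _ = 0 := by
    have := congrArg (fun t => (PresheafOfModules.toPresheaf _).map t) h5
    exact this
  constructor
  intro U s
  have h7 := Presheaf.equalizerSieve_mem J (CategoryTheory.toSheafify J (Limits.cokernel P).presheaf)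
    (q.app _ s) 0 (by
      rw [map_zero]
      exact ConcreteCategory.congr_hom (NatTrans.congr_app h6 (op U)) s)
  refine J.superset_covering ?_ h7
  intro W f hf
  have h8 : (Limits.cokernel P).presheaf.map f.op (q.app _ s) = 0 := by
    have : _ = _ := hf
    rw [map_zero] at this
    exact this
  have h9 : q.app (op W) (N.val.map f.op s) = 0 :=
    (PresheafOfModules.naturality_apply q f.op s).trans h8
  have h10 : (ShortComplex.mk P q (Limits.cokernel.condition P)).Exact :=
    ShortComplex.exact_of_g_is_cokernel _ (Limits.cokernelIsCokernel P)
  have h11 := (ShortComplex.moduleCat_exact_iff _).1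
    (h10.map (PresheafOfModules.evaluation R.obj (op W))) _ h9
  exact h11

namespace ModularSheaf
open Scheme.Modules

/-- An epimorphism of sheaves of modules is surjective on sections, locally. -/
lemma exists_app_eq_of_epi {T : Scheme.{u}} {M N : T.Modules} (φ : M ⟶ N) [Epi φ] {U : T.Opens}
    (x : Γ(N, U)) (t : T) (ht : t ∈ U) :
    ∃ (W : T.Opens) (i : W ⟶ U) (_ : t ∈ W) (y : Γ(M, W)), φ.app W y = N.presheaf.map i.op x := by
  have : Epi (C := SheafOfModules T.ringCatSheaf) φ := inferInstanceAs (Epi φ)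
  have h := SheafOfModules.isLocallySurjective_of_epi (R := T.ringCatSheaf) φ
  obtain ⟨W, i, ⟨y, hy⟩, hW⟩ := h.imageSieve_mem x t ht
  exact ⟨W, i, hW, y, hy⟩

noncomputable section

/-! ### Subsheaves and gluing of sections -/

section sections

variable {T : Scheme.{u}} {M N : T.Modules}

lemma section_ext {U : T.Opens} {x y : Γ(M, U)}
    (h : ∀ t ∈ U, ∃ (W : T.Opens) (i : W ⟶ U), t ∈ W ∧
      M.presheaf.map i.op x = M.presheaf.map i.op y) : x = y := by
  choose W i hW hi using h
  refine TopCat.Sheaf.eq_of_locally_eq' ⟨M.presheaf, M.isSheaf⟩ (fun t : U => W t.1 t.2) U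
    (fun t => i t.1 t.2) (fun t ht => Opens.mem_iSup.2 ⟨⟨t, ht⟩, hW t ht⟩) x y
    (fun t => hi t.1 t.2)

/-- A section of `N` that comes locally from `M` comes from `M`, if `M ⟶ N` is injective on
sections. -/
lemma exists_app_eq_of_locally (φ : M ⟶ N) (hφ : ∀ U, Function.Injective (φ.app U))
    {U : T.Opens} (z : Γ(N, U))
    (h : ∀ t ∈ U, ∃ (W : T.Opens) (i : W ⟶ U), t ∈ W ∧
      ∃ y : Γ(M, W), φ.app W y = N.presheaf.map i.op z) : ∃ y, φ.app U y = z := by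
  choose W i hW y hy using h
  obtain ⟨s, hs, -⟩ := TopCat.Sheaf.existsUnique_gluing' ⟨M.presheaf, M.isSheaf⟩
    (fun t : U => W t.1 t.2) U
    (fun t => i t.1 t.2) (fun t ht => Opens.mem_iSup.2 ⟨⟨t, ht⟩, hW t ht⟩)
    (fun t => y t.1 t.2) (fun t t' => by
      apply hφ
      refine (app_map φ (Opens.infLELeft _ _) _).trans ?_
      refine Eq.trans ?_ (app_map φ (Opens.infLERight _ _) _).symm
      rw [hy, hy, map_map, map_map]
      rfl)
  refine ⟨s, section_ext fun t ht => ⟨W t ht, i t ht, hW t ht, ?_⟩⟩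
  rw [← app_map, ← hy t ht]
  exact congrArg _ (hs ⟨t, ht⟩)

/-- Two subsheaves with the same sections are isomorphic. -/
lemma nonempty_iso_of_range_eq {C D : T.Modules} (φ : C ⟶ M) (ψ : D ⟶ M)
    (hφ : ∀ U, Function.Injective (φ.app U)) (hψ : ∀ U, Function.Injective (ψ.app U))
    (h : ∀ U z, (∃ x, φ.app U x = z) ↔ ∃ y, ψ.app U y = z) : Nonempty (C ≅ D) := by
  have key : ∀ {C D : T.Modules} (φ : C ⟶ M) (ψ : D ⟶ M)
    (hψ : ∀ U, Function.Injective (ψ.app U))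
    (h : ∀ U z, (∃ x, φ.app U x = z) → ∃ y, ψ.app U y = z), ∃ f : C ⟶ D, f ≫ ψ = φ := by
    intro C D φ ψ hψ h
    choose f hf using fun U x => h U (φ.app U x) ⟨x, rfl⟩
    refine ⟨mkHom (fun U => AddMonoidHom.mk' (f U) fun x y => hψ U ?_) (fun U r x => hψ U ?_)
      (fun i x => hψ _ ?_), ?_⟩
    · rw [hf, map_add, map_add, hf, hf]
    · change ψ.app U (f U (r • x)) = ψ.app U (r • f U x)
      rw [hf, Scheme.Modules.Hom.app_smul, Scheme.Modules.Hom.app_smul, hf]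
    · change ψ.app _ (f _ _) = ψ.app _ (_)
      rw [hf, app_map, app_map]
      exact congrArg _ (hf _ x).symm
    · refine Scheme.Modules.hom_ext _ _ fun U => ?_
      ext x
      exact hf U x
  obtain ⟨f, hf⟩ := key φ ψ hψ fun U z => (h U z).1
  obtain ⟨g, hg⟩ := key ψ φ hφ fun U z => (h U z).2
  have id_of : ∀ {C : T.Modules} (φ : C ⟶ M) (hφ : ∀ U, Function.Injective (φ.app U))
      (e : C ⟶ C), e ≫ φ = φ → e = 𝟙 C := by
    intro C φ hφ e he
    refine Scheme.Modules.hom_ext _ _ fun U => ?_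
    ext x
    exact hφ U (ConcreteCategory.congr_hom (congrArg (fun t => Scheme.Modules.Hom.app t U) he) x)
  exact ⟨⟨f, g, id_of φ hφ _ (by rw [Category.assoc, hg, hf]),
    id_of ψ hψ _ (by rw [Category.assoc, hf, hg])⟩⟩

end sections

/-! ### The group algebra acting on sections -/

section groupAlgebra

variable {k : Type u} [Field k] {G : Type u} [Group G] {T : Scheme.{u}}
  (s : T ⟶ Spec (CommRingCat.of k)) (M : T.Modules) (a : G →* End M)

/-- The group algebra acts on the sections of a sheaf of modules on which the group acts. -/
def groupAlgebraEnd (U : T.Opens) : MonoidAlgebra k G →+* AddMonoid.End Γ(M, U) :=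
  MonoidAlgebra.liftNCRingHom ((Module.toAddMonoidEnd Γ(T, U) Γ(M, U)).comp (scalar s U))
    { toFun := fun g => (Scheme.Modules.Hom.app (a g) U).hom
      map_one' := by rw [map_one]; rfl
      map_mul' := fun g h => by rw [map_mul]; rfl }
    (fun c g => by
      ext x
      exact (Scheme.Modules.Hom.app_smul (a g) (scalar s U c) x).symm)

lemma groupAlgebraEnd_single (U : T.Opens) (g : G) (c : k) (x : Γ(M, U)) :
    groupAlgebraEnd s M a U (MonoidAlgebra.single g c) x =
      scalar s U c • Scheme.Modules.Hom.app (a g) U x := by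
  refine congrArg (fun t : AddMonoid.End Γ(M, U) => t x) (MonoidAlgebra.liftNC_single _ _ _ _)

lemma groupAlgebraEnd_add_apply (U : T.Opens) (r r' : MonoidAlgebra k G) (x : Γ(M, U)) :
    groupAlgebraEnd s M a U (r + r') x =
      groupAlgebraEnd s M a U r x + groupAlgebraEnd s M a U r' x := by
  rw [map_add]; rfl

lemma groupAlgebraEnd_mul_apply (U : T.Opens) (r r' : MonoidAlgebra k G) (x : Γ(M, U)) :
    groupAlgebraEnd s M a U (r * r') x =
      groupAlgebraEnd s M a U r (groupAlgebraEnd s M a U r' x) := by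
  rw [map_mul]; rfl

variable {M a} in
lemma equivariantHoms_apply_smul {V : Type u} [AddCommGroup V] [Module (MonoidAlgebra k G) V]
    {U : T.Opens} (f : equivariantHoms s M a V U) (r : MonoidAlgebra k G) (v : V) :
    f.1 (r • v) = groupAlgebraEnd s M a U r (f.1 v) := by
  have h0 : f.1 0 = 0 := by
    have := f.2.1 0 0
    simpa using this
  induction r using MonoidAlgebra.induction_linear with
  | zero => rw [zero_smul, map_zero, h0]; rfl
  | add r r' h h' => rw [add_smul, f.2.1, h, h', map_add]; rfl
  | single g c => rw [f.2.2, groupAlgebraEnd_single]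

lemma groupAlgebraEnd_map {U W : T.Opens} (i : W ⟶ U) (r : MonoidAlgebra k G) (x : Γ(M, U)) :
    groupAlgebraEnd s M a W r (M.presheaf.map i.op x) =
      M.presheaf.map i.op (groupAlgebraEnd s M a U r x) := by
  induction r using MonoidAlgebra.induction_linear with
  | zero => simp only [map_zero]; exact (map_zero (M.presheaf.map i.op).hom).symm
  | add r r' h h' =>
    simp only [map_add]
    refine (congrArg₂ (· + ·) h h').trans (map_add (M.presheaf.map i.op).hom _ _).symm
  | single g c =>
    rw [groupAlgebraEnd_single, groupAlgebraEnd_single, Scheme.Modules.map_smul, scalar_map, app_map]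

end groupAlgebra

/-! ### Graded pieces as subsheaves -/

section jordan

variable {k : Type u} [Field k] {A : Type u} [CommGroup A]

variable (k) in
/-- The element `σ - 1` of the group algebra. -/
def subOne (σ : A) : MonoidAlgebra k A := MonoidAlgebra.single σ (1 : k) - 1

variable (k) in
/-- The class of `r` in `V_j`. -/
def jordanMk (σ : A) (j : ℕ) (r : MonoidAlgebra k A) : JordanModule k σ j :=
  Submodule.Quotient.mk r

lemma jordanMk_surjective (σ : A) (j : ℕ) : Function.Surjective (jordanMk k σ j) :=
  Submodule.Quotient.mk_surjective _

lemma smul_jordanMk (σ : A) (j : ℕ) (r r' : MonoidAlgebra k A) :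
    r • jordanMk k σ j r' = jordanMk k σ j (r * r') := rfl

lemma jordanMk_eq_smul (σ : A) (j : ℕ) (r : MonoidAlgebra k A) :
    jordanMk k σ j r = r • jordanMk k σ j 1 := by
  rw [smul_jordanMk, mul_one]

lemma jordanMk_eq_iff (σ : A) (j : ℕ) (r r' : MonoidAlgebra k A) :
    jordanMk k σ j r = jordanMk k σ j r' ↔ subOne k σ ^ j ∣ r - r' := by
  rw [← Ideal.mem_span_singleton]
  exact Submodule.Quotient.eq _

lemma jordanMk_pow_self (σ : A) (j : ℕ) : jordanMk k σ j (subOne k σ ^ j) = 0 :=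
  (jordanMk_eq_iff σ j _ 0).2 (by rw [sub_zero])

variable {T : Scheme.{u}} (s : T ⟶ Spec (CommRingCat.of k)) {M : T.Modules} (a : A →* End M)
  (σ : A) (j : ℕ)

/-- An equivariant map out of the cyclic module V_j is determined by the image m of the class of 1,
and the only constraint on m is to be killed by (σ - 1)^j. -/
lemma exists_equivariantHoms {U : T.Opens} (m : Γ(M, U))
    (hm : groupAlgebraEnd s M a U (subOne k σ ^ j) m = 0) :
    ∃ f : equivariantHoms s M a (JordanModule k σ j) U,
      ∀ r, f.1 (jordanMk k σ j r) = groupAlgebraEnd s M a U r m := by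
  choose l hl using jordanMk_surjective (k := k) σ j
  have key : ∀ r r', jordanMk k σ j r = jordanMk k σ j r' →
      groupAlgebraEnd s M a U r m = groupAlgebraEnd s M a U r' m := by
    intro r r' h
    obtain ⟨c, hc⟩ := (jordanMk_eq_iff σ j r r').1 h
    have h1 : r = c * subOne k σ ^ j + r' := by rw [mul_comm, ← hc, sub_add_cancel]
    rw [h1, groupAlgebraEnd_add_apply, groupAlgebraEnd_mul_apply, hm, map_zero, zero_add]
  have hmk : ∀ r, groupAlgebraEnd s M a U (l (jordanMk k σ j r)) m =
      groupAlgebraEnd s M a U r m := fun r => key _ _ (hl _)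
  refine ⟨⟨fun v => groupAlgebraEnd s M a U (l v) m, fun v w => ?_, fun g c v => ?_⟩, hmk⟩
  · obtain ⟨r, rfl⟩ := jordanMk_surjective σ j v
    obtain ⟨r', rfl⟩ := jordanMk_surjective σ j w
    have h1 := hmk (r + r')
    rw [groupAlgebraEnd_add_apply, ← hmk r, ← hmk r'] at h1
    exact h1
  · obtain ⟨r, rfl⟩ := jordanMk_surjective σ j v
    dsimp only
    rw [smul_jordanMk, hmk, hmk, groupAlgebraEnd_mul_apply, groupAlgebraEnd_single]

/-- Evaluation of the `k[A]`-linear maps `V_j → M` at the class of `(σ - 1) ^ (j - 1)`. -/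
def evalTop : homSheaf s M a (JordanModule k σ j) ⟶ M :=
  mkHom (fun _ =>
    { toFun := fun f => f.1 (jordanMk k σ j (subOne k σ ^ (j - 1)))
      map_zero' := rfl
      map_add' := fun _ _ => rfl } :
        ∀ U : T.Opens, equivariantHoms s M a (JordanModule k σ j) U →+ Γ(M, U))
    (fun _ _ _ => rfl) (fun _ _ => rfl)

/-- The embedding of `gr_0` into `M` given by evaluation at `(σ - 1) ^ (j - 1)`. -/
def grEval : Limits.cokernel (homSheafMap s M a (jordanProj k σ (Nat.sub_le j 1))) ⟶ M :=
  Limits.cokernel.desc _ (evalTop s a σ j) (by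
    refine Scheme.Modules.hom_ext _ _ fun U => ?_
    ext f
    change (f : equivariantHoms s M a (JordanModule k σ (j - 1)) U).1
      (jordanMk k σ (j - 1) (subOne k σ ^ (j - 1))) = 0
    rw [jordanMk_pow_self]
    exact map_zero (AddMonoidHom.mk' _ (f : equivariantHoms s M a _ U).2.1))

lemma grEval_app_π (U : T.Opens) (f : equivariantHoms s M a (JordanModule k σ j) U) :
    (grEval s a σ j).app U ((Limits.cokernel.π (homSheafMap s M a
      (jordanProj k σ (Nat.sub_le j 1)))).app U f) =
      groupAlgebraEnd s M a U (subOne k σ ^ (j - 1)) (f.1 (jordanMk k σ j 1)) := by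
  have h1 : Limits.cokernel.π (homSheafMap s M a (jordanProj k σ (Nat.sub_le j 1))) ≫
    grEval s a σ j = evalTop s a σ j := Limits.cokernel.π_desc _ _ _
  refine (ConcreteCategory.congr_hom (congrArg (fun t => Scheme.Modules.Hom.app t U) h1) f).trans ?_
  rw [← equivariantHoms_apply_smul, ← jordanMk_eq_smul]
  rfl

lemma groupAlgebraEnd_apply_one (U : T.Opens)
    (f : equivariantHoms s M a (JordanModule k σ j) U) :
    groupAlgebraEnd s M a U (subOne k σ ^ j) (f.1 (jordanMk k σ j 1)) = 0 := by
  rw [← equivariantHoms_apply_smul, ← jordanMk_eq_smul, jordanMk_pow_self]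
  exact map_zero (AddMonoidHom.mk' _ f.2.1)

/-- A section of the cokernel lifts locally to an equivariant map f. If (σ - 1)^(j-1) kills f(1),
then f factors through V_{j-1} and its class vanishes. -/
lemma grEval_injective (U : T.Opens) : Function.Injective ((grEval s a σ j).app U) := by
  rw [injective_iff_map_eq_zero]
  intro x hx
  refine section_ext fun t ht => ?_
  obtain ⟨W, i, hW, f, hf⟩ := exists_app_eq_of_epi (Limits.cokernel.π (homSheafMap s M a
    (jordanProj k σ (Nat.sub_le j 1)))) x t ht
  refine ⟨W, i, hW, ?_⟩
  change equivariantHoms s M a (JordanModule k σ j) W at f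
  have h1 : groupAlgebraEnd s M a W (subOne k σ ^ (j - 1)) (f.1 (jordanMk k σ j 1)) = 0 := by
    refine (grEval_app_π s a σ j W f).symm.trans ?_
    rw [hf, app_map, hx, map_zero]
  obtain ⟨g, hg⟩ := exists_equivariantHoms s a σ (j - 1) _ h1
  have h2 : (homSheafMap s M a (jordanProj k σ (Nat.sub_le j 1))).app W g = f := by
    refine Subtype.ext (funext fun v => ?_)
    obtain ⟨r, rfl⟩ := jordanMk_surjective σ j v
    change g.1 (jordanMk k σ (j - 1) r) = _
    rw [hg, ← equivariantHoms_apply_smul, ← jordanMk_eq_smul]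
  rw [← hf, map_zero, ← h2]
  exact ConcreteCategory.congr_hom (congrArg (fun t => Scheme.Modules.Hom.app t W)
    (Limits.cokernel.condition (homSheafMap s M a (jordanProj k σ (Nat.sub_le j 1))))) g

/-- Lifting along the cokernel projection is possible only locally, so the image is the sheaf image
of (σ - 1)^(j-1) on the kernel of (σ - 1)^j. Injectivity on sections lets local preimages glue. -/
lemma grEval_range (U : T.Opens) (z : Γ(M, U)) :
    (∃ x, (grEval s a σ j).app U x = z) ↔ ∀ t ∈ U, ∃ (W : T.Opens) (i : W ⟶ U), t ∈ W ∧
      ∃ y, groupAlgebraEnd s M a W (subOne k σ ^ j) y = 0 ∧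
        groupAlgebraEnd s M a W (subOne k σ ^ (j - 1)) y = M.presheaf.map i.op z := by
  constructor
  · rintro ⟨x, rfl⟩ t ht
    obtain ⟨W, i, hW, f, hf⟩ := exists_app_eq_of_epi (Limits.cokernel.π (homSheafMap s M a
      (jordanProj k σ (Nat.sub_le j 1)))) x t ht
    change equivariantHoms s M a (JordanModule k σ j) W at f
    refine ⟨W, i, hW, f.1 (jordanMk k σ j 1), groupAlgebraEnd_apply_one s a σ j W f, ?_⟩
    rw [← app_map, ← hf]
    exact (grEval_app_π s a σ j W f).symm
  · intro h
    refine exists_app_eq_of_locally _ (grEval_injective s a σ j) z fun t ht => ?_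
    obtain ⟨W, i, hW, y, hy, hz⟩ := h t ht
    obtain ⟨f, hf⟩ := exists_equivariantHoms s a σ j y hy
    refine ⟨W, i, hW, _, (grEval_app_π s a σ j W f).trans ?_⟩
    rw [hf, map_one, ← hz]
    rfl

end jordan

/-! ### Sections of invertible sheaves on affine open sets -/

section invertible

variable {X : Scheme.{u}} {L : X.Modules}

lemma modules_map_map (M : X.Modules) {U V W : X.Opens} (i : U ⟶ V) (j : V ⟶ W) (l : U ⟶ W)
    (x : Γ(M, W)) : M.presheaf.map i.op (M.presheaf.map j.op x) = M.presheaf.map l.op x := by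
  rw [map_map, Subsingleton.elim (i ≫ j) l]

lemma structure_map_map {U V W : X.Opens} (i : U ⟶ V) (j : V ⟶ W) (l : U ⟶ W) (x : Γ(X, W)) :
    X.presheaf.map i.op (X.presheaf.map j.op x) = X.presheaf.map l.op x := by
  rw [Subsingleton.elim l (i ≫ j), op_comp, Functor.map_comp]; rfl

lemma opens_nonempty_inf [IsIntegral X] (U V : X.Opens) [hU : Nonempty U] [hV : Nonempty V] :
    Nonempty ((U ⊓ V : X.Opens) : Type u) := by
  obtain ⟨x, hx⟩ := hU
  obtain ⟨y, hy⟩ := hV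
  obtain ⟨z, hz⟩ := nonempty_preirreducible_inter U.2 V.2 ⟨x, hx⟩ ⟨y, hy⟩
  exact ⟨z, hz⟩

/-- With a local generator the claim reduces to functions on an integral scheme, where every
nonempty open set meets W. -/
lemma IsInvertible.map_injective [IsIntegral X] (hL : IsInvertible L) {V W : X.Opens} (i : W ⟶ V)
    [hW : Nonempty W] : Function.Injective (L.presheaf.map i.op) := by
  rw [injective_iff_map_eq_zero]
  intro s hs
  refine section_ext fun t ht => ?_
  obtain ⟨U, htU, γ, hγ⟩ := hL t
  let N : X.Opens := V ⊓ U
  have : Nonempty N := ⟨⟨t, ht, htU⟩⟩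
  have := opens_nonempty_inf N W
  let jN : N ⟶ V := Opens.infLELeft _ _
  let jU : N ⟶ U := Opens.infLERight _ _
  let l : N ⊓ W ⟶ N := Opens.infLELeft _ _
  refine ⟨N, jN, ⟨ht, htU⟩, ?_⟩
  obtain ⟨r, hr⟩ := (hγ N jU).2 (L.presheaf.map jN.op s)
  dsimp only at hr
  have h1 : X.presheaf.map l.op r • L.presheaf.map (l ≫ jU).op γ = 0 := by
    rw [← map_map, ← Scheme.Modules.map_smul, hr, modules_map_map _ _ _ (Opens.infLERight N W ≫ i),
      ← map_map, hs, map_zero]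
  have h2 : X.presheaf.map l.op r = 0 := (hγ _ (l ≫ jU)).1 (by
    dsimp only; rw [h1, zero_smul])
  have h3 : r = 0 := map_injective_of_isIntegral X l (by rw [h2, map_zero])
  rw [← hr, h3, zero_smul, map_zero]

lemma IsInvertible.exists_generator_le (hL : IsInvertible L) {V : X.Opens} (hV : IsAffineOpen V)
    (t : X) (ht : t ∈ V) : ∃ (g : Γ(X, V)) (_ : t ∈ X.basicOpen g) (γ : Γ(L, X.basicOpen g)),
      ∀ (W : X.Opens) (i : W ⟶ X.basicOpen g),
        Function.Bijective fun r : Γ(X, W) => r • L.presheaf.map i.op γ := by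
  obtain ⟨U, htU, γ, hγ⟩ := hL t
  obtain ⟨g, hg, htg⟩ := hV.exists_basicOpen_le ⟨t, htU⟩ ht
  refine ⟨g, htg, L.presheaf.map (homOfLE hg).op γ, fun W i => ?_⟩
  rw [map_map]
  exact hγ W _

lemma IsInvertible.eq_zero_of_smul_eq_zero [IsIntegral X] (hL : IsInvertible L) {V : X.Opens}
    [hne : Nonempty V] (r : Γ(X, V)) (s : Γ(L, V)) (h : r • s = 0) : r = 0 ∨ s = 0 := by
  obtain ⟨⟨t, ht⟩⟩ := hne
  obtain ⟨U, htU, γ, hγ⟩ := hL t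
  let N : X.Opens := V ⊓ U
  have : Nonempty N := ⟨⟨t, ht, htU⟩⟩
  let i : N ⟶ V := Opens.infLELeft _ _
  obtain ⟨c, hc⟩ := (hγ N (Opens.infLERight _ _)).2 (L.presheaf.map i.op s)
  dsimp only at hc
  have h1 : X.presheaf.map i.op r * c = 0 := (hγ N (Opens.infLERight _ _)).1 (by
    dsimp only
    rw [mul_smul, hc, ← Scheme.Modules.map_smul, h, map_zero, zero_smul])
  rcases mul_eq_zero.1 h1 with h2 | h2
  · left
    exact map_injective_of_isIntegral X i (by rw [h2, map_zero])
  · right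
    refine hL.map_injective i ?_
    rw [map_zero, ← hc, h2, zero_smul]

/-- Sections over `W = D(f)` extend to the affine open set `V`, up to a power of `f`. -/
lemma IsInvertible.exists_map_eq_pow_smul [IsIntegral X] (hL : IsInvertible L) {V W : X.Opens}
    (hV : IsAffineOpen V) (f : Γ(X, V)) (hW : W = X.basicOpen f) (i : W ⟶ V) (s : Γ(L, W)) :
    ∃ (n : ℕ) (s' : Γ(L, V)), L.presheaf.map i.op s' = X.presheaf.map i.op (f ^ n) • s := by
  by_cases hne : Nonempty W
  swap
  · refine ⟨0, 0, section_ext fun t ht => (hne ⟨⟨t, ht⟩⟩).elim⟩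
  have hloc : ∀ t : V, ∃ (N : X.Opens) (_ : t.1 ∈ N) (j : N ⟶ V) (n : ℕ) (y : Γ(L, N)),
      L.presheaf.map (Opens.infLELeft N W).op y =
        L.presheaf.map (Opens.infLERight N W).op (X.presheaf.map i.op (f ^ n) • s) := by
    rintro ⟨t, ht⟩
    obtain ⟨g, htg, γ, hγ⟩ := hL.exists_generator_le hV t ht
    let N := X.basicOpen g
    let j : N ⟶ V := homOfLE (X.basicOpen_le g)
    obtain ⟨c, hc⟩ := (hγ (N ⊓ W) (Opens.infLELeft N W)).2
      (L.presheaf.map (Opens.infLERight N W).op s)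
    dsimp only at hc
    have e : X.basicOpen (X.presheaf.map j.op f) = N ⊓ W := by rw [Scheme.basicOpen_res, hW]
    have hN : IsAffineOpen N := hV.basicOpen g
    have := hN.isLocalization_of_eq_basicOpen (X.presheaf.map j.op f) (Opens.infLELeft N W) e.symm
    let := (X.presheaf.map (Opens.infLELeft N W).op).hom.toAlgebra
    obtain ⟨n, b, hb⟩ := IsLocalization.Away.surj (X.presheaf.map j.op f) c
    change c * X.presheaf.map (Opens.infLELeft N W).op (X.presheaf.map j.op f) ^ n =
      X.presheaf.map (Opens.infLELeft N W).op b at hb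
    refine ⟨N, htg, j, n, b • γ, ?_⟩
    rw [Scheme.Modules.map_smul, ← hb, Scheme.Modules.map_smul, ← hc, mul_comm, mul_smul, map_pow,
      map_pow, structure_map_map _ _ (Opens.infLERight N W ≫ i),
      structure_map_map _ _ (Opens.infLERight N W ≫ i)]
  choose N hN j n y hy using hloc
  obtain ⟨F, hF⟩ := hV.isCompact.elim_finite_subcover (fun t : V => (N t : Set X))
    (fun t => (N t).2) (fun t ht => Set.mem_iUnion.2 ⟨⟨t, ht⟩, hN _⟩)
  -- A common exponent: multiplying each local extension by the missing power of f makes all of them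
  -- restrict to the same section f^n' s on W.
  let n' := F.sup n
  let y' : ∀ t : F, Γ(L, N t.1) := fun t =>
    X.presheaf.map (j t.1).op (f ^ (n' - n t.1)) • y t.1
  have hy' : ∀ t : F, L.presheaf.map (Opens.infLELeft (N t.1) W).op (y' t) =
      L.presheaf.map (Opens.infLERight (N t.1) W).op (X.presheaf.map i.op (f ^ n') • s) := by
    intro t
    have h1 : n' = (n' - n t.1) + n t.1 := (Nat.sub_add_cancel (Finset.le_sup t.2)).symm
    conv_rhs => rw [h1, pow_add, map_mul, mul_smul, Scheme.Modules.map_smul, ← hy]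
    rw [Scheme.Modules.map_smul, structure_map_map _ _ (Opens.infLERight (N t.1) W ≫ i),
      structure_map_map _ _ (Opens.infLERight (N t.1) W ≫ i)]
  obtain ⟨s', hs', -⟩ := TopCat.Sheaf.existsUnique_gluing' ⟨L.presheaf, L.isSheaf⟩
    (fun t : F => N t.1) V (fun t => j t.1) (fun t ht => by
      obtain ⟨u, hu⟩ := Set.mem_iUnion.1 (hF ht)
      obtain ⟨hu1, hu2⟩ := Set.mem_iUnion.1 hu
      exact Opens.mem_iSup.2 ⟨⟨u, hu1⟩, hu2⟩) y' (fun t t' => by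
      by_cases hne' : Nonempty ((N t.1 ⊓ N t'.1 : X.Opens) : Type u)
      swap
      · exact section_ext fun t ht => (hne' ⟨⟨t, ht⟩⟩).elim
      -- The extensions are only known to agree inside W. Irreducibility makes the overlap meet W,
      -- and restriction to that intersection is injective.
      have := opens_nonempty_inf (N t.1 ⊓ N t'.1) W
      let N' := N t.1 ⊓ N t'.1 ⊓ W
      refine hL.map_injective (homOfLE inf_le_left : N' ⟶ N t.1 ⊓ N t'.1) ?_
      let l : N' ⟶ N t.1 ⊓ W := homOfLE (le_inf (inf_le_left.trans inf_le_left) inf_le_right)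
      let l' : N' ⟶ N t'.1 ⊓ W := homOfLE (le_inf (inf_le_left.trans inf_le_right) inf_le_right)
      refine (modules_map_map _ _ _ (l ≫ Opens.infLELeft _ _) _).trans ?_
      refine Eq.trans ?_ (modules_map_map _ _ _ (l' ≫ Opens.infLELeft _ _) _).symm
      rw [← map_map, ← map_map, hy', hy', map_map, map_map]
      rfl)
  refine ⟨n', s', section_ext fun t ht => ?_⟩
  obtain ⟨u, hu⟩ := Set.mem_iUnion.1 (hF (i.le ht))
  obtain ⟨hu1, hu2⟩ := Set.mem_iUnion.1 hu
  refine ⟨N u ⊓ W, Opens.infLERight _ _, ⟨hu2, ht⟩, ?_⟩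
  rw [← hy' ⟨u, hu1⟩, modules_map_map _ _ _ (Opens.infLELeft _ _ ≫ j u), ← map_map]
  exact congrArg _ (hs' ⟨u, hu1⟩)

/-- This is the rank-one property. On a basic open set both sections are multiples of one generator,
and clearing powers of g brings the relation back to V. -/
lemma IsInvertible.exists_smul_eq_smul [IsIntegral X] (hL : IsInvertible L) {V : X.Opens}
    (hV : IsAffineOpen V) [hne : Nonempty V] (m m' : Γ(L, V)) (hm : m ≠ 0) :
    ∃ b c : Γ(X, V), c ≠ 0 ∧ b • m = c • m' := by
  obtain ⟨⟨t, ht⟩⟩ := hne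
  obtain ⟨g, htg, γ, hγ⟩ := hL.exists_generator_le hV t ht
  have : Nonempty (X.basicOpen g) := ⟨⟨t, htg⟩⟩
  let i : X.basicOpen g ⟶ V := homOfLE (X.basicOpen_le g)
  have := hV.isLocalization_basicOpen g
  have key : ∀ m : Γ(L, V), ∃ (n : ℕ) (b : Γ(X, V)),
      L.presheaf.map i.op (g ^ n • m) = X.presheaf.map i.op b • γ := fun m => by
    obtain ⟨x, hx⟩ := (hγ _ (𝟙 _)).2 (L.presheaf.map i.op m)
    dsimp only at hx
    rw [map_self] at hx
    obtain ⟨n, b, hb⟩ := IsLocalization.Away.surj g x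
    change x * X.presheaf.map i.op g ^ n = X.presheaf.map i.op b at hb
    refine ⟨n, b, ?_⟩
    rw [Scheme.Modules.map_smul, ← hx, map_pow, smul_smul, mul_comm, hb]
  obtain ⟨n, x, hx⟩ := key m
  obtain ⟨n', x', hx'⟩ := key m'
  have hg : g ≠ 0 := by
    rintro rfl
    rw [Scheme.basicOpen_zero] at htg
    exact htg
  have : Nonempty V := ⟨⟨t, ht⟩⟩
  refine ⟨x' * g ^ n, x * g ^ n', ?_, hL.map_injective i ?_⟩
  · refine mul_ne_zero ?_ (pow_ne_zero _ hg)
    rintro rfl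
    rw [map_zero, zero_smul] at hx
    have := hL.map_injective i (hx.trans (map_zero _).symm)
    rcases hL.eq_zero_of_smul_eq_zero _ _ this with h | h
    exacts [pow_ne_zero n hg h, hm h]
  · rw [mul_smul, mul_smul, Scheme.Modules.map_smul, hx, Scheme.Modules.map_smul, hx', smul_comm]

lemma IsInvertible.nontrivial_sections [IsIntegral X] (hL : IsInvertible L) {V : X.Opens}
    (hV : IsAffineOpen V) [hne : Nonempty V] : Nontrivial Γ(L, V) := by
  obtain ⟨⟨t, ht⟩⟩ := hne
  obtain ⟨g, htg, γ, hγ⟩ := hL.exists_generator_le hV t ht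
  have : Nonempty (X.basicOpen g) := ⟨⟨t, htg⟩⟩
  let i : X.basicOpen g ⟶ V := homOfLE (X.basicOpen_le g)
  obtain ⟨n, m, hm⟩ := hL.exists_map_eq_pow_smul hV g rfl i γ
  refine ⟨m, 0, ?_⟩
  rintro rfl
  have h1 : X.presheaf.map i.op (g ^ n) = 0 := (hγ _ (𝟙 _)).1 (by
    dsimp only
    rw [map_self, ← hm, map_zero, zero_smul])
  have h2 : IsUnit (X.presheaf.map i.op (g ^ n)) := by
    rw [map_pow]
    exact (RingedSpace.isUnit_res_basicOpen _ g).pow n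
  exact not_isUnit_zero (h1 ▸ h2)

/-- Functions whose nonvanishing loci cover an affine open set generate the unit ideal, and the
radical of J contains such a family. -/
lemma ideal_eq_top_of_forall_mem {V : X.Opens} (hV : IsAffineOpen V) (J : Ideal Γ(X, V))
    (h : ∀ t ∈ V, ∃ (g : Γ(X, V)) (n : ℕ), t ∈ X.basicOpen g ∧ g ^ n ∈ J) : J = ⊤ := by
  rw [← Ideal.radical_eq_top, ← top_le_iff]
  have h1 : Ideal.span {g : Γ(X, V) | ∃ n : ℕ, g ^ n ∈ J} = ⊤ := by
    rw [← hV.self_le_iSup_basicOpen_iff]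
    intro t ht
    obtain ⟨g, n, hg, hn⟩ := h t ht
    exact Opens.mem_iSup.2 ⟨⟨g, n, hn⟩, hg⟩
  rw [← h1, Ideal.span_le]
  exact fun g hg => hg

/-- Up to a power of g, a local generator on D(g) extends to V. The extensions for a finite cover
generate. -/
lemma IsInvertible.finite_sections [IsIntegral X] (hL : IsInvertible L) {V : X.Opens}
    (hV : IsAffineOpen V) : Module.Finite Γ(X, V) Γ(L, V) := by
  have hloc : ∀ t : V, ∃ (g : Γ(X, V)) (_ : t.1 ∈ X.basicOpen g) (m : Γ(L, V)),
      ∀ x : Γ(L, V), ∃ (n : ℕ) (b : Γ(X, V)), g ^ n • x = b • m := by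
    rintro ⟨t, ht⟩
    obtain ⟨g, htg, γ, hγ⟩ := hL.exists_generator_le hV t ht
    have : Nonempty (X.basicOpen g) := ⟨⟨t, htg⟩⟩
    let i : X.basicOpen g ⟶ V := homOfLE (X.basicOpen_le g)
    obtain ⟨n, m, hm⟩ := hL.exists_map_eq_pow_smul hV g rfl i γ
    refine ⟨g, htg, m, fun x => ?_⟩
    obtain ⟨c, hc⟩ := (hγ _ (𝟙 _)).2 (L.presheaf.map i.op x)
    dsimp only at hc
    rw [map_self] at hc
    have := hV.isLocalization_basicOpen g
    obtain ⟨a, b, hb⟩ := IsLocalization.Away.surj g c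
    change c * X.presheaf.map i.op g ^ a = X.presheaf.map i.op b at hb
    refine ⟨n + a, b, hL.map_injective i ?_⟩
    rw [Scheme.Modules.map_smul, Scheme.Modules.map_smul, ← hb, hm, ← hc, map_pow, map_pow, smul_smul,
      smul_smul]
    congr 1
    ring
  choose g hg m hm using hloc
  have hspan : Ideal.span (Set.range g) = ⊤ := by
    rw [← hV.self_le_iSup_basicOpen_iff]
    intro t ht
    exact Opens.mem_iSup.2 ⟨⟨g ⟨t, ht⟩, ⟨t, ht⟩, rfl⟩, hg ⟨t, ht⟩⟩
  obtain ⟨F, hF, hF'⟩ := (Ideal.span_eq_top_iff_finite _).1 hspan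
  choose u hu using fun c (hc : c ∈ F) => hF hc
  classical
  refine ⟨⟨F.attach.image fun c => m (u c.1 c.2), ?_⟩⟩
  rw [← top_le_iff]
  intro x _
  let S : Submodule Γ(X, V) Γ(L, V) := Submodule.span _ (F.attach.image fun c => m (u c.1 c.2) : Set _)
  -- The ideal of functions that multiply x into S: it contains a power of each of finitely many
  -- functions generating the unit ideal, hence it contains 1.
  let J : Ideal Γ(X, V) := S.comap (LinearMap.toSpanSingleton _ _ x)
  have hJ : J = ⊤ := by
    rw [← Ideal.radical_eq_top, ← top_le_iff, ← hF', Ideal.span_le]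
    intro c hc
    obtain ⟨n, b, hb⟩ := hm (u c hc) x
    refine ⟨n, ?_⟩
    change c ^ n • x ∈ S
    rw [← hu c hc, hb]
    exact S.smul_mem _ (Submodule.subset_span (Finset.mem_coe.2 (Finset.mem_image_of_mem _ (F.mem_attach ⟨c, hc⟩))))
  have h1 : (1 : Γ(X, V)) ∈ J := by rw [hJ]; trivial
  change (1 : Γ(X, V)) • x ∈ S at h1
  rw [one_smul] at h1
  exact h1

end invertible

/-! ### Direct images along affine morphisms -/

section push

open Scheme.Modules

variable {X T : Scheme.{u}} [IsIntegral X] {L : X.Modules} (f : X ⟶ T)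

lemma IsInvertible.pushforward_map_injective (hL : IsInvertible L) {V W : T.Opens} (i : W ⟶ V)
    [hW : Nonempty (f ⁻¹ᵁ W)] :
    Function.Injective (((pushforward f).obj L).presheaf.map i.op) :=
  hL.map_injective ((Opens.map f.base).map i)

lemma IsInvertible.pushforward_exists_map_eq_pow_smul [IsAffineHom f] (hL : IsInvertible L)
    {V W : T.Opens} (hV : IsAffineOpen V) (g : Γ(T, V)) (hW : W = T.basicOpen g) (i : W ⟶ V)
    (s : Γ((pushforward f).obj L, W)) :
    ∃ (n : ℕ) (s' : Γ((pushforward f).obj L, V)),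
      ((pushforward f).obj L).presheaf.map i.op s' = T.presheaf.map i.op (g ^ n) • s := by
  obtain ⟨n, s', h⟩ := hL.exists_map_eq_pow_smul (hV.preimage f) (f.app V g)
    (by rw [hW]; exact Scheme.preimage_basicOpen f g) ((Opens.map f.base).map i) s
  refine ⟨n, s', h.trans ?_⟩
  have h1 : X.presheaf.map ((Opens.map f.base).map i).op (f.app V (g ^ n)) =
    f.app W (T.presheaf.map i.op (g ^ n)) :=
    (ConcreteCategory.congr_hom (f.naturality i.op) (g ^ n)).symm
  rw [← map_pow, h1]
  rfl

variable {k : Type u} [Field k] {A : Type u} [Group A] (s : T ⟶ Spec (CommRingCat.of k))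

lemma groupAlgebraEnd_smul {M : T.Modules} (a : A →* End M) (U : T.Opens) (r : MonoidAlgebra k A)
    (c : Γ(T, U)) (x : Γ(M, U)) :
    groupAlgebraEnd s M a U r (c • x) = c • groupAlgebraEnd s M a U r x := by
  induction r using MonoidAlgebra.induction_linear with
  | zero => rw [map_zero]; exact (smul_zero c).symm
  | add r r' h h' => rw [groupAlgebraEnd_add_apply, groupAlgebraEnd_add_apply, h, h', smul_add]
  | single g b =>
    rw [groupAlgebraEnd_single, groupAlgebraEnd_single, Scheme.Modules.Hom.app_smul, smul_comm]

/-- The image of `r₂` on the kernel of `r₁` can be computed on an affine open set. -/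
lemma IsInvertible.exists_groupAlgebraEnd_eq [IsAffineHom f] (hL : IsInvertible L)
    (a : A →* End ((pushforward f).obj L)) (r₁ r₂ : MonoidAlgebra k A) {V : T.Opens}
    (hV : IsAffineOpen V) (z : Γ((pushforward f).obj L, V))
    (h : ∀ t ∈ V, ∃ (W : T.Opens) (i : W ⟶ V), t ∈ W ∧
      ∃ y, groupAlgebraEnd s _ a W r₁ y = 0 ∧
        groupAlgebraEnd s _ a W r₂ y = ((pushforward f).obj L).presheaf.map i.op z) :
    ∃ y, groupAlgebraEnd s _ a V r₁ y = 0 ∧ groupAlgebraEnd s _ a V r₂ y = z := by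
  -- The ideal of functions c for which c z has a solution over all of V. A local solution on D(g)
  -- extends after multiplication by a power of g, and that power then lies in J.
  let J : Ideal Γ(T, V) :=
    { carrier := {c | ∃ y, groupAlgebraEnd s _ a V r₁ y = 0 ∧
        groupAlgebraEnd s _ a V r₂ y = c • z}
      zero_mem' := ⟨0, map_zero _, by rw [map_zero, zero_smul]⟩
      add_mem' := by
        rintro c c' ⟨y, h1, h2⟩ ⟨y', h1', h2'⟩
        exact ⟨y + y', by rw [map_add, h1, h1', add_zero], by rw [map_add, h2, h2', add_smul]⟩
      smul_mem' := by
        rintro c c' ⟨y, h1, h2⟩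
        exact ⟨c • y, by rw [groupAlgebraEnd_smul, h1, smul_zero],
          by rw [groupAlgebraEnd_smul, h2, smul_smul, smul_eq_mul]⟩ }
  have hJ : J = ⊤ := by
    refine ideal_eq_top_of_forall_mem hV J fun t ht => ?_
    obtain ⟨W, j, htW, y, hy1, hy2⟩ := h t ht
    obtain ⟨g, hg, htg⟩ := hV.exists_basicOpen_le ⟨t, htW⟩ ht
    let i : T.basicOpen g ⟶ V := homOfLE (T.basicOpen_le g)
    let l : T.basicOpen g ⟶ W := homOfLE hg
    by_cases hne : Nonempty (f ⁻¹ᵁ T.basicOpen g)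
    · obtain ⟨n, y', hy'⟩ := hL.pushforward_exists_map_eq_pow_smul f hV g rfl i
        (((pushforward f).obj L).presheaf.map l.op y)
      refine ⟨g, n, htg, y', hL.pushforward_map_injective f i ?_,
        hL.pushforward_map_injective f i ?_⟩
      · rw [← groupAlgebraEnd_map, hy', groupAlgebraEnd_smul, groupAlgebraEnd_map, hy1, map_zero,
          map_zero, smul_zero]
      · rw [← groupAlgebraEnd_map, hy', groupAlgebraEnd_smul, groupAlgebraEnd_map, hy2,
          modules_map_map _ l j i, Scheme.Modules.map_smul]
    -- If D(g) has empty preimage, g pulls back to zero on the integral scheme X, so g z = 0 and y =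
    -- 0 is a solution.
    · refine ⟨g, 1, htg, 0, map_zero _, ?_⟩
      have h0 : f.app V g = 0 := by
        apply eq_zero_of_basicOpen_eq_bot
        rw [← Scheme.preimage_basicOpen]
        exact Opens.not_nonempty_iff_eq_bot _ |>.1 fun ⟨x, hx⟩ => hne ⟨⟨x, hx⟩⟩
      rw [map_zero, pow_one]
      change 0 = (show Γ(L, f ⁻¹ᵁ V) from f.app V g • (show Γ(L, f ⁻¹ᵁ V) from z))
      rw [h0]
      exact (zero_smul Γ(X, f ⁻¹ᵁ V) (show Γ(L, f ⁻¹ᵁ V) from z)).symm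
  have h1 : (1 : Γ(T, V)) ∈ J := by rw [hJ]; trivial
  obtain ⟨y, hy1, hy2⟩ := h1
  exact ⟨y, hy1, by rw [hy2, one_smul]⟩

end push

/-! ### Divisibility among the elements g - 1 of the group algebra -/

section groupAlgebraIdentities

variable {k : Type u} [Field k] {G : Type u} [CommGroup G]

lemma single_pow_one (g : G) (n : ℕ) :
    MonoidAlgebra.single (g ^ n) (1 : k) = MonoidAlgebra.single g (1 : k) ^ n := by
  rw [MonoidAlgebra.single_pow, one_pow]

lemma subOne_dvd_subOne [Finite G] {g h : G} (hh : h ∈ Subgroup.zpowers g) :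
    subOne k g ∣ subOne k h := by
  obtain ⟨n, rfl⟩ := (isOfFinOrder_of_finite g).mem_powers_iff_mem_zpowers.2 hh
  dsimp only
  rw [subOne, subOne, single_pow_one]
  exact sub_one_dvd_pow_sub_one _ _

/-- The Frobenius identity (x - 1)^(p^n) = x^(p^n) - 1 in a commutative ring of characteristic p. -/
lemma subOne_pow_char (p : ℕ) [Fact p.Prime] [CharP k p] (g : G) (n : ℕ) :
    subOne k g ^ p ^ n = subOne k (g ^ p ^ n) := by
  have : CharP (MonoidAlgebra k G) p :=
    charP_of_injective_algebraMap (algebraMap k (MonoidAlgebra k G)).injective p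
  rw [subOne, sub_pow_char_pow, one_pow, subOne, single_pow_one]

variable {p : ℕ} [Fact p.Prime] {v : ℕ} (hv : 1 ≤ v) (hG : Nat.card G = p ^ v)
  {σ : G} (hσ : ∀ g, g ∈ Subgroup.zpowers σ) {H : Subgroup G} (hH : Nat.card H = p ^ (v - 1))

include hv hG hσ hH

/-- The quotient by H has order p, so σ^p lies in H, and its order equals that of H. -/
lemma zpowers_pow_eq : Subgroup.zpowers (σ ^ p) = H := by
  have hp : 0 < p := (Fact.out : p.Prime).pos
  have hfin : Finite G := Nat.finite_of_card_ne_zero (by rw [hG]; positivity)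
  have hq : Nat.card (G ⧸ H) = p := by
    have h1 := H.card_eq_card_quotient_mul_card_subgroup
    rw [hG, hH, ← Nat.sub_add_cancel hv, Nat.add_sub_cancel, pow_succ, mul_comm] at h1
    exact (Nat.eq_of_mul_eq_mul_right (by positivity) h1).symm
  refine Subgroup.eq_of_le_of_card_ge ?_ ?_
  · rw [Subgroup.zpowers_le, ← QuotientGroup.eq_one_iff, QuotientGroup.mk_pow]
    conv_lhs => rw [← hq]
    exact pow_card_eq_one'
  · rw [hH, Nat.card_zpowers, orderOf_pow, orderOf_eq_card_of_forall_mem_zpowers hσ, hG,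
      Nat.gcd_eq_right (dvd_pow_self p (by omega)), ← Nat.pow_div hv hp, pow_one]

/-- Any lift of a generator of the quotient generates G: modulo H = ⟨σ^p⟩ some power of the lift
agrees with σ, so it equals σ^n with n prime to p. -/
lemma mem_zpowers_of_generates_quotient {g : G} {q : G ⧸ H} (hg : (g : G ⧸ H) = q)
    (hq : ∀ x, x ∈ Subgroup.zpowers q) : σ ∈ Subgroup.zpowers g := by
  subst hg
  obtain ⟨m, hm⟩ := hq σ
  dsimp only at hm
  rw [← QuotientGroup.mk_zpow, QuotientGroup.eq, ← zpowers_pow_eq hv hG hσ hH] at hm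
  obtain ⟨c, hc⟩ := hm
  dsimp only at hc
  have h1 : σ ^ (1 - p * c : ℤ) = g ^ m := by
    rw [zpow_sub, zpow_one, zpow_mul, zpow_natCast, hc]
    group
  -- A Bézout relation inverts the exponent 1 - pc modulo the order p^v of σ.
  have h2 : IsCoprime (1 - p * c : ℤ) ((p : ℤ) ^ v) :=
    IsCoprime.pow_right ⟨1, c, by ring⟩
  obtain ⟨a, b, hab⟩ := h2
  have h3 : σ ^ (p ^ v) = 1 := by rw [← hG]; exact pow_card_eq_one'
  have h4 : σ = (g ^ m) ^ a := by
    rw [← h1, ← zpow_mul]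
    calc σ = σ ^ (a * (1 - p * c) + b * (p : ℤ) ^ v) := by rw [hab, zpow_one]
      _ = σ ^ ((1 - p * c) * a : ℤ) := by
        rw [zpow_add, mul_comm b, zpow_mul σ ((p : ℤ) ^ v)]
        have : σ ^ ((p : ℤ) ^ v) = 1 := by rw [← h3]; norm_cast
        rw [this, one_zpow, mul_one, mul_comm]
  rw [h4]
  exact Subgroup.zpow_mem _ (Subgroup.zpow_mem _ (Subgroup.mem_zpowers g) _) _

end groupAlgebraIdentities

/-! ### Equivariance of the embedding of the graded piece -/

section equivariance

open Scheme.Modules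

variable {k : Type u} [Field k]

lemma groupAlgebraEnd_subOne {G : Type u} [CommGroup G] {T : Scheme.{u}}
    (s : T ⟶ Spec (CommRingCat.of k)) {M : T.Modules} (a : G →* End M) (U : T.Opens) (g : G)
    (x : Γ(M, U)) :
    groupAlgebraEnd s M a U (subOne k g) x = Scheme.Modules.Hom.app (a g) U x - x := by
  have h1 : MonoidAlgebra.single g (1 : k) = subOne k g + 1 := by rw [subOne, sub_add_cancel]
  have h2 := groupAlgebraEnd_single s M a U g (1 : k) x
  rw [h1, groupAlgebraEnd_add_apply, map_one, map_one, one_smul] at h2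
  exact eq_sub_of_add_eq h2

/-- A map of sections that intertwines `g` and `g'` intertwines the powers of `g - 1` and
`g' - 1`. -/
lemma map_groupAlgebraEnd_subOne_pow {G G' : Type u} [CommGroup G] [CommGroup G']
    {T T' : Scheme.{u}} (s : T ⟶ Spec (CommRingCat.of k)) (s' : T' ⟶ Spec (CommRingCat.of k))
    {M : T.Modules} {M' : T'.Modules} (a : G →* End M) (a' : G' →* End M')
    {U : T.Opens} {U' : T'.Opens} (φ : Γ(M, U) →+ Γ(M', U')) (g : G) (g' : G')
    (hφ : ∀ x, φ (Scheme.Modules.Hom.app (a g) U x) = Scheme.Modules.Hom.app (a' g') U' (φ x))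
    (n : ℕ) (x : Γ(M, U)) :
    φ (groupAlgebraEnd s M a U (subOne k g ^ n) x) =
      groupAlgebraEnd s' M' a' U' (subOne k g' ^ n) (φ x) := by
  induction n with
  | zero => rw [pow_zero, pow_zero, map_one, map_one]; rfl
  | succ n ih =>
    rw [pow_succ', pow_succ', groupAlgebraEnd_mul_apply, groupAlgebraEnd_mul_apply, ← ih,
      groupAlgebraEnd_subOne, groupAlgebraEnd_subOne, map_sub, hφ]

namespace GSheaf

lemma sec_descendLin_out {G : Type u} [Group G] {X : Scheme.{u}} {H : Subgroup G} [H.Normal]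
    {ρQ : G ⧸ H →* Aut X} (N : GSheaf (ρQ.comp (QuotientGroup.mk' H))) (q : G ⧸ H)
    {U V : X.Opens} (e : actHom ρQ q ⁻¹ᵁ U = V) (x : Γ(N.sheaf, V)) :
    sec (N.descendLin q) U V e x = sec (N.lin q.out) U V ((preimage_out q U).trans e) x := by
  subst e
  exact sec_self (N.descendLin q) U x

/-- The direct image of the cokernel projection is still an epimorphism, so compatibility can be
tested before passing to the cokernel. -/
lemma map_comp_lin_of_cokernel {G : Type u} [Group G] {X : Scheme.{u}} {ρ : G →* Aut X}
    {A B C : GSheaf ρ} (φ : A.sheaf ⟶ B.sheaf)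
    (hφ : ∀ g, (pushforward (actHom ρ g)).map φ ≫ B.lin g = A.lin g ≫ φ)
    (ε : Limits.cokernel φ ⟶ C.sheaf) (g : G)
    (h : (pushforward (actHom ρ g)).map (Limits.cokernel.π φ ≫ ε) ≫ C.lin g =
      B.lin g ≫ Limits.cokernel.π φ ≫ ε) :
    (pushforward (actHom ρ g)).map ε ≫ C.lin g = cokernelLin φ hφ g ≫ ε := by
  rw [← cancel_epi ((pushforward (actHom ρ g)).map (Limits.cokernel.π φ)), ← Category.assoc,
    ← Category.assoc, map_π_cokernelLin, ← Functor.map_comp, Category.assoc, h]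

variable {G : Type u} [Group G] {X : Scheme.{u}} {ρ : G →* Aut X} (F : GSheaf ρ)
  (s : X ⟶ Spec (CommRingCat.of k)) (hs : ∀ g, actHom ρ g ≫ s = s)
  {H : Type u} [CommGroup H] (a : H →* End F.sheaf)
  (ha : ∀ (g : G) (h : H) (U V : X.Opens) (e : actHom ρ g ⁻¹ᵁ U = V) (x : Γ(F.sheaf, V)),
    sec (F.lin g) U V e (Scheme.Modules.Hom.app (a h) V x) =
      Scheme.Modules.Hom.app (a h) U (sec (F.lin g) U V e x))
  (τ : H) (l : ℕ)

/-- Evaluation at a fixed vector commutes with g because the action on maps is (g f)(v) = g (f v).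
-/
lemma map_grEval_comp_lin (g : G) :
    (pushforward (actHom ρ g)).map (grEval s a τ l) ≫ F.lin g =
      (F.homCokernel s hs a ha (jordanProj k τ (Nat.sub_le l 1))).lin g ≫ grEval s a τ l := by
  refine map_comp_lin_of_cokernel (A := F.hom s hs a ha (JordanModule k τ (l - 1)))
    (B := F.hom s hs a ha (JordanModule k τ l)) _ (F.hom_naturality s hs a ha _ _)
    (grEval s a τ l) g ?_
  have h1 : Limits.cokernel.π (homSheafMap s F.sheaf a (jordanProj k τ (Nat.sub_le l 1))) ≫
    grEval s a τ l = evalTop s a τ l := Limits.cokernel.π_desc _ _ _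
  have h2 : (pushforward (actHom ρ g)).map (evalTop s a τ l) ≫ F.lin g =
      (F.hom s hs a ha (JordanModule k τ l)).lin g ≫ evalTop s a τ l := by
    refine Scheme.Modules.hom_ext _ _ fun U => ?_
    ext f
    exact (sec_self (F.lin g) U _).symm
  exact (congrArg (fun t => (pushforward (actHom ρ g)).map t ≫ F.lin g) h1).trans
    (h2.trans (congrArg (fun t => (F.hom s hs a ha (JordanModule k τ l)).lin g ≫ t) h1).symm)

lemma grEval_app_sec_lin (g : G) {U V : X.Opens} (e : actHom ρ g ⁻¹ᵁ U = V)
    (x : Γ((F.homCokernel s hs a ha (jordanProj k τ (Nat.sub_le l 1))).sheaf, V)) :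
    (grEval s a τ l).app U
        (sec ((F.homCokernel s hs a ha (jordanProj k τ (Nat.sub_le l 1))).lin g) U V e x) =
      sec (F.lin g) U V e ((grEval s a τ l).app V x) := by
  subst e
  rw [sec_self, sec_self]
  exact (ConcreteCategory.congr_hom (congrArg (fun t => Scheme.Modules.Hom.app t U)
    (F.map_grEval_comp_lin s hs a ha τ l g)) x).symm

end GSheaf

end equivariance

/-! ### The quotient group acting on the graded piece for H -/

section residual

open Scheme.Modules GSheaf

variable {k : Type u} [Field k] {G : Type u} [CommGroup G] {X Z Y : Scheme.{u}} {ρ : G →* Aut X}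
  (L : GSheaf ρ) {H : Subgroup G}
  {ρZ : G ⧸ H →* Aut Z} (sZ : Z ⟶ Spec (CommRingCat.of k)) (hs : ∀ q, actHom ρZ q ≫ sZ = sZ)
  (α : X ⟶ Z) (hinv : ∀ h, actHom (ρ.comp H.subtype) h ≫ α = α)
  (hα : ∀ g : G, actHom ρ g ≫ α = α ≫ actHom ρZ (g : G ⧸ H))
  {τ : H} (hτ : ∀ h, h ∈ Subgroup.zpowers τ) (l : ℕ)

/-- The embedding of `gr_0 L(V_l)` into `α_* L`. -/
def residualEval : (L.gr0Residual sZ hs α hinv hα hτ l).sheaf ⟶ (pushforward α).obj L.sheaf :=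
  grEval sZ ((L.restrict H).act α hinv) τ l

/-- A coset has no action of its own on α_* L, but on the image of the graded piece it acts as the
chosen representative `q.out` does. -/
lemma residualEval_app_sec_lin (q : G ⧸ H) {U V : Z.Opens} (e : actHom ρZ q ⁻¹ᵁ U = V)
    (x : Γ((L.gr0Residual sZ hs α hinv hα hτ l).sheaf, V)) :
    (residualEval L sZ hs α hinv hα hτ l).app U
        (sec ((L.gr0Residual sZ hs α hinv hα hτ l).lin q) U V e x) =
      sec (L.lin q.out) (α ⁻¹ᵁ U) (α ⁻¹ᵁ V)
        (preimage_push (ρZ := ρZ.comp (QuotientGroup.mk' H)) α hα q.out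
          ((preimage_out q U).trans e))
        ((residualEval L sZ hs α hinv hα hτ l).app V x) := by
  refine (congrArg ((residualEval L sZ hs α hinv hα hτ l).app U)
    (sec_descendLin_out (L.underlineCokernel sZ hs α hinv hα
      (jordanProj k τ (Nat.sub_le l 1))) q e x)).trans ?_
  refine ((L.push (ρZ := ρZ.comp (QuotientGroup.mk' H)) α hα).grEval_app_sec_lin sZ
    (fun g => hs (g : G ⧸ H)) ((L.restrict H).act α hinv) (L.lin_act_comm α hinv hα) τ l
    q.out _ x).trans ?_
  exact L.sec_pushLin α hα q.out _ _

end residual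

/-- The image of b on the kernel of a depends on a and b only up to mutual divisibility: a cofactor
relating b and b' is absorbed into w, which stays in the kernel. The condition on c is automatic
after this change of w because c is a multiple of a. -/
lemma exists_apply_eq_iff_of_dvd {R M : Type*} [CommRing R] [AddCommGroup M]
    (E : R →+* AddMonoid.End M) {a b c a' b' : R} (ha : a ∣ a') (ha' : a' ∣ a) (hb : b ∣ b')
    (hb' : b' ∣ b) (hc : a ∣ c) (z : M) :
    (∃ w, E a w = 0 ∧ E b w = z) ↔ ∃ w, E c w = 0 ∧ E a' w = 0 ∧ E b' w = z := by
  have key : ∀ {x y : R} (u : R) (w : M), x ∣ y → E x w = 0 → E y (E u w) = 0 := by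
    rintro x _ u w ⟨d, rfl⟩ h
    have h1 : E (x * d) (E u w) = E (d * u * x) w := by
      rw [show d * u * x = x * d * u by ring, map_mul E (x * d) u]; rfl
    rw [h1, map_mul]
    exact (congrArg (E (d * u)) h).trans (map_zero (E (d * u)))
  constructor
  · rintro ⟨w, h1, h2⟩
    obtain ⟨u, rfl⟩ := hb'
    refine ⟨E u w, key u w hc h1, key u w ha h1, ?_⟩
    rw [← h2, map_mul]; rfl
  · rintro ⟨w, -, h1, h2⟩
    obtain ⟨u, rfl⟩ := hb
    refine ⟨E u w, key u w ha' h1, ?_⟩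
    rw [← h2, map_mul]; rfl

lemma grEval_exists {k : Type u} [Field k] {A : Type u} [CommGroup A] {T : Scheme.{u}}
    (s : T ⟶ Spec (CommRingCat.of k)) {M : T.Modules} (a : A →* End M) (σ : A) (j : ℕ)
    (U : T.Opens) (y : Γ(M, U)) (hy : groupAlgebraEnd s M a U (subOne k σ ^ j) y = 0) :
    ∃ x, (grEval s a σ j).app U x = groupAlgebraEnd s M a U (subOne k σ ^ (j - 1)) y :=
  (grEval_range s a σ j U _).2 fun _ ht => ⟨U, 𝟙 U, ht, y, hy, (map_self M _ _).symm⟩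

/-! ### Comparison of the two subsheaves of the direct image of L -/

section comparison

open Scheme.Modules GSheaf

variable {k : Type u} [Field k] {G : Type u} [CommGroup G] {X Z Y : Scheme.{u}} {ρ : G →* Aut X}
  (L : GSheaf ρ) {H : Subgroup G}
  {ρZ : G ⧸ H →* Aut Z} (sZ : Z ⟶ Spec (CommRingCat.of k)) (hs : ∀ q, actHom ρZ q ≫ sZ = sZ)
  (sY : Y ⟶ Spec (CommRingCat.of k))
  (α : X ⟶ Z) (hinv : ∀ h, actHom (ρ.comp H.subtype) h ≫ α = α)
  (hα : ∀ g : G, actHom ρ g ≫ α = α ≫ actHom ρZ (g : G ⧸ H))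
  (β : Z ⟶ Y) (hβ : ∀ q, actHom ρZ q ≫ β = β) (hπ : ∀ g, actHom ρ g ≫ α ≫ β = α ≫ β)
  {τ : H} (hτ : ∀ h, h ∈ Subgroup.zpowers τ) (l : ℕ) (ε : G ⧸ H) (j' : ℕ)

/-- The embedding of `gr_0 (gr_0 L(V_l))(V_j')` into `π_* L`. -/
def iteratedEval : (L.gr0Residual sZ hs α hinv hα hτ l).gr0 sY β hβ ε j' ⟶
    (pushforward (α ≫ β)).obj L.sheaf :=
  grEval sY ((L.gr0Residual sZ hs α hinv hα hτ l).act β hβ) ε j' ≫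
    (pushforward β).map (residualEval L sZ hs α hinv hα hτ l) ≫
      (pushforwardComp α β).hom.app L.sheaf

lemma residualEval_injective (U : Z.Opens) :
    Function.Injective ((residualEval L sZ hs α hinv hα hτ l).app U) :=
  grEval_injective sZ ((L.restrict H).act α hinv) τ l U

lemma iteratedEval_injective (U : Y.Opens) :
    Function.Injective ((iteratedEval L sZ hs sY α hinv hα β hβ hτ l ε j').app U) := by
  intro x y h
  exact grEval_injective sY _ ε j' U (residualEval_injective L sZ hs α hinv hα hτ l _ h)

lemma residualEval_groupAlgebraEnd (U : Y.Opens) (n : ℕ)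
    (x : Γ((pushforward β).obj (L.gr0Residual sZ hs α hinv hα hτ l).sheaf, U)) :
    (residualEval L sZ hs α hinv hα hτ l).app (β ⁻¹ᵁ U) (groupAlgebraEnd sY _
        ((L.gr0Residual sZ hs α hinv hα hτ l).act β hβ) U (subOne k ε ^ n) x) =
      groupAlgebraEnd sY _ (L.act (α ≫ β) hπ) U (subOne k ε.out ^ n)
        ((residualEval L sZ hs α hinv hα hτ l).app (β ⁻¹ᵁ U) x) := by
  refine map_groupAlgebraEnd_subOne_pow sY sY
    ((L.gr0Residual sZ hs α hinv hα hτ l).act β hβ) (L.act (α ≫ β) hπ) (U := U) (U' := U)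
    ((residualEval L sZ hs α hinv hα hτ l).app (β ⁻¹ᵁ U)).hom ε ε.out (fun y => ?_) n x
  exact residualEval_app_sec_lin L sZ hs α hinv hα hτ l ε (preimage_invariant β hβ ε U) y

/-- Sections of α_* L over β⁻¹U and of π_* L over U are the same group, with the same action of τ.
-/
lemma restrict_groupAlgebraEnd (U : Y.Opens) (n : ℕ)
    (x : Γ((pushforward (α ≫ β)).obj L.sheaf, U)) :
    groupAlgebraEnd sZ _ ((L.restrict H).act α hinv) (β ⁻¹ᵁ U) (subOne k τ ^ n) x =
      groupAlgebraEnd sY _ (L.act (α ≫ β) hπ) U (subOne k (τ : G) ^ n) x :=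
  map_groupAlgebraEnd_subOne_pow sZ sY ((L.restrict H).act α hinv) (L.act (α ≫ β) hπ)
    (U := β ⁻¹ᵁ U) (U' := U) (AddMonoidHom.id _) τ (τ : G) (fun _ => rfl) n x

/-- Two applications of `grEval_range`; the residual embedding turns ε - 1 into `ε.out` - 1, which
then composes with the power of τ - 1 inside one group algebra. -/
lemma iteratedEval_range [IsIntegral X] [IsAffineHom α] [IsAffineHom β]
    (hL : IsInvertible L.sheaf) (U : Y.Opens) (z : Γ((pushforward (α ≫ β)).obj L.sheaf, U)) :
    (∃ x, (iteratedEval L sZ hs sY α hinv hα β hβ hτ l ε j').app U x = z) ↔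
      ∀ t ∈ U, ∃ (W : Y.Opens) (i : W ⟶ U), t ∈ W ∧
        ∃ w, groupAlgebraEnd sY _ (L.act (α ≫ β) hπ) W (subOne k (τ : G) ^ l) w = 0 ∧
          groupAlgebraEnd sY _ (L.act (α ≫ β) hπ) W
            (subOne k ε.out ^ j' * subOne k (τ : G) ^ (l - 1)) w = 0 ∧
          groupAlgebraEnd sY _ (L.act (α ≫ β) hπ) W
            (subOne k ε.out ^ (j' - 1) * subOne k (τ : G) ^ (l - 1)) w =
              ((pushforward (α ≫ β)).obj L.sheaf).presheaf.map i.op z := by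
  constructor
  · rintro ⟨x, rfl⟩ t ht
    obtain ⟨W, i, htW, y, hy1, hy2⟩ := (grEval_range sY
      ((L.gr0Residual sZ hs α hinv hα hτ l).act β hβ) ε j' U _).1 ⟨x, rfl⟩ t ht
    -- The preimage of y under (τ - 1)^(l-1) exists only locally on Z. Shrinking to an affine W'
    -- makes β⁻¹W' affine, so that a single w works over all of it.
    obtain ⟨W', hW', htW', hle⟩ := exists_isAffineOpen_mem_and_subset htW
    let i' : W' ⟶ W := homOfLE hle
    obtain ⟨y', hy'⟩ : ∃ y', y' = ((pushforward β).obj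
      (L.gr0Residual sZ hs α hinv hα hτ l).sheaf).presheaf.map i'.op y := ⟨_, rfl⟩
    have hy1' := groupAlgebraEnd_map sY _ ((L.gr0Residual sZ hs α hinv hα hτ l).act β hβ) i'
      (subOne k ε ^ j') y
    have hy2' := groupAlgebraEnd_map sY _ ((L.gr0Residual sZ hs α hinv hα hτ l).act β hβ) i'
      (subOne k ε ^ (j' - 1)) y
    rw [hy1, map_zero, ← hy'] at hy1'
    rw [hy2, ← hy', map_map] at hy2'
    obtain ⟨w, hw1, hw2⟩ := hL.exists_groupAlgebraEnd_eq α sZ ((L.restrict H).act α hinv)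
      (subOne k τ ^ l) (subOne k τ ^ (l - 1)) (hW'.preimage β) _
      ((grEval_range sZ ((L.restrict H).act α hinv) τ l (β ⁻¹ᵁ W') _).1 ⟨y', rfl⟩)
    have hw1' := (restrict_groupAlgebraEnd L sZ sY α hinv β hπ W' l w).symm.trans hw1
    have hw2' := (restrict_groupAlgebraEnd L sZ sY α hinv β hπ W' (l - 1) w).symm.trans hw2
    refine ⟨W', i' ≫ i, htW', w, hw1', ?_, ?_⟩
    · refine (groupAlgebraEnd_mul_apply sY _ (L.act (α ≫ β) hπ) W' _ _ w).trans ?_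
      rw [hw2']
      refine (residualEval_groupAlgebraEnd L sZ hs sY α hinv hα β hβ hπ hτ l ε W' j' y').symm.trans
        ?_
      rw [hy1']
      exact map_zero ((residualEval L sZ hs α hinv hα hτ l).app (β ⁻¹ᵁ W')).hom
    · refine (groupAlgebraEnd_mul_apply sY _ (L.act (α ≫ β) hπ) W' _ _ w).trans ?_
      rw [hw2']
      refine (residualEval_groupAlgebraEnd L sZ hs sY α hinv hα β hβ hπ hτ l ε W' (j' - 1)
        y').symm.trans ?_
      rw [hy2']
      exact app_map (residualEval L sZ hs α hinv hα hτ l) ((Opens.map β.base).map (i' ≫ i)) _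
  · intro h
    refine exists_app_eq_of_locally _
      (iteratedEval_injective L sZ hs sY α hinv hα β hβ hτ l ε j') z fun t ht => ?_
    obtain ⟨W, i, htW, w, hw1, hw2, hw3⟩ := h t ht
    rw [← restrict_groupAlgebraEnd L sZ sY α hinv β hπ] at hw1
    rw [groupAlgebraEnd_mul_apply, ← restrict_groupAlgebraEnd L sZ sY α hinv β hπ] at hw2 hw3
    obtain ⟨y, hy⟩ := grEval_exists sZ ((L.restrict H).act α hinv) τ l (β ⁻¹ᵁ W) w hw1
    rw [← hy] at hw2 hw3
    have hy1 : groupAlgebraEnd sY _ ((L.gr0Residual sZ hs α hinv hα hτ l).act β hβ) W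
        (subOne k ε ^ j') y = 0 := by
      apply residualEval_injective L sZ hs α hinv hα hτ l
      refine Eq.trans ?_
        (map_zero ((residualEval L sZ hs α hinv hα hτ l).app (β ⁻¹ᵁ W)).hom).symm
      exact (residualEval_groupAlgebraEnd L sZ hs sY α hinv hα β hβ hπ hτ l ε W j' y).trans hw2
    obtain ⟨x, hx⟩ := grEval_exists sY ((L.gr0Residual sZ hs α hinv hα hτ l).act β hβ) ε j' W y hy1
    refine ⟨W, i, htW, x, ?_⟩
    rw [← hw3]
    refine Eq.trans ?_
      (residualEval_groupAlgebraEnd L sZ hs sY α hinv hα β hβ hπ hτ l ε W (j' - 1) y)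
    exact congrArg ((residualEval L sZ hs α hinv hα hτ l).app (β ⁻¹ᵁ W)) hx

/-- The isomorphism between the graded pieces for `G` and the iterated graded pieces. -/
lemma nonempty_gr0_iso [IsIntegral X] [IsAffineHom α] [IsAffineHom β]
    (hL : IsInvertible L.sheaf) (p : ℕ) [Fact p.Prime] [CharP k p] (v : ℕ) (hv : 2 ≤ v)
    (hG : Nat.card G = p ^ v) (σ : G) (hσ : ∀ g, g ∈ Subgroup.zpowers σ)
    (hH : Nat.card H = p ^ (v - 1)) (hε : ∀ q, q ∈ Subgroup.zpowers ε) (j : ℕ)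
    (hj : j = (l - 1) * p + j') (hl : 1 ≤ l) (hj1 : 1 ≤ j') (hj' : j' ≤ p) :
    Nonempty (L.gr0 sY (α ≫ β) hπ σ j ≅
      (L.gr0Residual sZ hs α hinv hα hτ l).gr0 sY β hβ ε j') := by
  have hfin : Finite G := Nat.finite_of_card_ne_zero (by
    rw [hG]; exact pow_ne_zero _ (Fact.out : p.Prime).ne_zero)
  have hH' := zpowers_pow_eq (by omega) hG hσ hH
  have h1 : subOne k σ ∣ subOne k ε.out := subOne_dvd_subOne (hσ _)
  have h2 : subOne k ε.out ∣ subOne k σ := subOne_dvd_subOne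
    (mem_zpowers_of_generates_quotient (by omega) hG hσ hH (QuotientGroup.out_eq' ε) hε)
  have hp := subOne_pow_char (k := k) p σ 1
  rw [pow_one] at hp
  have h3 : subOne k σ ^ p ∣ subOne k (τ : G) := by
    rw [hp]
    exact subOne_dvd_subOne (hH'.symm ▸ τ.2)
  have h4 : subOne k (τ : G) ∣ subOne k σ ^ p := by
    rw [hp]
    have h5 : σ ^ p ∈ H := hH' ▸ Subgroup.mem_zpowers (σ ^ p)
    obtain ⟨n, hn⟩ := hτ ⟨σ ^ p, h5⟩
    exact subOne_dvd_subOne ⟨n, congrArg Subtype.val hn⟩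
  -- Used with i = j' and i = j' - 1, this splits the powers j and j - 1 of σ - 1 into a part
  -- matching `ε.out` - 1 and a part matching τ - 1.
  have ej : ∀ i, subOne k σ ^ ((l - 1) * p + i) = subOne k σ ^ i * (subOne k σ ^ p) ^ (l - 1) :=
    fun i => by rw [← pow_mul, ← pow_add]; ring_nf
  refine nonempty_iso_of_range_eq (grEval sY (L.act (α ≫ β) hπ) σ j)
    (iteratedEval L sZ hs sY α hinv hα β hβ hτ l ε j') (grEval_injective _ _ _ _)
    (iteratedEval_injective L sZ hs sY α hinv hα β hβ hτ l ε j') fun U z => ?_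
  refine (grEval_range sY (L.act (α ≫ β) hπ) σ j U z).trans (Iff.trans ?_
    (iteratedEval_range L sZ hs sY α hinv hα β hβ hπ hτ l ε j' hL U z).symm)
  refine forall₂_congr fun t _ => exists_congr fun W => exists_congr fun i => and_congr_right
    fun _ => exists_apply_eq_iff_of_dvd (groupAlgebraEnd sY _ (L.act (α ≫ β) hπ) W) ?_ ?_ ?_ ?_ ?_ _
  · rw [hj, ej]
    exact mul_dvd_mul (pow_dvd_pow_of_dvd h1 _) (pow_dvd_pow_of_dvd h3 _)
  · rw [hj, ej]
    exact mul_dvd_mul (pow_dvd_pow_of_dvd h2 _) (pow_dvd_pow_of_dvd h4 _)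
  · rw [hj, Nat.add_sub_assoc hj1, ej]
    exact mul_dvd_mul (pow_dvd_pow_of_dvd h1 _) (pow_dvd_pow_of_dvd h3 _)
  · rw [hj, Nat.add_sub_assoc hj1, ej]
    exact mul_dvd_mul (pow_dvd_pow_of_dvd h2 _) (pow_dvd_pow_of_dvd h4 _)
  -- From j' ≤ p one gets j ≤ pl, so (τ - 1)^l is a multiple of (σ - 1)^j and imposes nothing new.
  · refine dvd_trans ?_ (pow_dvd_pow_of_dvd h3 l)
    rw [← pow_mul]
    refine pow_dvd_pow _ ?_
    obtain ⟨m, rfl⟩ := Nat.exists_eq_add_of_le' hl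
    rw [hj, Nat.add_sub_cancel, mul_add, mul_one, mul_comm]
    omega

end comparison

/-! ### Semilinear group actions on modules of rank one -/

section semilinear

variable {A B G M : Type*} [CommRing A] [CommRing B] [IsDomain B] [Algebra A B] [Group G] [Finite G]
  [MulSemiringAction G B] [Algebra.IsInvariant A B G] [AddCommGroup M] [Module B M]
  (ψ : G →* AddMonoid.End M) (hψ : ∀ g (b : B) m, ψ g (b • m) = (g • b) • ψ g m)
  (htf : ∀ (b : B) (m : M), b • m = 0 → b = 0 ∨ m = 0)
  (hrk : ∀ m m' : M, m ≠ 0 → ∃ b c : B, c ≠ 0 ∧ b • m = c • m')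

/-- The norm, the product of the conjugates of c, is invariant and a multiple of c. -/
lemma exists_dvd_algebraMap (A : Type*) [CommRing A] [Algebra A B] [Algebra.IsInvariant A B G]
    (c : B) (hc : c ≠ 0) : ∃ (n : A) (d : B), algebraMap A B n = d * c ∧ algebraMap A B n ≠ 0 := by
  have := Fintype.ofFinite G
  obtain ⟨n, hn⟩ := Algebra.IsInvariant.isInvariant (A := A) (G := G) (∏ g : G, g • c) (fun h => by
    rw [Finset.smul_prod']
    simp_rw [smul_smul]
    exact Fintype.prod_equiv (Equiv.mulLeft h) _ _ fun _ => rfl)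
  obtain ⟨d, hd⟩ := Finset.dvd_prod_of_mem (fun g : G => g • c) (Finset.mem_univ 1)
  refine ⟨n, d, by rw [hn, hd, one_smul, mul_comm], ?_⟩
  rw [hn]
  exact Finset.prod_ne_zero_iff.2 fun g _ => (smul_ne_zero_iff_ne g).2 hc

include hψ htf hrk in
/-- The invariants of a semilinear action on a module of rank one have rank at most one. -/
lemma exists_smul_eq_smul_of_invariant [SMulCommClass G A B] {m₁ m₂ : M} (h0 : m₁ ≠ 0) (h₁ : ∀ g, ψ g m₁ = m₁)
    (h₂ : ∀ g, ψ g m₂ = m₂) : ∃ a c : A, algebraMap A B c ≠ 0 ∧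
      algebraMap A B a • m₁ = algebraMap A B c • m₂ := by
  obtain ⟨b, c, hc, hbc⟩ := hrk m₁ m₂ h0
  obtain ⟨n, d, hn, hn0⟩ := exists_dvd_algebraMap (G := G) A c hc
  have h3 : (d * b) • m₁ = algebraMap A B n • m₂ := by rw [mul_smul, hbc, hn, mul_smul]
  obtain ⟨a, ha⟩ := Algebra.IsInvariant.isInvariant (A := A) (G := G) (d * b) (fun g => by
    have hg := congrArg (ψ g) h3
    rw [hψ, hψ, h₁, h₂, smul_algebraMap, ← h3] at hg
    rcases htf (g • (d * b) - d * b) m₁ (by rw [sub_smul, hg, sub_self]) with h | h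
    · exact sub_eq_zero.1 h
    · exact (h0 h).elim)
  exact ⟨a, n, hn0, by rw [ha, h3]⟩

omit [Finite G] in
include hψ htf hrk in
/-- The trace of a semilinear action on a module of rank one is nonzero. -/
lemma exists_sum_ne_zero [Fintype G] [Nontrivial M]
    (hfaith : ∀ g : G, (∀ b : B, g • b = b) → g = 1) : ∃ w, ∑ g, ψ g w ≠ 0 := by
  by_contra! hcon
  obtain ⟨w, hw⟩ := exists_ne (0 : M)
  have hinj : ∀ g, Function.Injective (ψ g) := fun g => by
    refine Function.LeftInverse.injective (g := ψ g⁻¹) fun m => ?_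
    have : (ψ g⁻¹ * ψ g) m = m := by rw [← map_mul, inv_mul_cancel, map_one]; rfl
    exact this
  have hw' : ∀ g, ψ g w ≠ 0 := fun g h => hw (hinj g (by rw [h, map_zero]))
  choose d c hc hdc using fun g => hrk w (ψ g w) hw
  classical
  -- Rank one gives c_g ψ_g(w) = d_g w. With a common denominator, ψ_g becomes multiplication by e_g
  -- on w, so the vanishing of the trace on every b w says that the automorphisms of B satisfy a
  -- linear relation with coefficients e_g.
  let e : G → B := fun g => (∏ h ∈ Finset.univ.erase g, c h) * d g
  have he : ∀ g, e g • w = (∏ h, c h) • ψ g w := fun g => by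
    rw [mul_smul, hdc, smul_smul, Finset.prod_erase_mul _ _ (Finset.mem_univ g)]
  have hc' : ∏ h, c h ≠ 0 := Finset.prod_ne_zero_iff.2 fun g _ => hc g
  have he0 : e 1 ≠ 0 := fun h => by
    have := he 1
    rw [h, zero_smul] at this
    rcases htf _ _ this.symm with h | h
    exacts [hc' h, hw' 1 h]
  have hsum : ∀ b : B, ∑ g : G, e g * g • b = 0 := fun b => by
    have h1 := congrArg ((∏ h, c h) • ·) (hcon (b • w))
    rw [smul_zero, Finset.smul_sum] at h1
    have h2 : (∑ g : G, e g * g • b) • w = 0 := by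
      rw [Finset.sum_smul, ← h1]
      refine Finset.sum_congr rfl fun g _ => ?_
      rw [hψ, smul_comm, ← he, smul_smul, mul_comm]
    exact (htf _ _ h2).resolve_right hw
  let χ : G → B →* B := fun g => (MulSemiringAction.toRingHom G B g : B →* B)
  -- Faithfulness makes the automorphisms distinct characters of B, so Dedekind independence
  -- contradicts e_1 ≠ 0.
  have hχ : Function.Injective χ := fun g h hgh => by
    have : h⁻¹ * g = 1 := hfaith _ fun b => by
      have hb : g • b = h • b := congrArg (fun t : B →* B => t b) hgh
      rw [mul_smul, hb, inv_smul_smul]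
    exact (inv_mul_eq_one.1 this).symm
  have hli := (linearIndependent_monoidHom B B).comp χ hχ
  rw [Fintype.linearIndependent_iff] at hli
  refine he0 (hli e ?_ 1)
  ext b
  rw [Finset.sum_apply, Pi.zero_apply, ← hsum b]
  rfl

end semilinear

/-- A finite torsion-free module of rank one over a ring whose localization at `P` is a valuation
ring is generated by one element in a neighbourhood of `P`. -/
lemma exists_locally_generator {A N : Type*} [CommRing A] [AddCommGroup N] [Module A N]
    [Module.Finite A N] [Nontrivial N] (P : Ideal A) [hP : P.IsPrime]
    (hval : ∀ a b : A, ∃ s ∉ P, ∃ c, s * a = c * b ∨ s * b = c * a)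
    (htf : ∀ (a : A) (x : N), a • x = 0 → a = 0 ∨ x = 0)
    (hrk : ∀ x y : N, x ≠ 0 → ∃ a c : A, c ≠ 0 ∧ a • x = c • y) :
    ∃ t : N, t ≠ 0 ∧ ∃ f ∉ P, ∀ x : N, ∃ c : A, f • x = c • t := by
  have h1 : (1 : A) ∉ P := fun h => hP.ne_top ((Ideal.eq_top_iff_one _).2 h)
  -- Near P any two elements are comparable for divisibility: proportionality a x = c y moves the
  -- comparison of a and c to x and y, and torsion-freeness cancels the extra factor.
  have htot : ∀ x y : N, ∃ s ∉ P, ∃ c : A, s • x = c • y ∨ s • y = c • x := by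
    intro x y
    by_cases hx : x = 0
    · exact ⟨1, h1, 0, Or.inl (by rw [hx, smul_zero, zero_smul])⟩
    by_cases hy : y = 0
    · exact ⟨1, h1, 0, Or.inr (by rw [hy, smul_zero, zero_smul])⟩
    obtain ⟨a, c, hc, hac⟩ := hrk x y hx
    have ha : a ≠ 0 := by
      rintro rfl
      rw [zero_smul] at hac
      rcases htf _ _ hac.symm with h | h
      exacts [hc h, hy h]
    obtain ⟨s, hs, d, hd | hd⟩ := hval a c
    · refine ⟨s, hs, d, Or.inr (sub_eq_zero.1 ((htf c _ ?_).resolve_left hc))⟩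
      rw [smul_sub, smul_comm c s, ← hac, smul_smul, hd, mul_smul, smul_comm, sub_self]
    · refine ⟨s, hs, d, Or.inl (sub_eq_zero.1 ((htf a _ ?_).resolve_left ha))⟩
      rw [smul_sub, smul_comm a s, hac, smul_smul, hd, mul_smul, smul_comm, sub_self]
  -- Each new element either is a multiple of the current generator, up to a factor outside P, or
  -- replaces it.
  have key : ∀ F : Finset N, ∃ t : N, ∃ f ∉ P, ∀ x ∈ F, ∃ c : A, f • x = c • t := by
    classical
    intro F
    induction F using Finset.induction_on with
    | empty => exact ⟨0, 1, h1, by simp⟩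
    | insert x F _ ih =>
      obtain ⟨t, f, hf, h⟩ := ih
      obtain ⟨s, hs, c, hc | hc⟩ := htot x t
      · refine ⟨t, f * s, fun h => (hP.mem_or_mem h).elim hf hs, fun y hy => ?_⟩
        rcases Finset.mem_insert.1 hy with rfl | hy
        · exact ⟨f * c, by rw [mul_smul, hc, mul_smul]⟩
        · obtain ⟨d, hd⟩ := h y hy
          exact ⟨s * d, by rw [mul_comm, mul_smul, hd, mul_smul]⟩
      · refine ⟨x, f * s, fun h => (hP.mem_or_mem h).elim hf hs, fun y hy => ?_⟩
        rcases Finset.mem_insert.1 hy with rfl | hy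
        · exact ⟨f * s, rfl⟩
        · obtain ⟨d, hd⟩ := h y hy
          exact ⟨d * c, by rw [mul_comm, mul_smul, hd, smul_comm, hc, mul_smul]⟩
  obtain ⟨F, hF⟩ := Module.Finite.fg_top (R := A) (M := N)
  obtain ⟨t, f, hf, h⟩ := key F
  have hall : ∀ x : N, ∃ c : A, f • x = c • t := by
    intro x
    have hx : x ∈ Submodule.span A (F : Set N) := by rw [hF]; trivial
    induction hx using Submodule.span_induction with
    | mem x hx => exact h x hx
    | zero => exact ⟨0, by rw [smul_zero, zero_smul]⟩
    | add x y _ _ hx hy =>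
      obtain ⟨c, hc⟩ := hx
      obtain ⟨d, hd⟩ := hy
      exact ⟨c + d, by rw [smul_add, hc, hd, add_smul]⟩
    | smul a x _ hx =>
      obtain ⟨c, hc⟩ := hx
      exact ⟨a * c, by rw [smul_comm, hc, mul_smul]⟩
  refine ⟨t, ?_, f, hf, hall⟩
  rintro rfl
  obtain ⟨x, hx⟩ := exists_ne (0 : N)
  obtain ⟨c, hc⟩ := hall x
  rw [smul_zero] at hc
  rcases htf _ _ hc with h | h
  · exact hf (h ▸ P.zero_mem)
  · exact hx h

/-! ### Rings of invariants of Dedekind domains -/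

section dedekind

variable {A B : Type*} [CommRing A] [CommRing B] [IsDomain B] [Algebra A B]
  (hinj : Function.Injective (algebraMap A B))

include hinj

/-- A fraction a/b integral over A is integral over B, hence equals some c in B. From a = bc with a
and b invariant and b nonzero, c is invariant, so it comes from A. -/
lemma isIntegrallyClosed_of_isInvariant {G : Type*} [Group G] [MulSemiringAction G B]
    [SMulCommClass G A B] [Algebra.IsInvariant A B G] [IsDomain A] [IsIntegrallyClosed B] :
    IsIntegrallyClosed A := by
  rw [isIntegrallyClosed_iff (FractionRing A)]
  intro x hx
  obtain ⟨a, b, hb, rfl⟩ := IsFractionRing.div_surjective (A := A) x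
  have hb0 : b ≠ 0 := nonZeroDivisors.ne_zero hb
  have hb' : algebraMap A B b ≠ 0 := by rwa [Ne, map_eq_zero_iff _ hinj]
  have hg : Function.Injective (algebraMap A (FractionRing B)) := by
    rw [IsScalarTower.algebraMap_eq A B]
    exact (IsFractionRing.injective B (FractionRing B)).comp hinj
  let φ : FractionRing A →ₐ[A] FractionRing B :=
    { (IsFractionRing.lift hg : FractionRing A →+* FractionRing B) with
      commutes' := fun r => IsFractionRing.lift_algebraMap hg r }
  have h1 : IsIntegral B (φ (algebraMap A _ a / algebraMap A _ b)) := (hx.map φ).tower_top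
  obtain ⟨c, hc⟩ := IsIntegrallyClosed.isIntegral_iff.1 h1
  have h2 : algebraMap A B a = algebraMap A B b * c := by
    apply IsFractionRing.injective B (FractionRing B)
    rw [map_mul, hc, map_div₀, AlgHom.commutes, AlgHom.commutes,
      ← IsScalarTower.algebraMap_apply, ← IsScalarTower.algebraMap_apply, mul_div_cancel₀]
    rwa [Ne, map_eq_zero_iff _ hg]
  obtain ⟨d, hd⟩ := Algebra.IsInvariant.isInvariant (A := A) (G := G) c (fun g => by
    have h3 := congrArg (g • ·) h2
    simp only [smul_mul', smul_algebraMap] at h3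
    exact mul_left_cancel₀ hb' (h3.symm.trans h2))
  refine ⟨d, ?_⟩
  have h4 : a = b * d := hinj (by rw [h2, map_mul, hd])
  rw [h4, map_mul, mul_div_cancel_left₀]
  rwa [Ne, map_eq_zero_iff _ (IsFractionRing.injective A (FractionRing A))]

omit [IsDomain B] in
-- A nonzero prime of A lies under a prime of B, which is nonzero, hence maximal, and maximality
-- passes down integral extensions.
lemma dimensionLEOne_of_isIntegral [Algebra.IsIntegral A B] [Ring.DimensionLEOne B] :
    Ring.DimensionLEOne A where
  maximalOfPrime := by
    intro P hP0 hP
    obtain ⟨Q, -, hQ, rfl⟩ := Ideal.exists_ideal_over_prime_of_isIntegral (S := B) P ⊥ (by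
      rw [← RingHom.ker_eq_comap_bot, (RingHom.injective_iff_ker_eq_bot _).1 hinj]
      exact bot_le)
    have hQ0 : Q ≠ ⊥ := by
      rintro rfl
      rw [← RingHom.ker_eq_comap_bot, (RingHom.injective_iff_ker_eq_bot _).1 hinj] at hP0
      exact hP0 rfl
    have := hQ.isMaximal hQ0
    exact Ideal.isMaximal_comap_of_isIntegral_of_isMaximal Q

omit [IsDomain B] in
-- Artin–Tate: A is itself of finite type over k.
lemma isNoetherianRing_of_finite (k : Type*) [Field k] [Algebra k A] [Algebra k B]
    [IsScalarTower k A B] [Algebra.FiniteType k B] [Module.Finite A B] : IsNoetherianRing A := by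
  have h : (⊤ : Subalgebra k A).FG := fg_of_fg_of_fg k A B Algebra.FiniteType.out
    Module.Finite.fg_top hinj
  have : Algebra.FiniteType k A := ⟨h⟩
  exact Algebra.FiniteType.isNoetherianRing k A

end dedekind

/-- The localization at a nonzero prime is a discrete valuation ring, where divisibility is total,
and denominators are cleared. At the zero prime, b itself can serve as s when b ≠ 0. -/
lemma exists_dvd_away_from_prime {A : Type*} [CommRing A] [IsDedekindDomain A] (P : Ideal A)
    [hP : P.IsPrime] (a b : A) : ∃ s ∉ P, ∃ c, s * a = c * b ∨ s * b = c * a := by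
  have h1 : (1 : A) ∉ P := fun h => hP.ne_top ((Ideal.eq_top_iff_one _).2 h)
  by_cases hbot : P = ⊥
  · by_cases hb : b = 0
    · exact ⟨1, h1, 0, Or.inr (by rw [hb, mul_zero, zero_mul])⟩
    · exact ⟨b, fun h => hb (by rwa [hbot, Ideal.mem_bot] at h), a, Or.inl (mul_comm _ _)⟩
  have := IsLocalization.AtPrime.isDiscreteValuationRing_of_dedekind_domain A hbot
    (Localization.AtPrime P)
  have key : ∀ a b : A, algebraMap A (Localization.AtPrime P) a ∣ algebraMap A _ b →
      ∃ s ∉ P, ∃ c, s * b = c * a := by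
    rintro a b ⟨x, hx⟩
    obtain ⟨⟨c, s⟩, hcs⟩ := IsLocalization.surj P.primeCompl x
    dsimp only at hcs
    refine ⟨s, s.2, c, ?_⟩
    apply IsLocalization.injective (Localization.AtPrime P) P.primeCompl_le_nonZeroDivisors
    rw [map_mul, map_mul, hx, ← hcs]
    ring
  rcases ValuationRing.dvd_total (algebraMap A (Localization.AtPrime P) a)
    (algebraMap A _ b) with h | h
  · obtain ⟨s, hs, c, h⟩ := key a b h
    exact ⟨s, hs, c, Or.inr h⟩
  · obtain ⟨s, hs, c, h⟩ := key b a h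
    exact ⟨s, hs, c, Or.inl h⟩

/-! ### The module (σ - 1)^(j-1) ker (σ - 1)^j -/

section jordanSubmodule

-- Since x - 1 may be a zero divisor in R, the identity is proved over 𝔽_p[X], where X - 1 can be
-- cancelled, and then specialized.
open Polynomial in
lemma sub_one_pow_card_sub_one {R : Type*} [CommRing R] (p : ℕ) [Fact p.Prime] [CharP R p]
    (x : R) (n : ℕ) : (x - 1) ^ (p ^ n - 1) = ∑ i ∈ Finset.range (p ^ n), x ^ i := by
  have h : ((X : (ZMod p)[X]) - 1) ^ (p ^ n - 1) = ∑ i ∈ Finset.range (p ^ n), X ^ i := by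
    have hX : (X : (ZMod p)[X]) - 1 ≠ 0 := by
      simpa using Polynomial.X_sub_C_ne_zero (1 : ZMod p)
    refine mul_left_cancel₀ hX ?_
    rw [mul_geom_sum, ← pow_succ', Nat.sub_add_cancel (Nat.pos_of_ne_zero
      (pow_ne_zero _ (Fact.out : p.Prime).ne_zero)), sub_pow_char_pow, one_pow]
  let := ZMod.algebra R p
  have := congrArg (aeval x) h
  simpa using this

lemma subOne_pow_card_sub_one {k G : Type u} [Field k] [CommGroup G] [Fintype G] (p : ℕ)
    [Fact p.Prime] [CharP k p] {v : ℕ} (hG : Nat.card G = p ^ v) {σ : G}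
    (hσ : ∀ g, g ∈ Subgroup.zpowers σ) :
    subOne k σ ^ (p ^ v - 1) = ∑ g : G, MonoidAlgebra.single g (1 : k) := by
  classical
  have : CharP (MonoidAlgebra k G) p :=
    charP_of_injective_algebraMap (algebraMap k (MonoidAlgebra k G)).injective p
  have h1 := IsCyclic.image_range_card hσ
  rw [subOne, sub_one_pow_card_sub_one p, ← h1, Finset.sum_image, ← hG]
  · exact Finset.sum_congr rfl fun i _ => (single_pow_one σ i).symm
  · rw [← orderOf_eq_card_of_forall_mem_zpowers hσ]
    exact fun i hi i' hi' h => pow_injOn_Iio_orderOf (by simpa using hi) (by simpa using hi') h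

variable {k G : Type u} {A B M : Type*} [Field k] [CommRing A] [CommRing B] [IsDomain B] [Algebra A B]
  [CommGroup G] [MulSemiringAction G B] [SMulCommClass G A B]
  [Algebra.IsInvariant A B G] [AddCommGroup M] [Module A M] [Module B M] [IsScalarTower A B M]
  (E : MonoidAlgebra k G →+* AddMonoid.End M) (hE : ∀ r (a : A) m, E r (a • m) = a • E r m)

/-- The image of `r₂` on the kernel of `r₁`. -/
def kernelImage (r₁ r₂ : MonoidAlgebra k G) : Submodule A M where
  carrier := {z | ∃ w, E r₁ w = 0 ∧ E r₂ w = z}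
  zero_mem' := ⟨0, map_zero _, map_zero _⟩
  add_mem' := by
    rintro z z' ⟨w, h, rfl⟩ ⟨w', h', rfl⟩
    exact ⟨w + w', by rw [map_add, h, h', add_zero], map_add _ _ _⟩
  smul_mem' := by
    rintro a z ⟨w, h, rfl⟩
    exact ⟨a • w, by rw [hE, h, smul_zero], hE _ _ _⟩

lemma mem_kernelImage (r₁ r₂ : MonoidAlgebra k G) (z : M) :
    z ∈ kernelImage E hE r₁ r₂ ↔ ∃ w, E r₁ w = 0 ∧ E r₂ w = z := Iff.rfl

variable (hψ : ∀ g (b : B) m, E (MonoidAlgebra.single g 1) (b • m) =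
    (g • b) • E (MonoidAlgebra.single g 1) m)
  (htf : ∀ (b : B) (m : M), b • m = 0 → b = 0 ∨ m = 0)
  (hrk : ∀ m m' : M, m ≠ 0 → ∃ b c : B, c ≠ 0 ∧ b • m = c • m')

-- The submodule is finite over the Noetherian ring A, torsion-free, nonzero and of rank one over A,
-- so `exists_locally_generator` applies to it.
include hψ htf hrk in
lemma exists_generator_kernelImage [Finite G] [Nontrivial M] [IsDedekindDomain A]
    [Module.Finite A M] (hinj : Function.Injective (algebraMap A B))
    (hfaith : ∀ g : G, (∀ b : B, g • b = b) → g = 1) (p : ℕ) [Fact p.Prime] [CharP k p] (v : ℕ)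
    (hG : Nat.card G = p ^ v) (σ : G) (hσ : ∀ g, g ∈ Subgroup.zpowers σ) (j : ℕ) (hj1 : 1 ≤ j)
    (hj : j ≤ p ^ v) (P : Ideal A) [hP : P.IsPrime] :
    ∃ t ∈ kernelImage E hE (subOne k σ ^ j) (subOne k σ ^ (j - 1)), t ≠ 0 ∧ ∃ f ∉ P,
      ∀ z ∈ kernelImage E hE (subOne k σ ^ j) (subOne k σ ^ (j - 1)), ∃ c : A, f • z = c • t := by
  let I := kernelImage E hE (subOne k σ ^ j) (subOne k σ ^ (j - 1))
  let ψ : G →* AddMonoid.End M := (E : MonoidAlgebra k G →* _).comp (MonoidAlgebra.of k G)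
  have hψ' : ∀ g (b : B) m, ψ g (b • m) = (g • b) • ψ g m := hψ
  have := Fintype.ofFinite G
  have htf' : ∀ (a : A) (m : M), a • m = 0 → a = 0 ∨ m = 0 := fun a m h => by
    rw [← algebraMap_smul B a m] at h
    exact (htf _ _ h).imp_left fun h => hinj (h.trans (map_zero _).symm)
  -- Since g - 1 is a multiple of σ - 1, it sends (σ - 1)^(j-1) w to a multiple of (σ - 1)^j w = 0.
  have hinvt : ∀ z ∈ I, ∀ g, ψ g z = z := by
    rintro z ⟨w, hw, rfl⟩ g
    obtain ⟨c, hc⟩ := dvd_single_sub_one k hσ g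
    have h1 : MonoidAlgebra.single g (1 : k) * subOne k σ ^ (j - 1) =
        c * subOne k σ ^ j + subOne k σ ^ (j - 1) := by
      rw [← Nat.sub_add_cancel hj1, Nat.add_sub_cancel, pow_succ, ← sub_add_cancel
        (MonoidAlgebra.single g (1 : k)) 1, hc, subOne]
      ring
    have h2 := congrArg (fun t => E t w) h1
    rw [map_mul, map_add, map_mul] at h2
    refine Eq.trans h2 ?_
    change E c (E (subOne k σ ^ j) w) + E (subOne k σ ^ (j - 1)) w = _
    rw [hw, map_zero, zero_add]
  -- The trace is (σ - 1)^(p^v - 1), which splits as (σ - 1)^(j-1) (σ - 1)^(p^v - j). The second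
  -- factor maps into the kernel of (σ - 1)^j because (σ - 1)^(p^v) = 0.
  have hne : Nontrivial I := by
    obtain ⟨w, hw⟩ := exists_sum_ne_zero ψ hψ' htf hrk hfaith
    have htr : E (subOne k σ ^ (p ^ v - 1)) w = ∑ g, ψ g w := by
      rw [subOne_pow_card_sub_one p hG hσ, map_sum]
      exact AddMonoidHom.finsetSum_apply (M := M) (N := M) _ _ _
    refine ⟨⟨⟨∑ g, ψ g w, ?_⟩, 0, fun h => hw (congrArg Subtype.val h)⟩⟩
    refine (mem_kernelImage E hE _ _ _).2 ⟨E (subOne k σ ^ (p ^ v - j)) w, ?_, ?_⟩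
    · change (E (subOne k σ ^ j) * E (subOne k σ ^ (p ^ v - j))) w = 0
      rw [← map_mul, ← pow_add, Nat.add_sub_cancel' hj, subOne_pow_char, ← hG, pow_card_eq_one']
      simp only [subOne]
      rw [← MonoidAlgebra.one_def, sub_self, map_zero]
      rfl
    · change (E (subOne k σ ^ (j - 1)) * E (subOne k σ ^ (p ^ v - j))) w = _
      rw [← map_mul, ← pow_add, ← htr]
      congr 3
      omega
  obtain ⟨t, ht, f, hf, h⟩ := exists_locally_generator (N := I) P
    (exists_dvd_away_from_prime P)
    (fun a x h => (htf' a x (congrArg Subtype.val h)).imp_right Subtype.ext)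
    (fun x y hx => by
      obtain ⟨a, c, hc, hac⟩ := exists_smul_eq_smul_of_invariant (A := A) ψ hψ' htf hrk
        (m₁ := x) (m₂ := y) (fun h => hx (Subtype.ext h)) (hinvt _ x.2) (hinvt _ y.2)
      refine ⟨a, c, fun h => hc (by rw [h, map_zero]), Subtype.ext ?_⟩
      rwa [algebraMap_smul, algebraMap_smul] at hac)
  refine ⟨t, t.2, fun h => ht (Subtype.ext h), f, hf, fun z hz => ?_⟩
  obtain ⟨c, hc⟩ := h ⟨z, hz⟩
  exact ⟨c, congrArg Subtype.val hc⟩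

end jordanSubmodule

/-! ### Affine coordinate rings of the curve -/

section curve

variable {k : Type u} [Field k] {X : Scheme.{u}} {sX : X ⟶ Spec (CommRingCat.of k)}

lemma finiteType_scalar [LocallyOfFiniteType sX] {V : X.Opens} (hV : IsAffineOpen V) :
    (scalar sX V).FiniteType := by
  refine RingHom.FiniteType.comp (f := (Scheme.ΓSpecIso (CommRingCat.of k)).inv.hom)
    (sX.finiteType_appLE (isAffineOpen_top _) hV le_top) (RingHom.FiniteType.of_surjective _ ?_)
  exact (Scheme.ΓSpecIso (CommRingCat.of k)).symm.commRingCatIsoToRingEquiv.surjective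

lemma ringKrullDim_section_le {V : X.Opens} (hV : IsAffineOpen V) :
    ringKrullDim Γ(X, V) ≤ topologicalKrullDim X := by
  rw [← PrimeSpectrum.topologicalKrullDim_eq_ringKrullDim]
  exact hV.fromSpec.isOpenEmbedding.isInducing.topologicalKrullDim_le

lemma isRegularLocalRing_localization (h : ∀ x : X, IsRegularLocalRing (X.presheaf.stalk x))
    {V : X.Opens} (hV : IsAffineOpen V) (P : Ideal Γ(X, V)) [hP : P.IsPrime] :
    IsRegularLocalRing (Localization.AtPrime P) := by
  let y : PrimeSpectrum Γ(X, V) := ⟨P, hP⟩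
  have hy : hV.fromSpec y ∈ V := by
    rw [← SetLike.mem_coe, ← hV.range_fromSpec]
    exact ⟨y, rfl⟩
  let := TopCat.Presheaf.algebra_section_stalk X.presheaf (⟨hV.fromSpec y, hy⟩ : V)
  have : IsLocalization.AtPrime (X.presheaf.stalk (hV.fromSpec y)) P :=
    hV.isLocalization_stalk' y hy
  have := h (hV.fromSpec y)
  exact IsRegularLocalRing.of_ringEquiv (IsLocalization.algEquiv P.primeCompl
    (X.presheaf.stalk (hV.fromSpec y)) (Localization.AtPrime P)).toRingEquiv

/-- Regularity equates the dimension of the cotangent space with the Krull dimension, so it is at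
most one, and it is nonzero as R is not a field. -/
lemma isDiscreteValuationRing_of_isRegularLocalRing (R : Type*) [CommRing R] [IsDomain R]
    [IsRegularLocalRing R] (hR : ringKrullDim R ≤ 1) (h : ¬ IsField R) :
    IsDiscreteValuationRing R := by
  have h1 := (IsRegularLocalRing.iff_finrank_cotangentSpace (R := R)).1 inferInstance
  rw [← h1] at hR
  have h2 : Module.finrank (IsLocalRing.ResidueField R) (IsLocalRing.CotangentSpace R) ≤ 1 := by
    exact_mod_cast hR
  exact ((IsDiscreteValuationRing.TFAE R h).out 0 5).2
    (le_antisymm h2 (Nat.one_le_iff_ne_zero.2 fun h3 =>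
      h (IsLocalRing.finrank_cotangentSpace_eq_zero_iff.1 h3)))

lemma IsProjectiveCurve.isDedekindDomain (hX : IsProjectiveCurve sX) {V : X.Opens}
    (hV : IsAffineOpen V) [hne : Nonempty V] : IsDedekindDomain Γ(X, V) := by
  have := hX.integral
  have := hX.proper
  let := (scalar sX V).toAlgebra
  have : Algebra.FiniteType k Γ(X, V) := finiteType_scalar hV
  have : IsNoetherianRing Γ(X, V) := Algebra.FiniteType.isNoetherianRing k _
  have : IsDedekindDomainDvr Γ(X, V) :=
    { is_dvr_at_nonzero_prime := fun P hP0 hP => by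
        have := isRegularLocalRing_localization hX.regular hV P
        refine isDiscreteValuationRing_of_isRegularLocalRing _ ?_
          (IsLocalization.AtPrime.not_isField _ hP0 _)
        rw [IsLocalization.AtPrime.ringKrullDim_eq_height P]
        refine (Ideal.height_le_ringKrullDim_of_ne_top hP.ne_top).trans ?_
        exact (ringKrullDim_section_le hV).trans hX.dim_one.le }
  infer_instance

end curve

/-! ### Faithfulness on functions -/

section faithful

variable {k : Type u} [Field k] {X : Scheme.{u}} {sX : X ⟶ Spec (CommRingCat.of k)}

/-- An endomorphism over `k` that is the identity on the functions of a nonempty affine open set is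
the identity. -/
lemma eq_id_of_appLE_eq_id [IsIntegral X] [IsSeparated sX] (φ : X ⟶ X) (hφ : φ ≫ sX = sX)
    {V : X.Opens} (hV : IsAffineOpen V) [hne : Nonempty V] (e : V ≤ φ ⁻¹ᵁ V)
    (h : ∀ b, φ.appLE V V e b = b) : φ = 𝟙 X := by
  have h1 : φ.appLE V V e = 𝟙 _ := by ext b; exact h b
  have h2 := IsAffineOpen.SpecMap_appLE_fromSpec φ hV hV e
  rw [h1, Spec.map_id, Category.id_comp] at h2
  have : IsDominant hV.fromSpec := ⟨by
    obtain ⟨⟨x, hx⟩⟩ := hne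
    rw [DenseRange, hV.range_fromSpec]
    exact V.2.dense ⟨x, hx⟩⟩
  exact ext_of_isDominant_of_isSeparated sX (by rw [hφ, Category.id_comp]) hV.fromSpec
    (by rw [← h2, Category.comp_id])

end faithful

/-! ### The quotient over an affine open set -/

section affine

open Scheme.Modules

variable {k : Type u} [Field k] {G : Type u} [CommGroup G] {X Y : Scheme.{u}} {ρ : G →* Aut X}
  (π : X ⟶ Y)

lemma appLE_actHom_mul (hπ : ∀ g, actHom ρ g ≫ π = π) (U : Y.Opens) (h g : G)
    (b : Γ(X, π ⁻¹ᵁ U)) :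
    (actHom ρ (h * g)).appLE _ _ (GSheaf.preimage_invariant π hπ (h * g) U).ge b =
      (actHom ρ g).appLE _ _ (GSheaf.preimage_invariant π hπ g U).ge
        ((actHom ρ h).appLE _ _ (GSheaf.preimage_invariant π hπ h U).ge b) := by
  have h1 := Scheme.Hom.appLE_comp_appLE (actHom ρ g) (actHom ρ h) (π ⁻¹ᵁ U) (π ⁻¹ᵁ U) (π ⁻¹ᵁ U)
    (GSheaf.preimage_invariant π hπ h U).ge (GSheaf.preimage_invariant π hπ g U).ge
  rw [appLE_of_eq (actHom_mul ρ h g) _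
    (by rw [← actHom_mul]; exact (GSheaf.preimage_invariant π hπ (h * g) U).ge), ← h1]
  rfl

lemma appLE_actHom_one (U : X.Opens) (e : U ≤ actHom ρ 1 ⁻¹ᵁ U) (b : Γ(X, U)) :
    (actHom ρ 1).appLE U U e b = b := by
  rw [appLE_of_eq (actHom_one ρ) e le_rfl]
  exact ConcreteCategory.congr_hom ((Scheme.Hom.appLE_eq_app (f := 𝟙 X) (U := U)).trans
    (Scheme.Hom.id_app U)) b

/-- The action of `G` on the functions of an invariant open set, by `g b = b ∘ g⁻¹`. -/
abbrev sectionAction (hπ : ∀ g, actHom ρ g ≫ π = π) (U : Y.Opens) :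
    MulSemiringAction G Γ(X, π ⁻¹ᵁ U) where
  smul g b := (actHom ρ g⁻¹).appLE _ _ (GSheaf.preimage_invariant π hπ g⁻¹ U).ge b
  one_smul b := by
    change (actHom ρ (1 : G)⁻¹).appLE _ _ _ b = b
    have h1 : actHom ρ (1 : G)⁻¹ = actHom ρ 1 := by rw [inv_one]
    rw [appLE_of_eq h1 _ (GSheaf.preimage_invariant π hπ 1 U).ge, appLE_actHom_one]
  mul_smul h g b := by
    change (actHom ρ (h * g)⁻¹).appLE _ _ _ b =
      (actHom ρ h⁻¹).appLE _ _ _ ((actHom ρ g⁻¹).appLE _ _ _ b)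
    have h1 : actHom ρ (h * g)⁻¹ = actHom ρ (g⁻¹ * h⁻¹) := by rw [mul_inv_rev]
    rw [appLE_of_eq h1 _ (GSheaf.preimage_invariant π hπ _ U).ge,
      appLE_actHom_mul π hπ]
  smul_zero g := map_zero _
  smul_add g := map_add _
  smul_one g := map_one _
  smul_mul g := map_mul _

lemma appLE_actHom_app (hπ : ∀ g, actHom ρ g ≫ π = π) (U : Y.Opens) (g : G) (r : Γ(Y, U)) :
    (actHom ρ g).appLE (π ⁻¹ᵁ U) (π ⁻¹ᵁ U) (GSheaf.preimage_invariant π hπ g U).ge (π.app U r) =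
      π.app U r := by
  have h1 := (Scheme.Hom.comp_appLE (actHom ρ g) π U (π ⁻¹ᵁ U) (by rw [hπ])).symm.trans
    (appLE_of_eq (hπ g) _ le_rfl)
  rw [Scheme.Hom.appLE_eq_app] at h1
  exact ConcreteCategory.congr_hom h1 r

lemma scalar_app {sX : X ⟶ Spec (CommRingCat.of k)} {sY : Y ⟶ Spec (CommRingCat.of k)}
    (h : π ≫ sY = sX) (U : Y.Opens) (c : k) :
    π.app U (scalar sY U c) = scalar sX (π ⁻¹ᵁ U) c := by
  subst h
  have h1 : sY.appLE ⊤ U le_top ≫ π.app U = (π ≫ sY).appLE ⊤ (π ⁻¹ᵁ U) le_top := by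
    rw [Scheme.Hom.app_eq_appLE]
    exact Scheme.Hom.appLE_comp_appLE π sY ⊤ U (π ⁻¹ᵁ U) _ _
  exact ConcreteCategory.congr_hom h1 ((Scheme.ΓSpecIso (CommRingCat.of k)).inv c)

/-- An empty preimage would force 1 = 0 on U, since functions on U inject into functions on the
preimage. -/
lemma IsQuotient.nonempty_preimage (hπ : IsQuotient ρ π) (U : Y.Opens) [Nonempty U] :
    Nonempty (π ⁻¹ᵁ U) := by
  by_contra h
  have h1 : π ⁻¹ᵁ U = ⊥ := by
    rw [← Opens.not_nonempty_iff_eq_bot]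
    exact fun ⟨x, hx⟩ => h ⟨⟨x, hx⟩⟩
  have : Subsingleton Γ(X, π ⁻¹ᵁ U) := by rw [h1]; infer_instance
  exact one_ne_zero (hπ.injective U (Subsingleton.elim (π.app U 1) (π.app U 0)))

/-- The geometric form of `exists_generator_kernelImage`, with A the functions on U, B those on
π⁻¹U, and the sections of L over π⁻¹U as module. -/
lemma IsQuotient.exists_generator {sX : X ⟶ Spec (CommRingCat.of k)}
    {sY : Y ⟶ Spec (CommRingCat.of k)} (hX : IsProjectiveCurve sX) (hρ : Function.Injective ρ)
    (hρX : ∀ g, actHom ρ g ≫ sX = sX) (hπ : IsQuotient ρ π) (hsY : π ≫ sY = sX) (L : GSheaf ρ)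
    (hL : IsInvertible L.sheaf) (p : ℕ) [Fact p.Prime] [CharP k p] (v : ℕ)
    (hG : Nat.card G = p ^ v) (σ : G) (hσ : ∀ g, g ∈ Subgroup.zpowers σ) (j : ℕ) (hj1 : 1 ≤ j)
    (hj : j ≤ p ^ v) {U : Y.Opens} (hU : IsAffineOpen U) (y : Y) (hy : y ∈ U) :
    ∃ w : Γ((pushforward π).obj L.sheaf, U),
      groupAlgebraEnd sY _ (L.act π hπ.invariant) U (subOne k σ ^ j) w = 0 ∧
      groupAlgebraEnd sY _ (L.act π hπ.invariant) U (subOne k σ ^ (j - 1)) w ≠ 0 ∧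
      ∃ f : Γ(Y, U), y ∈ Y.basicOpen f ∧ ∀ z : Γ((pushforward π).obj L.sheaf, U),
        groupAlgebraEnd sY _ (L.act π hπ.invariant) U (subOne k σ ^ j) z = 0 →
        ∃ c : Γ(Y, U), f • groupAlgebraEnd sY _ (L.act π hπ.invariant) U (subOne k σ ^ (j - 1)) z =
          c • groupAlgebraEnd sY _ (L.act π hπ.invariant) U (subOne k σ ^ (j - 1)) w := by
  have := hX.integral
  have := hX.proper
  have := hπ.affine
  have hV : IsAffineOpen (π ⁻¹ᵁ U) := hU.preimage π
  have : Nonempty U := ⟨⟨y, hy⟩⟩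
  have := hπ.nonempty_preimage π U
  have hfin : Finite G := Nat.finite_of_card_ne_zero (by
    rw [hG]; exact pow_ne_zero _ (Fact.out : p.Prime).ne_zero)
  let := (π.app U).hom.toAlgebra
  let := (scalar sX (π ⁻¹ᵁ U)).toAlgebra
  let := (scalar sY U).toAlgebra
  let := sectionAction π hπ.invariant U
  have hinj : Function.Injective (algebraMap Γ(Y, U) Γ(X, π ⁻¹ᵁ U)) := hπ.injective U
  have htower : IsScalarTower k Γ(Y, U) Γ(X, π ⁻¹ᵁ U) :=
    IsScalarTower.of_algebraMap_eq fun c => (scalar_app π hsY U c).symm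
  have hft : Algebra.FiniteType k Γ(X, π ⁻¹ᵁ U) := finiteType_scalar hV
  have hcomm : SMulCommClass G Γ(Y, U) Γ(X, π ⁻¹ᵁ U) := ⟨fun g a b => by
    rw [Algebra.smul_def, Algebra.smul_def, smul_mul']
    congr 1
    exact appLE_actHom_app π hπ.invariant U g⁻¹ a⟩
  have hinvar : Algebra.IsInvariant Γ(Y, U) Γ(X, π ⁻¹ᵁ U) G := ⟨fun b hb =>
    hπ.surjective U b fun g => by
      have h1 := hb g⁻¹
      change (actHom ρ g⁻¹⁻¹).appLE _ _ _ b = b at h1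
      have h2 : actHom ρ g⁻¹⁻¹ = actHom ρ g := by rw [inv_inv]
      rwa [appLE_of_eq h2 _ (GSheaf.preimage_invariant π hπ.invariant g U).ge] at h1⟩
  have hB := hX.isDedekindDomain hV
  have hdom : IsDomain Γ(Y, U) := hinj.isDomain _
  -- Integral over its invariants and of finite type over k, B is finite over A; this makes A
  -- Noetherian, and the dimension and normality of B pass down to A.
  have hint : Algebra.IsIntegral Γ(Y, U) Γ(X, π ⁻¹ᵁ U) := Algebra.IsInvariant.isIntegral _ _ G
  have hftA : Algebra.FiniteType Γ(Y, U) Γ(X, π ⁻¹ᵁ U) :=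
    Algebra.FiniteType.of_restrictScalars_finiteType k _ _
  have hfinA : Module.Finite Γ(Y, U) Γ(X, π ⁻¹ᵁ U) := Algebra.IsIntegral.finite
  have : IsNoetherianRing Γ(Y, U) := isNoetherianRing_of_finite hinj k
  have : Ring.DimensionLEOne Γ(Y, U) := dimensionLEOne_of_isIntegral hinj
  have : IsIntegrallyClosed Γ(Y, U) := isIntegrallyClosed_of_isInvariant hinj (G := G)
  have hA : IsDedekindDomain Γ(Y, U) := { }
  let : Module Γ(X, π ⁻¹ᵁ U) Γ((pushforward π).obj L.sheaf, U) :=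
    inferInstanceAs (Module Γ(X, π ⁻¹ᵁ U) Γ(L.sheaf, π ⁻¹ᵁ U))
  have htowerM : IsScalarTower Γ(Y, U) Γ(X, π ⁻¹ᵁ U) Γ((pushforward π).obj L.sheaf, U) :=
    IsScalarTower.of_algebraMap_smul fun _ _ => rfl
  have hMB : Module.Finite Γ(X, π ⁻¹ᵁ U) Γ((pushforward π).obj L.sheaf, U) :=
    hL.finite_sections hV
  have hMA : Module.Finite Γ(Y, U) Γ((pushforward π).obj L.sheaf, U) :=
    Module.Finite.trans Γ(X, π ⁻¹ᵁ U) _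
  have hMn : Nontrivial Γ((pushforward π).obj L.sheaf, U) := hL.nontrivial_sections hV
  let P : Ideal Γ(Y, U) :=
    (IsLocalRing.maximalIdeal (Y.presheaf.stalk y)).comap (Y.presheaf.germ U y hy).hom
  have hP : P.IsPrime := Ideal.comap_isPrime _ _
  obtain ⟨t, ⟨w, hw, rfl⟩, ht, f, hf, h⟩ := exists_generator_kernelImage
    (B := Γ(X, π ⁻¹ᵁ U)) (groupAlgebraEnd sY _ (L.act π hπ.invariant) U)
    (groupAlgebraEnd_smul sY (L.act π hπ.invariant) U)
    -- Semilinearity: pulling g • b back along the automorphism of g returns b, which is why the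
    -- action on functions uses g⁻¹.
    (fun g b m => by
      rw [groupAlgebraEnd_single, groupAlgebraEnd_single, map_one, one_smul, one_smul]
      have h1 := sec_smul_appLE (L.lin g) (GSheaf.preimage_invariant π hπ.invariant g U) (g • b) m
      refine Eq.trans ?_ h1
      refine congrArg (fun b' : Γ(X, π ⁻¹ᵁ U) => sec (L.lin g) (π ⁻¹ᵁ U) (π ⁻¹ᵁ U)
        (GSheaf.preimage_invariant π hπ.invariant g U) (b' • (show Γ(L.sheaf, π ⁻¹ᵁ U) from m))) ?_
      change b = (actHom ρ g).appLE _ _ _ ((actHom ρ g⁻¹).appLE _ _ _ b)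
      have h3 : actHom ρ (g⁻¹ * g) = actHom ρ 1 := by rw [inv_mul_cancel]
      rw [← appLE_actHom_mul π hπ.invariant, appLE_of_eq h3 _
        (GSheaf.preimage_invariant π hπ.invariant 1 U).ge, appLE_actHom_one])
    (fun b m => hL.eq_zero_of_smul_eq_zero b (show Γ(L.sheaf, π ⁻¹ᵁ U) from m))
    (fun m m' hm => hL.exists_smul_eq_smul hV m m' hm) hinj
    (fun g hg => by
      have h1 := eq_id_of_appLE_eq_id (actHom ρ g⁻¹) (hρX _) hV
        (GSheaf.preimage_invariant π hπ.invariant g⁻¹ U).ge hg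
      have h2 : ρ g⁻¹ = ρ 1 := Iso.ext (h1.trans (actHom_one ρ).symm)
      exact inv_eq_one.1 (hρ h2)) p v hG σ hσ j hj1 hj P
  refine ⟨w, hw, ht, f, ?_, fun z hz => h _ ⟨z, hz, rfl⟩⟩
  rw [Scheme.mem_basicOpen _ _ _ hy]
  by_contra h1
  exact hf h1

end affine

/-! ### Invertibility of the graded piece -/

section invertible

open Scheme.Modules

variable {k : Type u} [Field k] {G : Type u} [CommGroup G] {X Y : Scheme.{u}} {ρ : G →* Aut X}
  (π : X ⟶ Y)

lemma IsInvertible.of_iso {M N : Y.Modules} (e : M ≅ N) (hM : IsInvertible M) :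
    IsInvertible N := by
  intro x
  obtain ⟨U, hx, t, ht⟩ := hM x
  refine ⟨U, hx, e.hom.app U t, fun W i => ?_⟩
  have h1 : (fun r : Γ(Y, W) => r • N.presheaf.map i.op (e.hom.app U t)) =
      e.hom.app W ∘ fun r : Γ(Y, W) => r • M.presheaf.map i.op t := by
    funext r
    rw [Function.comp_apply, Scheme.Modules.Hom.app_smul, app_map]
  rw [h1]
  refine Function.Bijective.comp ?_ (ht W i)
  rw [Function.bijective_iff_has_inverse]
  have h2 : ∀ {M N : Y.Modules} (e : M ≅ N), Function.LeftInverse (e.inv.app W) (e.hom.app W) :=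
    fun e x => ConcreteCategory.congr_hom
      (congrArg (fun φ => Scheme.Modules.Hom.app φ W) e.hom_inv_id) x
  exact ⟨e.inv.app W, h2 e, h2 e.symm⟩

lemma IsQuotient.eq_zero_of_smul_eq_zero [IsIntegral X] (hπ : IsQuotient ρ π) {L : X.Modules}
    (hL : IsInvertible L) {U W : Y.Opens} (i : W ⟶ U) (t : Γ((pushforward π).obj L, U))
    (ht : t ≠ 0) (r : Γ(Y, W)) (h : r • ((pushforward π).obj L).presheaf.map i.op t = 0) :
    r = 0 := by
  refine hπ.injective W ?_
  rw [map_zero]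
  by_cases hne : Nonempty (π ⁻¹ᵁ W)
  · refine (hL.eq_zero_of_smul_eq_zero (π.app W r) _ h).resolve_right fun h1 => ht ?_
    exact hL.pushforward_map_injective π i (h1.trans (map_zero _).symm)
  · have h1 : π ⁻¹ᵁ W = ⊥ := by
      rw [← Opens.not_nonempty_iff_eq_bot]
      exact fun ⟨x, hx⟩ => hne ⟨⟨x, hx⟩⟩
    have : Subsingleton Γ(X, π ⁻¹ᵁ W) := by rw [h1]; infer_instance
    exact Subsingleton.elim _ _

/-- The generator t found over an affine U controls all smaller open sets: on D(f) every section of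
the graded piece is locally a multiple of t, with a unique coefficient, so the coefficients glue. -/
lemma IsQuotient.isInvertible_gr0 {sX : X ⟶ Spec (CommRingCat.of k)}
    {sY : Y ⟶ Spec (CommRingCat.of k)} (hX : IsProjectiveCurve sX) (hρ : Function.Injective ρ)
    (hρX : ∀ g, actHom ρ g ≫ sX = sX) (hπ : IsQuotient ρ π) (hsY : π ≫ sY = sX) (L : GSheaf ρ)
    (hL : IsInvertible L.sheaf) (p : ℕ) [Fact p.Prime] [CharP k p] (v : ℕ)
    (hG : Nat.card G = p ^ v) (σ : G) (hσ : ∀ g, g ∈ Subgroup.zpowers σ) (j : ℕ) (hj1 : 1 ≤ j)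
    (hj : j ≤ p ^ v) : IsInvertible (L.gr0 sY π hπ.invariant σ j) := by
  have := hX.integral
  have := hπ.affine
  intro y
  obtain ⟨U, hU, hy, -⟩ := exists_isAffineOpen_mem_and_subset (x := y) (U := ⊤) trivial
  obtain ⟨w, hw, ht, f, hyf, hgen⟩ := hπ.exists_generator π hX hρ hρX hsY L hL p v hG σ hσ j hj1 hj
    hU y hy
  let a := L.act π hπ.invariant
  let M := (pushforward π).obj L.sheaf
  let E : ∀ U : Y.Opens, MonoidAlgebra k G →+* AddMonoid.End Γ(M, U) := groupAlgebraEnd sY M a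
  let C := L.gr0 sY π hπ.invariant σ j
  let φ : C ⟶ M := grEval sY a σ j
  let j₀ : Y.basicOpen f ⟶ U := homOfLE (Y.basicOpen_le f)
  obtain ⟨x, hx⟩ : ∃ x : Γ(C, U), φ.app U x = E U (subOne k σ ^ (j - 1)) w :=
    grEval_exists sY a σ j U w hw
  set t : Γ(M, U) := E U (subOne k σ ^ (j - 1)) w with ht_def
  have hφ : ∀ (W : Y.Opens) (i : W ⟶ Y.basicOpen f) (r : Γ(Y, W)),
      φ.app W (r • C.presheaf.map i.op
        (C.presheaf.map j₀.op x)) =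
        r • M.presheaf.map (i ≫ j₀).op t := fun W i r => by
    rw [Scheme.Modules.Hom.app_smul, map_map]
    congr 1
    exact (app_map φ (i ≫ j₀) x).trans (congrArg _ hx)
  have hinj : ∀ (W : Y.Opens) (i : W ⟶ Y.basicOpen f) (r r' : Γ(Y, W)),
      r • M.presheaf.map (i ≫ j₀).op t = r' • M.presheaf.map (i ≫ j₀).op t → r = r' :=
    fun W i r r' h => by
      rw [← sub_eq_zero, ← sub_smul] at h
      exact sub_eq_zero.1 (hπ.eq_zero_of_smul_eq_zero π hL (i ≫ j₀) t ht _ h)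
  refine ⟨Y.basicOpen f, hyf, C.presheaf.map j₀.op x,
    fun W i => ⟨fun r r' h => hinj W i r r' ?_, fun z => ?_⟩⟩
  · rw [← hφ, ← hφ]
    exact congrArg _ h
  -- The generation statement concerns sections over U only. Near q a local preimage y' is
  -- multiplied by g^n to extend to U, the resulting relation is restricted to D(g), and f g^n, a
  -- unit there, is divided out.
  have hloc : ∀ q : W, ∃ (N : Y.Opens) (l : N ⟶ W) (r : Γ(Y, N)), q.1 ∈ N ∧
      r • M.presheaf.map (l ≫ i ≫ j₀).op t = M.presheaf.map l.op (φ.app W z) := by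
    rintro ⟨q, hq⟩
    obtain ⟨W', i', hq', y', hy1, hy2⟩ := (grEval_range sY a σ j W _).1 ⟨z, rfl⟩ q hq
    obtain ⟨g, hg, hqg⟩ := hU.exists_basicOpen_le ⟨q, hq'⟩ ((i ≫ j₀).le hq)
    let N := Y.basicOpen g
    let n₀ : N ⟶ U := homOfLE (Y.basicOpen_le g)
    let n₁ : N ⟶ W' := homOfLE hg
    obtain ⟨n, z', hz'⟩ := hL.pushforward_exists_map_eq_pow_smul π hU g rfl n₀
      (M.presheaf.map n₁.op y')
    have : Nonempty N := ⟨⟨q, hqg⟩⟩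
    have := hπ.nonempty_preimage π N
    have hz0 : E U (subOne k σ ^ j) z' = 0 := by
      refine hL.pushforward_map_injective π n₀ ?_
      refine (groupAlgebraEnd_map sY M a n₀ _ z').symm.trans ?_
      rw [hz', groupAlgebraEnd_smul, groupAlgebraEnd_map, hy1, map_zero,
        map_zero]
      exact smul_zero _
    obtain ⟨c, hc⟩ := hgen z' hz0
    have h1 : IsUnit (Y.presheaf.map n₀.op f) := by
      have h2 : N ≤ Y.basicOpen f := (homOfLE hg ≫ i' ≫ i).le
      have h3 := (RingedSpace.isUnit_res_basicOpen Y.toRingedSpace f).map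
        (Y.presheaf.map (homOfLE h2).op).hom
      rwa [← structure_map_map (homOfLE h2) j₀ n₀]
    have h4 : IsUnit (Y.presheaf.map n₀.op (g ^ n)) := by
      rw [map_pow]
      exact (RingedSpace.isUnit_res_basicOpen _ g).pow n
    obtain ⟨u, hu⟩ := (h1.mul h4).exists_left_inv
    refine ⟨N, n₁ ≫ i', u * Y.presheaf.map n₀.op c, hqg, ?_⟩
    have h5 := congrArg (M.presheaf.map n₀.op) hc
    rw [Scheme.Modules.map_smul, Scheme.Modules.map_smul, ← groupAlgebraEnd_map, hz',
      groupAlgebraEnd_smul, groupAlgebraEnd_map, hy2, smul_smul] at h5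
    rw [Subsingleton.elim ((n₁ ≫ i') ≫ i ≫ j₀) n₀, mul_smul]
    refine (congrArg (u • ·) h5.symm).trans ?_
    dsimp only
    rw [smul_smul, hu, one_smul, map_map]
    rfl
  choose N l r hq hr using hloc
  obtain ⟨r₀, hr₀, -⟩ := TopCat.Sheaf.existsUnique_gluing' Y.sheaf N W l
    (fun q hq' => Opens.mem_iSup.2 ⟨⟨q, hq'⟩, hq _⟩) r (fun q q' => by
      -- Torsion-freeness makes the coefficient of t unique, so the local coefficients agree on
      -- overlaps.
      refine hinj _ (Opens.infLELeft _ _ ≫ l q ≫ i) _ _ ?_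
      have h1 := congrArg (M.presheaf.map (Opens.infLELeft (N q) (N q')).op) (hr q)
      have h2 := congrArg (M.presheaf.map (Opens.infLERight (N q) (N q')).op) (hr q')
      rw [Scheme.Modules.map_smul, map_map, map_map] at h1 h2
      exact h1.trans h2.symm)
  refine ⟨r₀, grEval_injective sY a σ j W ((hφ W i r₀).trans (section_ext fun q hq' => ?_))⟩
  refine ⟨N ⟨q, hq'⟩, l ⟨q, hq'⟩, hq ⟨q, hq'⟩, ?_⟩
  refine Eq.trans ?_ (hr ⟨q, hq'⟩)
  refine (Scheme.Modules.map_smul M (l ⟨q, hq'⟩) r₀ _).trans ?_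
  rw [map_map]
  exact congrArg (· • M.presheaf.map (l ⟨q, hq'⟩ ≫ i ≫ j₀).op t) (hr₀ ⟨q, hq'⟩)

end invertible

end

end ModularSheaf

theorem mainTheorem8 {k : Type u} [Field k] [IsAlgClosed k] (p : ℕ) [Fact p.Prime] [CharP k p]
    {G : Type u} [CommGroup G] (v : ℕ) (hv : 2 ≤ v) (hG : Nat.card G = p ^ v)
    (σ : G) (hσ : ∀ g, g ∈ Subgroup.zpowers σ)
    (H : Subgroup G) (hH : Nat.card H = p ^ (v - 1))
    (τ : H) (hτ : ∀ h, h ∈ Subgroup.zpowers τ)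
    (ε : G ⧸ H) (hε : ∀ q, q ∈ Subgroup.zpowers ε)
    {X Z Y : Scheme.{u}} (sX : X ⟶ Spec (CommRingCat.of k)) (sZ : Z ⟶ Spec (CommRingCat.of k))
    (sY : Y ⟶ Spec (CommRingCat.of k)) (hX : IsProjectiveCurve sX)
    (ρ : G →* Aut X) (hρ : Function.Injective ρ) (hρX : ∀ g, actHom ρ g ≫ sX = sX)
    (ρZ : G ⧸ H →* Aut Z) (hρZ : ∀ q, actHom ρZ q ≫ sZ = sZ)
    (π : X ⟶ Y) (α : X ⟶ Z) (β : Z ⟶ Y)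
    (hπ : IsQuotient ρ π) (hα : IsQuotient (ρ.comp H.subtype) α) (hβ : IsQuotient ρZ β)
    (hαβ : α ≫ β = π) (hαeq : ∀ g : G, actHom ρ g ≫ α = α ≫ actHom ρZ (g : G ⧸ H))
    (hsZ : α ≫ sZ = sX) (hsY : β ≫ sY = sZ)
    (L : GSheaf ρ) (hL : IsInvertible L.sheaf)
    (j l j' : ℕ) (hj : j = (l - 1) * p + j')
    (hl : 1 ≤ l) (hl' : l ≤ p ^ (v - 1)) (hj1 : 1 ≤ j') (hj' : j' ≤ p) :
    IsInvertible (L.gr0 sY π hπ.invariant σ j) ∧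
    IsInvertible ((L.gr0Residual sZ hρZ α hα.invariant hαeq hτ l).gr0 sY β hβ.invariant ε j') ∧
    Nonempty (L.gr0 sY π hπ.invariant σ j ≅
      (L.gr0Residual sZ hρZ α hα.invariant hαeq hτ l).gr0 sY β hβ.invariant ε j') := by
  subst hαβ
  have := hX.integral
  have := hα.affine
  have := hβ.affine
  have hp := (Fact.out : p.Prime).pos
  -- The bounds l ≤ p^(v-1) and j' ≤ p keep j within the range where the trace lies in the graded
  -- piece.
  have hjv : j ≤ p ^ v := by
    calc j ≤ (l - 1) * p + p := by omega
      _ = l * p := by rw [← Nat.succ_mul, Nat.succ_eq_add_one, Nat.sub_add_cancel hl]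
      _ ≤ p ^ (v - 1) * p := Nat.mul_le_mul_right p hl'
      _ = p ^ v := by rw [← pow_succ, Nat.sub_add_cancel (by omega)]
  have h1 : IsInvertible (L.gr0 sY (α ≫ β) hπ.invariant σ j) :=
    hπ.isInvertible_gr0 (α ≫ β) hX hρ hρX (by rw [Category.assoc, hsY, hsZ]) L hL p v hG σ hσ j
      (by omega) hjv
  obtain ⟨e⟩ := nonempty_gr0_iso L sZ hρZ sY α hα.invariant hαeq β hβ.invariant hπ.invariant hτ l ε
    j' hL p v hv hG σ hσ hH hε j hj hl hj1 hj'
  exact ⟨h1, h1.of_iso e, ⟨e⟩⟩
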